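/- **Theorem ($\mathsf{RCA}_0$).** Cousin's lemma for Baire 1 functions, $\mathsf{CL}_{\mathrm{B1}}$, implies the sequential completeness $\mathsf{SC}$ of the reals in $[0,1]$, and implies $\mathsf{ACA}_0$. That is, every model $M$ of $\mathsf{RCA}_0$ (an arbitrary, possibly nonstandard, structure for the two-sorted language of second-order arithmetic satisfying the basic axioms, $\Sigma^0_1$ induction and $\Delta^0_1$ comprehension) in which $\mathsf{CL}_{\mathrm{B1}}$ holds satisfies $\mathsf{SC}$ and is a model of $\mathsf{ACA}_0$. Here all notions are interpreted inside $M$, as follows. A pair of numbers is coded by $(m,n)=(m+n)^2+m$; integers are coded by least pairs representing differences, and rationals by least pairs representing fractions. A *real number* is a sequence of rationals $(q_i)$ with $|q_m-q_n|\le 2^{-m}$ for all $m\le n$; further $(q_i)\le(q_i')$ means $q_k\le q_k'+2^{-k+1}$ for all $k$, and $x<y$ means $\neg(y\le x)$. A *(total) continuous function* $f\colon[0,1]\to\mathbb R$ is a set of pairs $(U,V)$, where $U$ is a nonempty interval $(p,q)\cap[0,1]$ and $V$ an open interval, both with rational endpoints (read: $f(U)\subseteq V$), such that any two $V,V'$ paired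 with the same $U$ intersect, the set is closed under shrinking $U$ and enlarging $V$, and for every real $x\in[0,1]$ and rational $\varepsilon>0$ it contains a pair $(U,V)$ with $x\in U$ and $V$ of length at most $\varepsilon$; $f(x)$ is the real, unique up to equality of reals, lying in the closure of every $V$ with $(U,V)\in f$, $x\in U$. A *Baire 1 function* $f\colon[0,1]\to\mathbb R$ is a sequence $(f_n)$ of total continuous functions that is pointwise Cauchy: for every real $x\in[0,1]$ and rational $\varepsilon>0$, $|f_m(x)-f_n(x)|\le\varepsilon$ for all sufficiently large $m,n$. (The limit need not exist.) Write $f(x)\ge y$ if for every rational $q<y$ one has $f_m(x)>q$ for all sufficiently large $m$; write $f(x)\le y$ if for every rational $q>y$ one has $f_m(x)<q$ for all sufficiently large $m$; and $f(x)>y$ if not $f(x)\le y$. A *Baire 1 gauge* is a Baire 1 function $\delta$ with $\delta(x)>0$ for all $x\in[0,1]$. A *tagged partition* of $[0,1]$ is a finite sequence of reals $\langle x_0,t_0,x_1,\dots,t_{\ell-1},x_\ell\rangle$ with $0=x_0<x_1<\dots<x_\ell=1$ and $x_j\le t_j\le x_{j+1}$ for $j<\ell$. It is *$\delta$-fine*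 if $\delta(t_j)\ge t_j-x_j$ and $\delta(t_j)\ge x_{j+1}-t_j$ for all $j<\ell$. - $\mathsf{CL}_{\mathrm{B1}}$: every Baire 1 gauge on $[0,1]$ has a $\delta$-fine tagged partition. - $\mathsf{SC}$: every Cauchy sequence of reals in $[0,1]$ has a limit in $[0,1]$. - $\mathsf{ACA}_0$: the basic axioms, the induction axiom for sets, and comprehension for all arithmetical formulas. -/

import Mathlib

universe u v

namespace SOA

/-! ## Structures and arithmetical formulas of second-order arithmetic -/

/-- A structure for the two-sorted language of second-order arithmetic: an arbitrary (possibly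
nonstandard) number sort with `0, 1, +, ·, <`, and a collection of subsets of the number sort over
which the set variables range. -/
structure L2Structure where
  Num : Type u
  zero : Num
  one : Num
  add : Num → Num → Num
  mul : Num → Num → Num
  lt : Num → Num → Prop
  sets : Set (Set Num)

/-- Numerical terms; variables are de Bruijn indices. -/
inductive NumTerm : Type
  | var (i : ℕ)
  | zero
  | one
  | add (s t : NumTerm)
  | mul (s t : NumTerm)

/-- Renaming `x_i ↦ x_{i+1}`, so that the new variable `x_0` does not occur in the term. -/
def NumTerm.lift : NumTerm → NumTerm
  | .var i => .var (i + 1)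
  | .zero => .zero
  | .one => .one
  | .add s t => .add s.lift t.lift
  | .mul s t => .mul s.lift t.lift

/-- Arithmetical formulas (no set quantifiers) with set parameters from `σ`; the quantifiers `all`
and `ex` bind the variable `0`. -/
inductive ArithFormula (σ : Type v) : Type v
  | eq (s t : NumTerm)
  | lt (s t : NumTerm)
  | mem (s : NumTerm) (X : σ)
  | neg (φ : ArithFormula σ)
  | and (φ ψ : ArithFormula σ)
  | or (φ ψ : ArithFormula σ)
  | imp (φ ψ : ArithFormula σ)
  | iff (φ ψ : ArithFormula σ)
  | all (φ : ArithFormula σ)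
  | ex (φ : ArithFormula σ)

namespace ArithFormula

/-- `Σ⁰₀` formulas: every quantifier is of the form `∀ x < t` or `∃ x < t`, with `x` not in `t`. -/
inductive IsBounded {σ : Type v} : ArithFormula σ → Prop
  | eq (s t : NumTerm) : IsBounded (.eq s t)
  | lt (s t : NumTerm) : IsBounded (.lt s t)
  | mem (s : NumTerm) (X : σ) : IsBounded (.mem s X)
  | neg {φ : ArithFormula σ} : IsBounded φ → IsBounded (.neg φ)
  | and {φ ψ : ArithFormula σ} : IsBounded φ → IsBounded ψ → IsBounded (.and φ ψ)
  | or {φ ψ : ArithFormula σ} : IsBounded φ → IsBounded ψ → IsBounded (.or φ ψ)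
  | imp {φ ψ : ArithFormula σ} : IsBounded φ → IsBounded ψ → IsBounded (.imp φ ψ)
  | iff {φ ψ : ArithFormula σ} : IsBounded φ → IsBounded ψ → IsBounded (.iff φ ψ)
  | ball (t : NumTerm) {φ : ArithFormula σ} :
      IsBounded φ → IsBounded (.all (.imp (.lt (.var 0) t.lift) φ))
  | bex (t : NumTerm) {φ : ArithFormula σ} :
      IsBounded φ → IsBounded (.ex (.and (.lt (.var 0) t.lift) φ))

/-- `Σ⁰₁` formulas: a block of existential number quantifiers before a `Σ⁰₀` formula. -/
inductive IsSigma1 {σ : Type v} : ArithFormula σ → Prop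
  | bounded {φ : ArithFormula σ} : IsBounded φ → IsSigma1 φ
  | ex {φ : ArithFormula σ} : IsSigma1 φ → IsSigma1 (.ex φ)

/-- `Π⁰₁` formulas: a block of universal number quantifiers before a `Σ⁰₀` formula. -/
inductive IsPi1 {σ : Type v} : ArithFormula σ → Prop
  | bounded {φ : ArithFormula σ} : IsBounded φ → IsPi1 φ
  | all {φ : ArithFormula σ} : IsPi1 φ → IsPi1 (.all φ)

end ArithFormula

/-- The assignment `x_0 ↦ a`, `x_{i+1} ↦ e i`. -/
def scons {α : Type u} (a : α) (e : ℕ → α) : ℕ → α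
  | 0 => a
  | i + 1 => e i

namespace L2Structure

instance (M : L2Structure.{u}) : Zero M.Num := ⟨M.zero⟩
instance (M : L2Structure.{u}) : One M.Num := ⟨M.one⟩
instance (M : L2Structure.{u}) : Add M.Num := ⟨M.add⟩
instance (M : L2Structure.{u}) : Mul M.Num := ⟨M.mul⟩
instance (M : L2Structure.{u}) : LT M.Num := ⟨M.lt⟩
instance (M : L2Structure.{u}) : LE M.Num := ⟨fun a b => a < b ∨ a = b⟩

/-- Value of a term under an assignment. -/
def termVal (M : L2Structure.{u}) (e : ℕ → M.Num) : NumTerm → M.Num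
  | .var i => e i
  | .zero => 0
  | .one => 1
  | .add s t => M.termVal e s + M.termVal e t
  | .mul s t => M.termVal e s * M.termVal e t

/-- Truth in `M` of an arithmetical formula with set parameters from `M`. -/
def Holds (M : L2Structure.{u}) : ArithFormula M.sets → (ℕ → M.Num) → Prop
  | .eq s t, e => M.termVal e s = M.termVal e t
  | .lt s t, e => M.termVal e s < M.termVal e t
  | .mem s X, e => M.termVal e s ∈ X.1
  | .neg φ, e => ¬ M.Holds φ e
  | .and φ ψ, e => M.Holds φ e ∧ M.Holds ψ e
  | .or φ ψ, e => M.Holds φ e ∨ M.Holds ψ e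
  | .imp φ ψ, e => M.Holds φ e → M.Holds ψ e
  | .iff φ ψ, e => M.Holds φ e ↔ M.Holds ψ e
  | .all φ, e => ∀ a : M.Num, M.Holds φ (scons a e)
  | .ex φ, e => ∃ a : M.Num, M.Holds φ (scons a e)

/-! ## The systems `RCA₀` and `ACA₀` -/

/-- The basic axioms of second-order arithmetic. -/
structure BasicAxioms (M : L2Structure.{u}) : Prop where
  succ_ne_zero : ∀ n : M.Num, n + 1 ≠ 0
  succ_inj : ∀ m n : M.Num, m + 1 = n + 1 → m = n
  add_zero : ∀ m : M.Num, m + 0 = m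
  add_succ : ∀ m n : M.Num, m + (n + 1) = (m + n) + 1
  mul_zero : ∀ m : M.Num, m * 0 = 0
  mul_succ : ∀ m n : M.Num, m * (n + 1) = m * n + m
  not_lt_zero : ∀ m : M.Num, ¬ m < 0
  lt_succ : ∀ m n : M.Num, m < n + 1 ↔ (m < n ∨ m = n)

/-- `M` is a model of `RCA₀`: basic axioms, `Σ⁰₁` induction and `Δ⁰₁` comprehension, both with
number and set parameters. -/
structure ModelsRCA0 (M : L2Structure.{u}) : Prop where
  basic : M.BasicAxioms
  sigma1_induction : ∀ φ : ArithFormula M.sets, φ.IsSigma1 → ∀ e : ℕ → M.Num,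
    M.Holds φ (scons 0 e) →
    (∀ n : M.Num, M.Holds φ (scons n e) → M.Holds φ (scons (n + 1) e)) →
    ∀ n : M.Num, M.Holds φ (scons n e)
  delta1_comprehension : ∀ φ ψ : ArithFormula M.sets, φ.IsSigma1 → ψ.IsPi1 → ∀ e : ℕ → M.Num,
    (∀ n : M.Num, M.Holds φ (scons n e) ↔ M.Holds ψ (scons n e)) →
    {n : M.Num | M.Holds φ (scons n e)} ∈ M.sets

/-- `M` is a model of `ACA₀`: basic axioms, the induction axiom for sets and comprehension for all
arithmetical formulas with number and set parameters. -/
structure ModelsACA0 (M : L2Structure.{u}) : Prop where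
  basic : M.BasicAxioms
  induction : ∀ X ∈ M.sets, (0 : M.Num) ∈ X → (∀ n ∈ X, n + 1 ∈ X) → ∀ n, n ∈ X
  arith_comprehension : ∀ (φ : ArithFormula M.sets) (e : ℕ → M.Num),
    {n : M.Num | M.Holds φ (scons n e)} ∈ M.sets

/-! ## Coding in `M`: pairs, functions, integers, rationals -/

/-- The code of the pair `(m, n)`. -/
def pair {M : L2Structure.{u}} (m n : M.Num) : M.Num := (m + n) * (m + n) + m

/-- The `n`-th member of the sequence of sets coded by `Z`. -/
def sect {M : L2Structure.{u}} (Z : Set M.Num) (n : M.Num) : Set M.Num := {m | pair m n ∈ Z}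

/-- `F` is (the graph of) a function `X → Y`. -/
def IsFunction {M : L2Structure.{u}} (F X Y : Set M.Num) : Prop :=
  (∀ c ∈ F, ∃ x ∈ X, ∃ y ∈ Y, c = pair x y) ∧ ∀ x ∈ X, ∃! y, y ∈ Y ∧ pair x y ∈ F

/-- `v = 2 ^ m`: the function `n ↦ 2 ^ n`, given by its recursion equations, sends `m` to `v`. -/
def IsPow2 {M : L2Structure.{u}} (m v : M.Num) : Prop :=
  ∃ E ∈ M.sets, IsFunction E Set.univ Set.univ ∧ pair 0 1 ∈ E ∧
    (∀ n y : M.Num, pair n y ∈ E → pair (n + 1) (y + y) ∈ E) ∧ pair m v ∈ E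

/-- A formal difference `pos - neg`, in no normal form. -/
@[ext]
structure PreInt (M : L2Structure.{u}) where
  pos : M.Num
  neg : M.Num

namespace PreInt

variable {M : L2Structure.{u}}

def code (z : PreInt M) : M.Num := pair z.pos z.neg
def ofNum (n : M.Num) : PreInt M := ⟨n, 0⟩
def add (z w : PreInt M) : PreInt M := ⟨z.pos + w.pos, z.neg + w.neg⟩
def opp (z : PreInt M) : PreInt M := ⟨z.neg, z.pos⟩
def mul (z w : PreInt M) : PreInt M :=
  ⟨z.pos * w.pos + z.neg * w.neg, z.pos * w.neg + z.neg * w.pos⟩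
def Equiv (z w : PreInt M) : Prop := z.pos + w.neg = z.neg + w.pos
def Lt (z w : PreInt M) : Prop := z.pos + w.neg < w.pos + z.neg

/-- `z` is an integer: the pair with the least code in its class. -/
def IsInt (z : PreInt M) : Prop := ∀ w : PreInt M, w.Equiv z → z.code ≤ w.code

end PreInt

/-- A formal fraction, in no normal form. The operations and relations below are meant for fractions
with positive denominator, the only ones that occur. -/
@[ext]
structure PreRat (M : L2Structure.{u}) where
  num : PreInt M
  den : PreInt M

namespace PreRat

variable {M : L2Structure.{u}}

def code (q : PreRat M) : M.Num := pair q.num.code q.den.code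
/-- The fraction `a / b` of two numbers. -/
def ofNums (a b : M.Num) : PreRat M := ⟨.ofNum a, .ofNum b⟩
def add (q r : PreRat M) : PreRat M := ⟨(q.num.mul r.den).add (r.num.mul q.den), q.den.mul r.den⟩
def opp (q : PreRat M) : PreRat M := ⟨q.num.opp, q.den⟩
def sub (q r : PreRat M) : PreRat M := q.add r.opp
def Equiv (q r : PreRat M) : Prop := (q.num.mul r.den).Equiv (q.den.mul r.num)
def Lt (q r : PreRat M) : Prop := (q.num.mul r.den).Lt (r.num.mul q.den)
def Le (q r : PreRat M) : Prop := ¬ r.Lt q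
open Classical in
noncomputable def abs (q : PreRat M) : PreRat M := if q.Lt (ofNums 0 1) then q.opp else q

/-- A fraction of integers with positive denominator. -/
def IsFrac (q : PreRat M) : Prop := q.num.IsInt ∧ q.den.IsInt ∧ (PreInt.ofNum 0).Lt q.den

/-- `q` is a rational number: the fraction with the least code in its class. -/
def IsRat (q : PreRat M) : Prop :=
  q.IsFrac ∧ ∀ r : PreRat M, r.IsFrac → r.Equiv q → q.code ≤ r.code

end PreRat

/-- The rational numbers of `M`. -/
abbrev Rat (M : L2Structure.{u}) := {q : PreRat M // q.IsRat}

/-- The set of codes of rational numbers of `M`. -/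
def ratCodes (M : L2Structure.{u}) : Set M.Num := {c | ∃ q : M.Rat, c = q.1.code}

/-! ## Real numbers of `M` -/

section Reals

variable {M : L2Structure.{u}}

/-- The `k`-th term of the sequence of rationals `A` is `q`. -/
def At (A : Set M.Num) (k : M.Num) (q : M.Rat) : Prop := pair k q.1.code ∈ A

/-- `A` is a real number of `M`: a sequence of rationals with `|q_m - q_n| ≤ 2 ^ (-m)` for
`m ≤ n`. -/
def IsReal (A : Set M.Num) : Prop :=
  A ∈ M.sets ∧ IsFunction A Set.univ M.ratCodes ∧
    ∀ (m n : M.Num) (a b : M.Rat), m ≤ n → At A m a → At A n b →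
      ∃ v, IsPow2 m v ∧ (a.1.sub b.1).abs.Le (.ofNums 1 v)

/-- `A =_ℝ B`: `|a_k - b_k| ≤ 2 ^ (-k+1)` for all `k`. -/
def RealEq (A B : Set M.Num) : Prop :=
  ∀ (k : M.Num) (a b : M.Rat), At A k a → At B k b →
    ∃ v, IsPow2 k v ∧ (a.1.sub b.1).abs.Le (.ofNums (1 + 1) v)

/-- `A ≤_ℝ B`: `a_k ≤ b_k + 2 ^ (-k+1)` for all `k`. -/
def RealLe (A B : Set M.Num) : Prop :=
  ∀ (k : M.Num) (a b : M.Rat), At A k a → At B k b →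
    ∃ v, IsPow2 k v ∧ a.1.Le (b.1.add (.ofNums (1 + 1) v))

def RealLt (A B : Set M.Num) : Prop := ¬ RealLe B A

/-- A rational as a constant sequence. -/
def constReal (q : PreRat M) : Set M.Num :=
  {c | ∃ (k : M.Num) (a : M.Rat), a.1.Equiv q ∧ c = pair k a.1.code}

/-- Subtraction of reals; the terms are taken at `k + 1` to keep the rate of convergence. -/
def realSub (A B : Set M.Num) : Set M.Num :=
  {c | ∃ (k : M.Num) (a b d : M.Rat), At A (k + 1) a ∧ At B (k + 1) b ∧
    d.1.Equiv (a.1.sub b.1) ∧ c = pair k d.1.code}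

def realAbs (A : Set M.Num) : Set M.Num :=
  {c | ∃ (k : M.Num) (a d : M.Rat), At A k a ∧ d.1.Equiv a.1.abs ∧ c = pair k d.1.code}

/-- `|A - B| ≤ ε` for reals `A, B` and a rational `ε`. -/
def DistLe (A B : Set M.Num) (ε : M.Rat) : Prop :=
  RealLe (realAbs (realSub A B)) (constReal ε.1)

def RatPos (ε : M.Rat) : Prop := (PreRat.ofNums 0 1).Lt ε.1

/-- `A` is a real number of `M` in `[0,1]`. -/
def InUnit (A : Set M.Num) : Prop :=
  IsReal A ∧ RealLe (constReal (.ofNums 0 1)) A ∧ RealLe A (constReal (.ofNums 1 1))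

/-! ## Codes of continuous functions on `[0,1]` -/

/-- `(p, q)` codes a nonempty interval `U = (p,q) ∩ [0,1]`: `max p 0 < min q 1`. -/
def UnitInterval (p q : M.Rat) : Prop :=
  p.1.Lt q.1 ∧ p.1.Lt (.ofNums 1 1) ∧ (PreRat.ofNums 0 1).Lt q.1

/-- `(p',q') ∩ [0,1] ⊆ (p,q) ∩ [0,1]`. -/
def UnitIntervalSub (p' q' p q : M.Rat) : Prop :=
  (p.1.Lt (.ofNums 0 1) ∨ p.1.Le p'.1) ∧ ((PreRat.ofNums 1 1).Lt q.1 ∨ q'.1.Le q.1)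

/-- `x ∈ (p,q) ∩ [0,1]`. -/
def InInterval (x : Set M.Num) (p q : M.Rat) : Prop :=
  InUnit x ∧ RealLt (constReal p.1) x ∧ RealLt x (constReal q.1)

/-- Code of the pair `(U, V)` with `U = (p,q) ∩ [0,1]` and `V = (r,s)`. -/
def boxCode (p q r s : M.Rat) : M.Num :=
  pair (pair p.1.code q.1.code) (pair r.1.code s.1.code)

/-- `F` codes a partial continuous function `[0,1] → ℝ`: a set of pairs `(U, V)`, to be read as
`f(U) ⊆ V`, such that all `V` for one `U` meet, and closed under shrinking `U` and enlarging `V`. -/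
structure IsContinuous (F : Set M.Num) : Prop where
  mem_sets : F ∈ M.sets
  codes : ∀ c ∈ F, ∃ p q r s : M.Rat, UnitInterval p q ∧ r.1.Lt s.1 ∧ c = boxCode p q r s
  consistent : ∀ p q r s r' s' : M.Rat, boxCode p q r s ∈ F → boxCode p q r' s' ∈ F →
    r.1.Lt s'.1 ∧ r'.1.Lt s.1
  shrink : ∀ p q r s p' q' : M.Rat, boxCode p q r s ∈ F → UnitInterval p' q' →
    UnitIntervalSub p' q' p q → boxCode p' q' r s ∈ F
  enlarge : ∀ p q r s r' s' : M.Rat, boxCode p q r s ∈ F → r'.1.Lt s'.1 →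
    r'.1.Le r.1 → s.1.Le s'.1 → boxCode p q r' s' ∈ F

/-- Every real of `M` in `[0,1]` is in the domain of `F`. -/
def IsTotal (F : Set M.Num) : Prop :=
  ∀ x : Set M.Num, InUnit x → ∀ ε : M.Rat, RatPos ε →
    ∃ p q r s : M.Rat, boxCode p q r s ∈ F ∧ InInterval x p q ∧ (s.1.sub r.1).Le ε.1

/-- `y = f(x)`, where `f` is coded by `F`: the real `y` lies in the closure of every `V` with
`(U, V) ∈ F` and `x ∈ U`. For `x` in the domain this determines `y` up to `=_ℝ`. -/
def IsValue (F x y : Set M.Num) : Prop :=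
  IsReal y ∧ ∀ p q r s : M.Rat, boxCode p q r s ∈ F → InInterval x p q →
    RealLe (constReal r.1) y ∧ RealLe y (constReal s.1)

/-! ## Baire 1 functions, gauges and partitions -/

/-- `D` codes a Baire 1 function: a sequence of total continuous functions that is pointwise
Cauchy. -/
structure IsBaire1 (D : Set M.Num) : Prop where
  mem_sets : D ∈ M.sets
  continuous : ∀ n : M.Num, IsContinuous (sect D n)
  total : ∀ n : M.Num, IsTotal (sect D n)
  cauchy : ∀ x : Set M.Num, InUnit x → ∀ ε : M.Rat, RatPos ε →
    ∃ N : M.Num, ∀ m n : M.Num, N ≤ m → N ≤ n →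
      ∃ y z : Set M.Num, IsValue (sect D m) x y ∧ IsValue (sect D n) x z ∧ DistLe y z ε

/-- `f(x) ≥ y`: for every rational `q < y`, `f_m(x) > q` for all sufficiently large `m`. -/
def Baire1Ge (D x y : Set M.Num) : Prop :=
  ∀ q : M.Rat, RealLt (constReal q.1) y → ∃ N : M.Num, ∀ m : M.Num, N ≤ m →
    ∃ w : Set M.Num, IsValue (sect D m) x w ∧ RealLt (constReal q.1) w

/-- `f(x) ≤ y`: for every rational `q > y`, `f_m(x) < q` for all sufficiently large `m`. -/
def Baire1Le (D x y : Set M.Num) : Prop :=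
  ∀ q : M.Rat, RealLt y (constReal q.1) → ∃ N : M.Num, ∀ m : M.Num, N ≤ m →
    ∃ w : Set M.Num, IsValue (sect D m) x w ∧ RealLt w (constReal q.1)

/-- `f(x) > 0`, that is, not `f(x) ≤ 0`, for all `x ∈ [0,1]`. -/
def IsGauge (D : Set M.Num) : Prop :=
  ∀ x : Set M.Num, InUnit x → ¬ Baire1Le D x (constReal (.ofNums 0 1))

/-- The partition point `x_j` of the finite sequence of reals `x_0, t_0, x_1, …, t_{ℓ-1}, x_ℓ`
coded by `P`. -/
def node (P : Set M.Num) (j : M.Num) : Set M.Num := sect P (j + j)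

/-- The tag `t_j` of the finite sequence of reals coded by `P`. -/
def tag (P : Set M.Num) (j : M.Num) : Set M.Num := sect P (j + j + 1)

/-- `P` codes a tagged partition of `[0,1]` of size `ℓ` (a number of `M`): reals with
`0 = x_0 < x_1 < ⋯ < x_ℓ = 1` and `x_j ≤ t_j ≤ x_{j+1}`. -/
structure IsTaggedPartition (P : Set M.Num) (ℓ : M.Num) : Prop where
  mem_sets : P ∈ M.sets
  real : ∀ i : M.Num, i ≤ ℓ + ℓ → IsReal (sect P i)
  first : RealEq (node P 0) (constReal (.ofNums 0 1))
  last : RealEq (node P ℓ) (constReal (.ofNums 1 1))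
  lt : ∀ j : M.Num, j < ℓ → RealLt (node P j) (node P (j + 1))
  le_tag : ∀ j : M.Num, j < ℓ → RealLe (node P j) (tag P j)
  tag_le : ∀ j : M.Num, j < ℓ → RealLe (tag P j) (node P (j + 1))

/-- The partition is `δ`-fine: `δ(t_j) ≥ t_j - x_j` and `δ(t_j) ≥ x_{j+1} - t_j` for all
`j < ℓ`. -/
def IsFine (D P : Set M.Num) (ℓ : M.Num) : Prop :=
  ∀ j : M.Num, j < ℓ →
    Baire1Ge D (tag P j) (realSub (tag P j) (node P j)) ∧
    Baire1Ge D (tag P j) (realSub (node P (j + 1)) (tag P j))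

end Reals

/-! ## The two principles -/

/-- `M` satisfies Cousin's lemma for Baire 1 functions. -/
def CousinBaire1 (M : L2Structure.{u}) : Prop :=
  ∀ D : Set M.Num, IsBaire1 D → IsGauge D →
    ∃ (P : Set M.Num) (ℓ : M.Num), IsTaggedPartition P ℓ ∧ IsFine D P ℓ

/-- `M` satisfies sequential completeness: every Cauchy sequence of reals in `[0,1]` has a limit
in `[0,1]`. -/
def SeqComplete (M : L2Structure.{u}) : Prop :=
  ∀ Z ∈ M.sets, (∀ n : M.Num, InUnit (sect Z n)) →
    (∀ ε : M.Rat, RatPos ε → ∃ N : M.Num, ∀ m n : M.Num, N ≤ m → N ≤ n →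
      DistLe (sect Z m) (sect Z n) ε) →
    ∃ z : Set M.Num, InUnit z ∧ ∀ ε : M.Rat, RatPos ε → ∃ N : M.Num, ∀ n : M.Num, N ≤ n →
      DistLe (sect Z n) z ε

end L2Structure

end SOA

/-!
Let a set `Θ` of the model enumerate a `Σ⁰₁` set `A` of its numbers, and let `aₙ` be the sum of
`2 ^ (-k - 1)` over the `k < n` enumerated before stage `n`. The functions `x ↦ |x - aₙ| / 2` form a
Baire 1 function `δ` with limit `|x - s| / 2`, where `s = sup aₙ` need not exist in the model. If
`A` is not a set of the model, then `s` is not a real of the model, since the binary digits of `s`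
decide `A`; hence `δ` is a gauge. A `δ`-fine tagged partition is then impossible. Indeed, if
`xⱼ < s`, then fineness excludes `s ≤ tⱼ`, because `tⱼ - xⱼ` exceeds `(tⱼ - s) / 2`, and `tⱼ < s`
gives `xⱼ₊₁ ≤ tⱼ + (s - tⱼ) / 2 < s`. The statement `xⱼ < s` is `Σ⁰₁`, being `∃ n, xⱼ < aₙ`, so by
induction `1 = x_ℓ < s ≤ 1`. Thus `Σ⁰₁` comprehension holds. It yields arithmetical comprehension,
and a modulus of convergence for every Cauchy sequence.
-/
namespace SOA

/-! ## The ordered field of fractions of an ordered semiring -/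

section Fractions

open scoped TensorProduct

variable (R : Type*) [CommSemiring R]

/-- The ring of formal differences of elements of a commutative semiring. Extension of scalars from
`ℕ` to `ℤ` adjoins negatives, and its ring structure is already available. -/
def DifferenceRing := ℤ ⊗[ℕ] R

noncomputable instance : CommRing (DifferenceRing R) := inferInstanceAs (CommRing (ℤ ⊗[ℕ] R))

variable {R}

/-- The canonical map from a semiring to its ring of differences. -/
def toDifferenceRing : R →+* DifferenceRing R :=
  (Algebra.TensorProduct.includeRight : R →ₐ[ℕ] ℤ ⊗[ℕ] R).toRingHom

/-- The map into the Grothendieck group of the addition, injective by cancellation, factors through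
`toDifferenceRing`. -/
theorem toDifferenceRing_injective [IsCancelAdd R] :
    Function.Injective (toDifferenceRing (R := R)) := by
  let smulOf : ℤ →ₗ[ℕ] R →ₗ[ℕ] Algebra.GrothendieckAddGroup R :=
    LinearMap.mk₂ ℕ (fun z n => z • Algebra.GrothendieckAddGroup.of n)
      (fun a b n => add_smul a b _) (fun c a n => by simp [mul_smul])
      (fun a m n => by simp) (fun c a n => by simp only [map_nsmul]; exact smul_comm _ _ _)
  have lift_toDifferenceRing (n : R) :
      TensorProduct.lift smulOf (toDifferenceRing n) = Algebra.GrothendieckAddGroup.of n := by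
    change TensorProduct.lift smulOf ((1 : ℤ) ⊗ₜ[ℕ] n) = _
    simp [smulOf]
  intro a b h
  have lift_eq := congrArg (TensorProduct.lift smulOf) h
  rw [lift_toDifferenceRing, lift_toDifferenceRing] at lift_eq
  exact Algebra.GrothendieckAddGroup.of_injective lift_eq

theorem exists_toDifferenceRing_sub (x : DifferenceRing R) :
    ∃ a b : R, x = toDifferenceRing a - toDifferenceRing b := by
  induction x using TensorProduct.induction_on with
  | zero => exact ⟨0, 0, (sub_self _).symm⟩
  | tmul z n =>
    have natCast_tmul (k : ℕ) : (k : ℤ) ⊗ₜ[ℕ] n = toDifferenceRing (k • n) := by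
      change _ = (1 : ℤ) ⊗ₜ[ℕ] (k • n)
      rw [← nsmul_one]
      exact TensorProduct.smul_tmul _ _ _
    obtain ⟨k, rfl | rfl⟩ := z.eq_nat_or_neg
    · exact ⟨k • n, 0, by rw [natCast_tmul, map_zero, sub_zero]⟩
    · exact ⟨0, k • n, by
        rw [map_zero, zero_sub, ← natCast_tmul]; exact TensorProduct.neg_tmul _ _⟩
  | add x y hx hy =>
    obtain ⟨a, b, hx⟩ := hx
    obtain ⟨c, d, hy⟩ := hy
    refine ⟨a + c, b + d, (congrArg₂ (fun x y : DifferenceRing R => x + y) hx hy).trans ?_⟩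
    simp only [map_add]
    ring

variable [LinearOrder R]

theorem exists_eq_or_neg_toDifferenceRing [ExistsAddOfLE R] (x : DifferenceRing R) :
    ∃ a : R, x = toDifferenceRing a ∨ x = -toDifferenceRing a := by
  obtain ⟨a, b, rfl⟩ := exists_toDifferenceRing_sub x
  rcases le_total a b with h | h <;> obtain ⟨c, rfl⟩ := exists_add_of_le h
  · exact ⟨c, .inr (by simp)⟩
  · exact ⟨c, .inl (by simp)⟩

variable [IsStrictOrderedRing R] [CanonicallyOrderedAdd R]

theorem dvd_of_toDifferenceRing_dvd {a b : R} (h : toDifferenceRing a ∣ toDifferenceRing b) :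
    a ∣ b := by
  obtain ⟨x, hx⟩ := h
  obtain ⟨c, rfl | rfl⟩ := exists_eq_or_neg_toDifferenceRing x
  · rw [← map_mul] at hx
    exact ⟨c, toDifferenceRing_injective hx⟩
  · have sum_eq_zero : toDifferenceRing (b + a * c) = toDifferenceRing 0 := by
      rw [map_add, hx, map_mul, map_zero]
      ring
    rw [(add_eq_zero.1 (toDifferenceRing_injective sum_eq_zero)).1]
    exact dvd_zero a

instance : IsDomain (DifferenceRing R) := by
  have : Nontrivial (DifferenceRing R) := toDifferenceRing_injective.nontrivial
  have : NoZeroDivisors (DifferenceRing R) := ⟨fun {x y} h => by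
    obtain ⟨a, ha⟩ := exists_eq_or_neg_toDifferenceRing x
    obtain ⟨b, hb⟩ := exists_eq_or_neg_toDifferenceRing y
    have mul_eq : toDifferenceRing (a * b) = 0 := by
      rw [map_mul]
      rcases ha with rfl | rfl <;> rcases hb with rfl | rfl <;>
        simpa only [neg_mul, mul_neg, neg_neg, neg_eq_zero] using h
    rw [map_eq_zero_iff _ toDifferenceRing_injective, mul_eq_zero] at mul_eq
    rcases mul_eq with rfl | rfl
    · exact .inl (by simpa using ha)
    · exact .inr (by simpa using hb)⟩
  exact NoZeroDivisors.to_isDomain _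

variable (R) in
/-- The field of fractions of the ring of differences of an ordered semiring. -/
def Fr := FractionRing (DifferenceRing R)

noncomputable instance : Field (Fr R) := inferInstanceAs (Field (FractionRing (DifferenceRing R)))

/-- The inclusion of an ordered semiring into its field of fractions. -/
noncomputable def toFr : R →+* Fr R :=
  (algebraMap (DifferenceRing R) (FractionRing (DifferenceRing R))).comp toDifferenceRing

theorem toFr_injective : Function.Injective (toFr (R := R)) :=
  (IsFractionRing.injective (DifferenceRing R) (FractionRing (DifferenceRing R))).comp
    toDifferenceRing_injective

theorem toFr_ne_zero {a : R} (ha : a ≠ 0) : toFr a ≠ 0 :=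
  (map_ne_zero_iff _ toFr_injective).2 ha

theorem exists_eq_or_neg_div (x : Fr R) :
    ∃ a b : R, b ≠ 0 ∧ (x = toFr a / toFr b ∨ x = -(toFr a / toFr b)) := by
  obtain ⟨y, z, hz, rfl⟩ :=
    IsFractionRing.div_surjective (A := DifferenceRing R) (K := FractionRing (DifferenceRing R)) x
  obtain ⟨a, ha⟩ := exists_eq_or_neg_toDifferenceRing y
  obtain ⟨b, hb⟩ := exists_eq_or_neg_toDifferenceRing z
  refine ⟨a, b, ?_, ?_⟩
  · rintro rfl
    exact nonZeroDivisors.ne_zero hz (by simpa using hb)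
  · let f := algebraMap (DifferenceRing R) (FractionRing (DifferenceRing R))
    change f y / f z = f (toDifferenceRing a) / f (toDifferenceRing b) ∨
      f y / f z = -(f (toDifferenceRing a) / f (toDifferenceRing b))
    rcases ha with rfl | rfl <;> rcases hb with rfl | rfl <;> simp [neg_div, div_neg]

variable (R) in
/-- The cone of nonnegative fractions, which defines the order of `Fr R`. -/
def nonnegCone : RingCone (Fr R) where
  carrier := {x | ∃ a b : R, b ≠ 0 ∧ x = toFr a / toFr b}
  mul_mem' := by
    rintro _ _ ⟨a, b, hb, rfl⟩ ⟨c, d, hd, rfl⟩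
    exact ⟨a * c, b * d, mul_ne_zero hb hd, by simp [div_mul_div_comm]⟩
  one_mem' := ⟨1, 1, one_ne_zero, by simp⟩
  add_mem' := by
    rintro _ _ ⟨a, b, hb, rfl⟩ ⟨c, d, hd, rfl⟩
    refine ⟨a * d + b * c, b * d, mul_ne_zero hb hd, ?_⟩
    rw [div_add_div _ _ (toFr_ne_zero hb) (toFr_ne_zero hd)]
    simp only [map_add, map_mul]
  zero_mem' := ⟨0, 1, one_ne_zero, by simp⟩
  eq_zero_of_mem_of_neg_mem' := by
    rintro _ ⟨a, b, hb, rfl⟩ ⟨c, d, hd, h⟩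
    rw [← neg_div, div_eq_div_iff (toFr_ne_zero hb) (toFr_ne_zero hd), neg_mul,
      neg_eq_iff_add_eq_zero, ← map_mul, ← map_mul, ← map_add, map_eq_zero_iff _ toFr_injective,
      add_eq_zero] at h
    have ha : a = 0 := (mul_eq_zero.1 h.1).resolve_right hd
    rw [ha, map_zero, zero_div]

instance : HasMemOrNegMem (nonnegCone R) where
  mem_or_neg_mem x := by
    obtain ⟨a, b, hb, h⟩ := exists_eq_or_neg_div x
    exact h.imp (fun h => ⟨a, b, hb, h⟩) fun h => ⟨a, b, hb, by rw [h, neg_neg]⟩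

open Classical in
noncomputable instance : LinearOrder (Fr R) := LinearOrder.mkOfAddGroupCone (nonnegCone R)

instance : IsOrderedRing (Fr R) := IsOrderedRing.mkOfCone (nonnegCone R)

instance : IsStrictOrderedRing (Fr R) := IsOrderedRing.toIsStrictOrderedRing _

theorem toFr_nonneg (a : R) : 0 ≤ toFr a :=
  show toFr a - 0 ∈ nonnegCone R from ⟨a, 1, one_ne_zero, by simp⟩

theorem toFr_strictMono : StrictMono (toFr (R := R)) := by
  refine Monotone.strictMono_of_injective (fun a b h => ?_) toFr_injective
  obtain ⟨c, rfl⟩ := exists_add_of_le h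
  rw [map_add]
  exact le_add_of_nonneg_right (toFr_nonneg c)

@[simp] theorem toFr_le {a b : R} : toFr a ≤ toFr b ↔ a ≤ b := toFr_strictMono.le_iff_le
@[simp] theorem toFr_lt {a b : R} : toFr a < toFr b ↔ a < b := toFr_strictMono.lt_iff_lt
@[simp] theorem toFr_inj {a b : R} : toFr a = toFr b ↔ a = b := toFr_injective.eq_iff
@[simp] theorem toFr_pos {a : R} : 0 < toFr a ↔ 0 < a := by
  rw [← map_zero (toFr (R := R)), toFr_lt]

end Fractions

/-! ## Renaming of variables -/

/-- The renaming `ρ` as it acts below a quantifier, which binds the variable `0`. -/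
def liftRenaming (ρ : ℕ → ℕ) : ℕ → ℕ
  | 0 => 0
  | i + 1 => ρ i + 1

/-- The term with its variables renamed by `ρ`. -/
def NumTerm.rename (ρ : ℕ → ℕ) : NumTerm → NumTerm
  | .var i => .var (ρ i)
  | .zero => .zero
  | .one => .one
  | .add s t => .add (s.rename ρ) (t.rename ρ)
  | .mul s t => .mul (s.rename ρ) (t.rename ρ)

theorem NumTerm.rename_lift (ρ : ℕ → ℕ) (t : NumTerm) :
    t.lift.rename (liftRenaming ρ) = (t.rename ρ).lift := by
  induction t <;> simp_all [NumTerm.lift, NumTerm.rename, liftRenaming]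

namespace ArithFormula

variable {σ : Type v}

/-- The formula with its free variables renamed by `ρ`. -/
def rename : (ℕ → ℕ) → ArithFormula σ → ArithFormula σ
  | ρ, .eq s t => .eq (s.rename ρ) (t.rename ρ)
  | ρ, .lt s t => .lt (s.rename ρ) (t.rename ρ)
  | ρ, .mem s X => .mem (s.rename ρ) X
  | ρ, .neg φ => .neg (φ.rename ρ)
  | ρ, .and φ ψ => .and (φ.rename ρ) (ψ.rename ρ)
  | ρ, .or φ ψ => .or (φ.rename ρ) (ψ.rename ρ)
  | ρ, .imp φ ψ => .imp (φ.rename ρ) (ψ.rename ρ)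
  | ρ, .iff φ ψ => .iff (φ.rename ρ) (ψ.rename ρ)
  | ρ, .all φ => .all (φ.rename (liftRenaming ρ))
  | ρ, .ex φ => .ex (φ.rename (liftRenaming ρ))

/-- A class of formulas closed under renaming of variables. -/
class RenameClosed (C : ArithFormula σ → Prop) : Prop where
  rename : ∀ {φ : ArithFormula σ}, C φ → ∀ ρ, C (φ.rename ρ)

instance renameClosed_isBounded : RenameClosed (IsBounded (σ := σ)) where
  rename {φ} h ρ := by
    induction h generalizing ρ with
    | eq s t => exact .eq _ _
    | lt s t => exact .lt _ _
    | mem s X => exact .mem _ _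
    | neg _ ih => exact .neg (ih ρ)
    | and _ _ ih₁ ih₂ => exact .and (ih₁ ρ) (ih₂ ρ)
    | or _ _ ih₁ ih₂ => exact .or (ih₁ ρ) (ih₂ ρ)
    | imp _ _ ih₁ ih₂ => exact .imp (ih₁ ρ) (ih₂ ρ)
    | iff _ _ ih₁ ih₂ => exact .iff (ih₁ ρ) (ih₂ ρ)
    | ball t _ ih => simpa only [rename, NumTerm.rename_lift] using .ball _ (ih _)
    | bex t _ ih => simpa only [rename, NumTerm.rename_lift] using .bex _ (ih _)

instance renameClosed_isSigma1 : RenameClosed (IsSigma1 (σ := σ)) where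
  rename {φ} h ρ := by
    induction h generalizing ρ with
    | bounded h => exact .bounded (RenameClosed.rename h ρ)
    | ex _ ih => exact .ex (ih _)

end ArithFormula

namespace L2Structure

open ArithFormula

variable {M : L2Structure.{u}}

theorem termVal_rename (ρ : ℕ → ℕ) (t : NumTerm) (e : ℕ → M.Num) :
    M.termVal e (t.rename ρ) = M.termVal (e ∘ ρ) t := by
  induction t <;> simp_all [NumTerm.rename, termVal]

theorem termVal_lift (t : NumTerm) (a : M.Num) (e : ℕ → M.Num) :
    M.termVal (scons a e) t.lift = M.termVal e t := by
  induction t <;> simp_all [NumTerm.lift, termVal, scons]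

theorem comp_scons {α β : Type*} (f : α → β) (a : α) (s : ℕ → α) :
    (fun i => f (scons a s i)) = scons (f a) fun i => f (s i) := by
  funext i
  cases i <;> rfl

theorem scons_zero_succ {α : Type*} (e : ℕ → α) : scons (e 0) (fun i => e (i + 1)) = e := by
  funext i
  cases i <;> rfl

theorem scons_comp_liftRenaming (ρ : ℕ → ℕ) (a : M.Num) (e : ℕ → M.Num) :
    scons a e ∘ liftRenaming ρ = scons a (e ∘ ρ) := by
  funext i
  cases i <;> rfl

theorem holds_rename (ρ : ℕ → ℕ) (φ : ArithFormula M.sets) (e : ℕ → M.Num) :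
    M.Holds (φ.rename ρ) e ↔ M.Holds φ (e ∘ ρ) := by
  induction φ generalizing ρ e <;>
    simp_all [ArithFormula.rename, Holds, termVal_rename, scons_comp_liftRenaming]

theorem exists_support_termVal (t : NumTerm) :
    ∃ d, ∀ e e' : ℕ → M.Num, (∀ i < d, e i = e' i) → M.termVal e t = M.termVal e' t := by
  induction t with
  | var i => exact ⟨i + 1, fun e e' h => h i i.lt_succ_self⟩
  | zero => exact ⟨0, fun _ _ _ => rfl⟩
  | one => exact ⟨0, fun _ _ _ => rfl⟩
  | add s t hs ht | mul s t hs ht =>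
    obtain ⟨d, hs⟩ := hs
    obtain ⟨d', ht⟩ := ht
    refine ⟨max d d', fun e e' h => ?_⟩
    simp only [termVal, hs e e' fun i hi => h i (lt_max_of_lt_left hi),
      ht e e' fun i hi => h i (lt_max_of_lt_right hi)]

theorem exists_support_holds (φ : ArithFormula M.sets) :
    ∃ d, ∀ e e' : ℕ → M.Num, (∀ i < d, e i = e' i) → (M.Holds φ e ↔ M.Holds φ e') := by
  induction φ with
  | eq s t | lt s t =>
    obtain ⟨d, hs⟩ := exists_support_termVal (M := M) s
    obtain ⟨d', ht⟩ := exists_support_termVal (M := M) t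
    refine ⟨max d d', fun e e' h => ?_⟩
    simp only [Holds, hs e e' fun i hi => h i (lt_max_of_lt_left hi),
      ht e e' fun i hi => h i (lt_max_of_lt_right hi)]
  | mem s X =>
    obtain ⟨d, hs⟩ := exists_support_termVal (M := M) s
    exact ⟨d, fun e e' h => by simp only [Holds, hs e e' h]⟩
  | neg φ ih =>
    obtain ⟨d, ih⟩ := ih
    exact ⟨d, fun e e' h => not_congr (ih e e' h)⟩
  | and φ ψ hφ hψ | or φ ψ hφ hψ | imp φ ψ hφ hψ | iff φ ψ hφ hψ =>
    obtain ⟨d, hφ⟩ := hφ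
    obtain ⟨d', hψ⟩ := hψ
    refine ⟨max d d', fun e e' h => ?_⟩
    simp only [Holds, hφ e e' fun i hi => h i (lt_max_of_lt_left hi),
      hψ e e' fun i hi => h i (lt_max_of_lt_right hi)]
  | all φ ih | ex φ ih =>
    obtain ⟨d, ih⟩ := ih
    refine ⟨d, fun e e' h => ?_⟩
    have holds_scons_iff (a : M.Num) : M.Holds φ (scons a e) ↔ M.Holds φ (scons a e') :=
      ih _ _ fun
        | 0, _ => rfl
        | i + 1, hi => h i (i.lt_succ_self.trans hi)
    simp only [Holds, holds_scons_iff]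

theorem holds_rename_succ (φ : ArithFormula M.sets) (a : M.Num) (e : ℕ → M.Num) :
    M.Holds (φ.rename Nat.succ) (scons a e) ↔ M.Holds φ e :=
  holds_rename _ _ _

/-- Prenexing: a connective under which existential quantifiers can be pulled out on both sides
preserves `Σ⁰₁` as soon as it preserves `Σ⁰₀`. -/
theorem exists_isSigma1_combine {f : Prop → Prop → Prop}
    (pull_left : ∀ (p : M.Num → Prop) q, f (∃ a, p a) q ↔ ∃ a, f (p a) q)
    (pull_right : ∀ p (q : M.Num → Prop), f p (∃ a, q a) ↔ ∃ a, f p (q a))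
    (bounded : ∀ φ ψ : ArithFormula M.sets, φ.IsBounded → ψ.IsBounded →
      ∃ χ : ArithFormula M.sets, χ.IsBounded ∧ ∀ e, M.Holds χ e ↔ f (M.Holds φ e) (M.Holds ψ e))
    {φ ψ : ArithFormula M.sets} (hφ : φ.IsSigma1) (hψ : ψ.IsSigma1) :
    ∃ χ : ArithFormula M.sets, χ.IsSigma1 ∧ ∀ e, M.Holds χ e ↔ f (M.Holds φ e) (M.Holds ψ e) := by
  induction hφ generalizing ψ with
  | @bounded φ hφ =>
    induction hψ generalizing φ with
    | bounded hψ =>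
      obtain ⟨χ, hχ, h⟩ := bounded _ _ hφ hψ
      exact ⟨χ, .bounded hχ, h⟩
    | ex _ ih =>
      obtain ⟨χ, hχ, h⟩ := ih (RenameClosed.rename hφ Nat.succ)
      exact ⟨_, .ex hχ, fun e => by simp only [Holds, h, holds_rename_succ, pull_right]⟩
  | ex _ ih =>
    obtain ⟨χ, hχ, h⟩ := ih (RenameClosed.rename hψ Nat.succ)
    exact ⟨_, .ex hχ, fun e => by simp only [Holds, h, holds_rename_succ, pull_left]⟩

theorem exists_isSigma1_and {φ ψ : ArithFormula M.sets} (hφ : φ.IsSigma1) (hψ : ψ.IsSigma1) :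
    ∃ χ : ArithFormula M.sets, χ.IsSigma1 ∧ ∀ e, M.Holds χ e ↔ M.Holds φ e ∧ M.Holds ψ e :=
  exists_isSigma1_combine (fun _ _ => exists_and_right.symm) (fun _ _ => exists_and_left.symm)
    (fun _ _ hφ hψ => ⟨_, .and hφ hψ, fun _ => Iff.rfl⟩) hφ hψ

theorem exists_isSigma1_or {φ ψ : ArithFormula M.sets} (hφ : φ.IsSigma1) (hψ : ψ.IsSigma1) :
    ∃ χ : ArithFormula M.sets, χ.IsSigma1 ∧ ∀ e, M.Holds χ e ↔ M.Holds φ e ∨ M.Holds ψ e :=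
  have : Nonempty M.Num := ⟨0⟩
  exists_isSigma1_combine (fun _ _ => by rw [exists_or, exists_const])
    (fun _ _ => by rw [exists_or, exists_const])
    (fun _ _ hφ hψ => ⟨_, .or hφ hψ, fun _ => Iff.rfl⟩) hφ hψ

theorem exists_isPi1_not {φ : ArithFormula M.sets} (hφ : φ.IsSigma1) :
    ∃ χ : ArithFormula M.sets, χ.IsPi1 ∧ ∀ e, M.Holds χ e ↔ ¬ M.Holds φ e := by
  induction hφ with
  | bounded hφ => exact ⟨_, .bounded (.neg hφ), fun _ => Iff.rfl⟩
  | ex _ ih =>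
    obtain ⟨χ, hχ, h⟩ := ih
    exact ⟨_, .all hχ, fun e => by simp only [Holds, h, not_exists]⟩

/-! ## Definability with parameters -/

/-- The assignment interleaving `e` with the parameters `p`: the even variables take their values
from `e`, the odd ones from `p`. -/
def withParams (e p : ℕ → M.Num) : ℕ → M.Num := Sum.elim e p ∘ Equiv.natSumNatEquivNat.symm

theorem exists_withParams_comp_eq (p₁ p₂ : ℕ → M.Num) : ∃ (p : ℕ → M.Num) (ρ₁ ρ₂ : ℕ → ℕ),
    ∀ e, withParams e p ∘ ρ₁ = withParams e p₁ ∧ withParams e p ∘ ρ₂ = withParams e p₂ := by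
  let q := Equiv.natSumNatEquivNat
  refine ⟨withParams p₁ p₂, q ∘ Sum.map id (q ∘ Sum.inl) ∘ q.symm,
    q ∘ Sum.map id (q ∘ Sum.inr) ∘ q.symm, fun e => ⟨?_, ?_⟩⟩ <;> funext i <;>
    obtain ⟨j | j, rfl⟩ := q.surjective i <;>
    simp only [withParams, Function.comp_apply, q, Equiv.symm_apply_apply, Sum.map_inl,
      Sum.map_inr, Sum.elim_inl, Sum.elim_inr, id]

theorem exists_scons_withParams_comp_eq : ∃ ρ : ℕ → ℕ, ∀ (a : M.Num) (e p : ℕ → M.Num),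
    scons a (withParams e p) ∘ ρ = withParams (scons a e) p := by
  let q := Equiv.natSumNatEquivNat
  refine ⟨Sum.elim (liftRenaming (q ∘ Sum.inl)) (fun j => q (.inr j) + 1) ∘ q.symm,
    fun a e p => ?_⟩
  funext i
  obtain ⟨j | j, rfl⟩ := q.surjective i
  · cases j <;> simp [withParams, q, liftRenaming, scons]
  · simp [withParams, q, scons]

theorem exists_withParams_comp_eq_comp (ρ : ℕ → ℕ) : ∃ ρ' : ℕ → ℕ, ∀ e p : ℕ → M.Num,
    withParams e p ∘ ρ' = withParams (e ∘ ρ) p := by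
  let q := Equiv.natSumNatEquivNat
  refine ⟨q ∘ Sum.map ρ id ∘ q.symm, fun e p => ?_⟩
  funext i
  obtain ⟨j | j, rfl⟩ := q.surjective i <;> simp [withParams, q]

theorem exists_withParams_comp_eq_subst (σ : ℕ → ℕ ⊕ M.Num) (p : ℕ → M.Num) :
    ∃ (p' : ℕ → M.Num) (ρ : ℕ → ℕ),
      ∀ e, withParams e p' ∘ ρ = withParams (fun i => Sum.elim e id (σ i)) p := by
  let q := Equiv.natSumNatEquivNat
  refine ⟨withParams (fun i => Sum.elim 0 id (σ i)) p,
    q ∘ Sum.elim (fun i => (σ i).map id fun _ => q (.inl i)) (fun j => .inr (q (.inr j))) ∘ q.symm,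
    fun e => ?_⟩
  funext i
  obtain ⟨j | j, rfl⟩ := q.surjective i
  · cases h : σ j <;> simp [withParams, q, h]
  · simp [withParams, q]

/-- The function `t` of the assignment is the value of a term with number parameters. -/
class TermDefinable (t : (ℕ → M.Num) → M.Num) : Prop where
  out : ∃ (s : NumTerm) (p : ℕ → M.Num), ∀ e, M.termVal (withParams e p) s = t e

/-- The predicate `P` of the assignment is defined by a formula of the class `C` with parameters.
A class, so that definability of concrete predicates is found by instance search. -/
class Definable (C : ArithFormula M.sets → Prop) (P : (ℕ → M.Num) → Prop) : Prop where
  out : ∃ φ, C φ ∧ ∃ p : ℕ → M.Num, ∀ e, M.Holds φ (withParams e p) ↔ P e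

/-- Definability by a `Σ⁰₀` formula with parameters. -/
abbrev BoundedDefinable (P : (ℕ → M.Num) → Prop) : Prop := Definable IsBounded P

/-- Definability by a `Σ⁰₁` formula with parameters. -/
abbrev Sigma1Definable (P : (ℕ → M.Num) → Prop) : Prop := Definable IsSigma1 P

/-- `X` is one of the sets of the structure; a class, for use in the search for definability. -/
class IsSet (X : Set M.Num) : Prop where
  mem : X ∈ M.sets

namespace TermDefinable

instance var (i : ℕ) : TermDefinable (fun e : ℕ → M.Num => e i) :=
  ⟨.var (Equiv.natSumNatEquivNat (.inl i)), fun _ => 0, fun e => by simp [termVal, withParams]⟩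

instance const (a : M.Num) : TermDefinable (fun _ : ℕ → M.Num => a) :=
  ⟨.var (Equiv.natSumNatEquivNat (.inr 0)), fun _ => a, fun e => by simp [termVal, withParams]⟩

theorem exists_common (t s : (ℕ → M.Num) → M.Num) [ht : TermDefinable t] [hs : TermDefinable s] :
    ∃ (t' s' : NumTerm) (p : ℕ → M.Num), ∀ e,
      M.termVal (withParams e p) t' = t e ∧ M.termVal (withParams e p) s' = s e := by
  obtain ⟨⟨t', p₁, h₁⟩⟩ := ht
  obtain ⟨⟨s', p₂, h₂⟩⟩ := hs
  obtain ⟨p, ρ₁, ρ₂, h⟩ := exists_withParams_comp_eq p₁ p₂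
  exact ⟨t'.rename ρ₁, s'.rename ρ₂, p, fun e => by
    simp only [termVal_rename, h e, h₁, h₂, and_self]⟩

instance add (t s : (ℕ → M.Num) → M.Num) [TermDefinable t] [TermDefinable s] :
    TermDefinable (fun e => t e + s e) := by
  obtain ⟨t', s', p, h⟩ := exists_common t s
  exact ⟨.add t' s', p, fun e => by simp only [termVal, h]⟩

instance mul (t s : (ℕ → M.Num) → M.Num) [TermDefinable t] [TermDefinable s] :
    TermDefinable (fun e => t e * s e) := by
  obtain ⟨t', s', p, h⟩ := exists_common t s
  exact ⟨.mul t' s', p, fun e => by simp only [termVal, h]⟩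

instance pair (t s : (ℕ → M.Num) → M.Num) [TermDefinable t] [TermDefinable s] :
    TermDefinable (fun e => pair (t e) (s e)) :=
  inferInstanceAs (TermDefinable (fun e => (t e + s e) * (t e + s e) + t e))

instance (priority := 900) rename (t : (ℕ → M.Num) → M.Num) [ht : TermDefinable t] (ρ : ℕ → ℕ) :
    TermDefinable (fun e => t (fun i => e (ρ i))) := by
  obtain ⟨⟨t', p, h⟩⟩ := ht
  obtain ⟨ρ', h'⟩ := exists_withParams_comp_eq_comp (M := M) ρ
  exact ⟨t'.rename ρ', p, fun e => by rw [termVal_rename, h', h]; rfl⟩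

end TermDefinable

namespace Definable

variable {C : ArithFormula M.sets → Prop}

theorem of_iff {P Q : (ℕ → M.Num) → Prop} [hQ : Definable C Q] (h : ∀ e, P e ↔ Q e) :
    Definable C P := by
  rwa [funext fun e => propext (h e)]

theorem rename [RenameClosed C] (P : (ℕ → M.Num) → Prop) [hP : Definable C P] (ρ : ℕ → ℕ) :
    Definable C (fun e => P (fun i => e (ρ i))) := by
  obtain ⟨⟨φ, hφ, p, h⟩⟩ := hP
  obtain ⟨ρ', h'⟩ := exists_withParams_comp_eq_comp (M := M) ρ
  exact ⟨φ.rename ρ', RenameClosed.rename hφ _, p, fun e => by rw [holds_rename, h', h]; rfl⟩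

theorem subst [RenameClosed C] (P : (ℕ → M.Num) → Prop) [hP : Definable C P] (σ : ℕ → ℕ ⊕ M.Num) :
    Definable C (fun e => P (fun i => Sum.elim e id (σ i))) := by
  obtain ⟨⟨φ, hφ, p, h⟩⟩ := hP
  obtain ⟨p', ρ, hρ⟩ := exists_withParams_comp_eq_subst σ p
  exact ⟨φ.rename ρ, RenameClosed.rename hφ _, p', fun e => by rw [holds_rename, hρ, h]⟩

theorem exists_support (P : (ℕ → M.Num) → Prop) [hP : Definable C P] :
    ∃ d, ∀ e e' : ℕ → M.Num, (∀ i < d, e i = e' i) → (P e ↔ P e') := by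
  obtain ⟨⟨φ, _, p, h⟩⟩ := hP
  obtain ⟨d, hd⟩ := exists_support_holds φ
  refine ⟨d, fun e e' he => ?_⟩
  rw [← h, ← h]
  refine hd _ _ fun i hi => ?_
  obtain ⟨j | j, rfl⟩ := Equiv.natSumNatEquivNat.surjective i
  · have j_lt : j < d := by
      simp only [Equiv.natSumNatEquivNat_apply, Sum.elim_inl] at hi
      omega
    simp [withParams, he j j_lt]
  · simp [withParams]

theorem exists_common [RenameClosed C] (P Q : (ℕ → M.Num) → Prop) [hP : Definable C P]
    [hQ : Definable C Q] :
    ∃ φ ψ, C φ ∧ C ψ ∧ ∃ p : ℕ → M.Num, ∀ e,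
      (M.Holds φ (withParams e p) ↔ P e) ∧ (M.Holds ψ (withParams e p) ↔ Q e) := by
  obtain ⟨⟨φ, hφ, p₁, h₁⟩⟩ := hP
  obtain ⟨⟨ψ, hψ, p₂, h₂⟩⟩ := hQ
  obtain ⟨p, ρ₁, ρ₂, h⟩ := exists_withParams_comp_eq p₁ p₂
  exact ⟨φ.rename ρ₁, ψ.rename ρ₂, RenameClosed.rename hφ _, RenameClosed.rename hψ _, p,
    fun e => by simp only [holds_rename, h e, h₁, h₂, and_self]⟩

end Definable

namespace BoundedDefinable

variable (P Q : (ℕ → M.Num) → Prop) (t s : (ℕ → M.Num) → M.Num)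

instance eq [TermDefinable t] [TermDefinable s] : BoundedDefinable (fun e => t e = s e) := by
  obtain ⟨t', s', p, h⟩ := TermDefinable.exists_common t s
  exact ⟨.eq t' s', .eq _ _, p, fun e => by simp only [Holds, h]⟩

instance lt [TermDefinable t] [TermDefinable s] : BoundedDefinable (fun e => t e < s e) := by
  obtain ⟨t', s', p, h⟩ := TermDefinable.exists_common t s
  exact ⟨.lt t' s', .lt _ _, p, fun e => by simp only [Holds, h]⟩

instance mem (X : Set M.Num) [hX : IsSet X] [ht : TermDefinable t] :
    BoundedDefinable (fun e => t e ∈ X) := by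
  obtain ⟨⟨t', p, h⟩⟩ := ht
  exact ⟨.mem t' ⟨X, hX.mem⟩, .mem _ _, p, fun e => by simp only [Holds, h]⟩

instance and [BoundedDefinable P] [BoundedDefinable Q] :
    BoundedDefinable (fun e => P e ∧ Q e) := by
  obtain ⟨φ, ψ, hφ, hψ, p, h⟩ := Definable.exists_common (C := IsBounded) P Q
  exact ⟨_, .and hφ hψ, p, fun e => by simp only [Holds, h]⟩

instance or [BoundedDefinable P] [BoundedDefinable Q] : BoundedDefinable (fun e => P e ∨ Q e) := by
  obtain ⟨φ, ψ, hφ, hψ, p, h⟩ := Definable.exists_common (C := IsBounded) P Q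
  exact ⟨_, .or hφ hψ, p, fun e => by simp only [Holds, h]⟩

instance imp [BoundedDefinable P] [BoundedDefinable Q] :
    BoundedDefinable (fun e => P e → Q e) := by
  obtain ⟨φ, ψ, hφ, hψ, p, h⟩ := Definable.exists_common (C := IsBounded) P Q
  exact ⟨_, .imp hφ hψ, p, fun e => by simp only [Holds, h]⟩

instance iff [BoundedDefinable P] [BoundedDefinable Q] :
    BoundedDefinable (fun e => P e ↔ Q e) := by
  obtain ⟨φ, ψ, hφ, hψ, p, h⟩ := Definable.exists_common (C := IsBounded) P Q
  exact ⟨_, .iff hφ hψ, p, fun e => by simp only [Holds, h]⟩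

instance le [TermDefinable t] [TermDefinable s] : BoundedDefinable (fun e => t e ≤ s e) :=
  inferInstanceAs (BoundedDefinable (fun e => t e < s e ∨ t e = s e))

instance (priority := 900) const (p : Prop) : BoundedDefinable (fun _ : ℕ → M.Num => p) := by
  by_cases hp : p
  · exact ⟨.eq .zero .zero, .eq _ _, fun _ => 0, fun e => by simp [Holds, hp]⟩
  · exact ⟨.neg (.eq .zero .zero), .neg (.eq _ _), fun _ => 0, fun e => by simp [Holds, hp]⟩

instance ball [ht : TermDefinable t] (R : M.Num → (ℕ → M.Num) → Prop)
    [hR : BoundedDefinable (fun e => R (e 0) (fun i => e (i + 1)))] :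
    BoundedDefinable (fun e => ∀ a, a < t e → R a e) := by
  obtain ⟨ρ, hρ⟩ := exists_scons_withParams_comp_eq (M := M)
  obtain ⟨⟨φ, hφ, p₁, h₁⟩⟩ := hR
  obtain ⟨⟨t', p₂, h₂⟩⟩ := ht
  obtain ⟨p, ρ₁, ρ₂, h⟩ := exists_withParams_comp_eq p₁ p₂
  refine ⟨.all (.imp (.lt (.var 0) (t'.rename ρ₂).lift) ((φ.rename ρ₁).rename ρ)),
    .ball _ (RenameClosed.rename (RenameClosed.rename hφ _) _), p, fun e => ?_⟩
  simp only [Holds, termVal, holds_rename, termVal_lift, termVal_rename, hρ, h, h₁, h₂, scons]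

instance bex [ht : TermDefinable t] (R : M.Num → (ℕ → M.Num) → Prop)
    [hR : BoundedDefinable (fun e => R (e 0) (fun i => e (i + 1)))] :
    BoundedDefinable (fun e => ∃ a, a < t e ∧ R a e) := by
  obtain ⟨ρ, hρ⟩ := exists_scons_withParams_comp_eq (M := M)
  obtain ⟨⟨φ, hφ, p₁, h₁⟩⟩ := hR
  obtain ⟨⟨t', p₂, h₂⟩⟩ := ht
  obtain ⟨p, ρ₁, ρ₂, h⟩ := exists_withParams_comp_eq p₁ p₂
  refine ⟨.ex (.and (.lt (.var 0) (t'.rename ρ₂).lift) ((φ.rename ρ₁).rename ρ)),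
    .bex _ (RenameClosed.rename (RenameClosed.rename hφ _) _), p, fun e => ?_⟩
  simp only [Holds, termVal, holds_rename, termVal_lift, termVal_rename, hρ, h, h₁, h₂, scons]

instance (priority := 400) rename [BoundedDefinable P] (ρ : ℕ → ℕ) :
    BoundedDefinable (fun e => P (fun i => e (ρ i))) :=
  Definable.rename P ρ

theorem holds {φ : ArithFormula M.sets} (hφ : φ.IsBounded) :
    BoundedDefinable (fun e => M.Holds φ e) :=
  ⟨φ.rename (Equiv.natSumNatEquivNat ∘ Sum.inl), RenameClosed.rename hφ _, fun _ => 0, fun e => by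
    rw [holds_rename, show withParams e (fun _ => 0) ∘ Equiv.natSumNatEquivNat ∘ Sum.inl = e from
      funext fun i => by simp [withParams]]⟩

end BoundedDefinable

namespace Sigma1Definable

variable (P Q : (ℕ → M.Num) → Prop)

instance (priority := 500) of_boundedDefinable [hP : BoundedDefinable P] : Sigma1Definable P := by
  obtain ⟨⟨φ, hφ, h⟩⟩ := hP
  exact ⟨φ, .bounded hφ, h⟩

instance and [Sigma1Definable P] [Sigma1Definable Q] : Sigma1Definable (fun e => P e ∧ Q e) := by
  obtain ⟨φ, ψ, hφ, hψ, p, h⟩ := Definable.exists_common (C := IsSigma1) P Q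
  obtain ⟨χ, hχ, h'⟩ := exists_isSigma1_and hφ hψ
  exact ⟨χ, hχ, p, fun e => by simp only [h', h]⟩

instance or [Sigma1Definable P] [Sigma1Definable Q] : Sigma1Definable (fun e => P e ∨ Q e) := by
  obtain ⟨φ, ψ, hφ, hψ, p, h⟩ := Definable.exists_common (C := IsSigma1) P Q
  obtain ⟨χ, hχ, h'⟩ := exists_isSigma1_or hφ hψ
  exact ⟨χ, hχ, p, fun e => by simp only [h', h]⟩

instance ex (R : M.Num → (ℕ → M.Num) → Prop)
    [hR : Sigma1Definable (fun e => R (e 0) (fun i => e (i + 1)))] :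
    Sigma1Definable (fun e => ∃ a, R a e) := by
  obtain ⟨ρ, hρ⟩ := exists_scons_withParams_comp_eq (M := M)
  obtain ⟨⟨φ, hφ, p, h⟩⟩ := hR
  exact ⟨.ex (φ.rename ρ), .ex (RenameClosed.rename hφ _), p, fun e => by
    simp only [Holds, holds_rename, hρ, h, scons]⟩

end Sigma1Definable

/-! ## Definability for formal differences and fractions -/

/-- Both components of the formal difference `z`, a function of the assignment, are values of terms
with parameters. -/
class IntDefinable (z : (ℕ → M.Num) → PreInt M) : Prop where
  pos : TermDefinable (fun e => (z e).pos)
  neg : TermDefinable (fun e => (z e).neg)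

attribute [instance] IntDefinable.pos IntDefinable.neg

/-- Numerator and denominator of the formal fraction `q`, a function of the assignment, are values
of terms with parameters. -/
class RatDefinable (q : (ℕ → M.Num) → PreRat M) : Prop where
  num : IntDefinable (fun e => (q e).num)
  den : IntDefinable (fun e => (q e).den)

attribute [instance] RatDefinable.num RatDefinable.den

namespace IntDefinable

variable (z w : (ℕ → M.Num) → PreInt M) (t s : (ℕ → M.Num) → M.Num)

instance ofPair [TermDefinable t] [TermDefinable s] : IntDefinable (fun e => ⟨t e, s e⟩) :=
  ⟨inferInstanceAs (TermDefinable t), inferInstanceAs (TermDefinable s)⟩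
instance const (z : PreInt M) : IntDefinable (fun _ => z) := ⟨.const _, .const _⟩
instance ofNum [TermDefinable t] : IntDefinable (fun e => PreInt.ofNum (t e)) :=
  ofPair t (fun _ => 0)
instance opp [IntDefinable z] : IntDefinable (fun e => (z e).opp) :=
  ofPair (fun e => (z e).neg) (fun e => (z e).pos)
instance add [IntDefinable z] [IntDefinable w] : IntDefinable (fun e => (z e).add (w e)) :=
  ofPair (fun e => (z e).pos + (w e).pos) (fun e => (z e).neg + (w e).neg)
instance mul [IntDefinable z] [IntDefinable w] : IntDefinable (fun e => (z e).mul (w e)) :=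
  ofPair (fun e => (z e).pos * (w e).pos + (z e).neg * (w e).neg)
    (fun e => (z e).pos * (w e).neg + (z e).neg * (w e).pos)
instance code [IntDefinable z] : TermDefinable (fun e => (z e).code) :=
  inferInstanceAs (TermDefinable (fun e => L2Structure.pair (z e).pos (z e).neg))
instance equiv [IntDefinable z] [IntDefinable w] : BoundedDefinable (fun e => (z e).Equiv (w e)) :=
  inferInstanceAs (BoundedDefinable (fun e => (z e).pos + (w e).neg = (z e).neg + (w e).pos))
instance lt [IntDefinable z] [IntDefinable w] : BoundedDefinable (fun e => (z e).Lt (w e)) :=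
  inferInstanceAs (BoundedDefinable (fun e => (z e).pos + (w e).neg < (w e).pos + (z e).neg))
instance (priority := 900) rename [IntDefinable z] (ρ : ℕ → ℕ) :
    IntDefinable (fun e => z (fun i => e (ρ i))) :=
  ⟨TermDefinable.rename (fun e => (z e).pos) _, TermDefinable.rename (fun e => (z e).neg) _⟩

end IntDefinable

namespace RatDefinable

variable (q r : (ℕ → M.Num) → PreRat M)

instance ofPair (z w : (ℕ → M.Num) → PreInt M) [IntDefinable z] [IntDefinable w] :
    RatDefinable (fun e => ⟨z e, w e⟩) :=
  ⟨inferInstanceAs (IntDefinable z), inferInstanceAs (IntDefinable w)⟩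
instance const (q : PreRat M) : RatDefinable (fun _ => q) := ⟨.const _, .const _⟩
instance ofNums (t s : (ℕ → M.Num) → M.Num) [TermDefinable t] [TermDefinable s] :
    RatDefinable (fun e => PreRat.ofNums (t e) (s e)) :=
  ofPair (fun e => PreInt.ofNum (t e)) (fun e => PreInt.ofNum (s e))
instance opp [RatDefinable q] : RatDefinable (fun e => (q e).opp) :=
  ofPair (fun e => (q e).num.opp) (fun e => (q e).den)
instance add [RatDefinable q] [RatDefinable r] : RatDefinable (fun e => (q e).add (r e)) :=
  ofPair (fun e => ((q e).num.mul (r e).den).add ((r e).num.mul (q e).den))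
    (fun e => (q e).den.mul (r e).den)
instance sub [RatDefinable q] [RatDefinable r] : RatDefinable (fun e => (q e).sub (r e)) :=
  add q (fun e => (r e).opp)
instance code [RatDefinable q] : TermDefinable (fun e => (q e).code) :=
  inferInstanceAs (TermDefinable (fun e => L2Structure.pair (q e).num.code (q e).den.code))
instance equiv [RatDefinable q] [RatDefinable r] : BoundedDefinable (fun e => (q e).Equiv (r e)) :=
  inferInstanceAs (BoundedDefinable (fun e =>
    ((q e).num.mul (r e).den).Equiv ((q e).den.mul (r e).num)))
instance lt [RatDefinable q] [RatDefinable r] : BoundedDefinable (fun e => (q e).Lt (r e)) :=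
  inferInstanceAs (BoundedDefinable (fun e =>
    ((q e).num.mul (r e).den).Lt ((r e).num.mul (q e).den)))
instance le [RatDefinable q] [RatDefinable r] : BoundedDefinable (fun e => (q e).Le (r e)) :=
  inferInstanceAs (BoundedDefinable (fun e => ¬ (r e).Lt (q e)))
instance (priority := 900) rename [RatDefinable q] (ρ : ℕ → ℕ) :
    RatDefinable (fun e => q (fun i => e (ρ i))) :=
  ⟨IntDefinable.rename (fun e => (q e).num) ρ, IntDefinable.rename (fun e => (q e).den) ρ⟩

instance ex (R : PreRat M → (ℕ → M.Num) → Prop)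
    [Sigma1Definable (fun e => R ⟨⟨e 3, e 2⟩, ⟨e 1, e 0⟩⟩ (fun i => e (i + 4)))] :
    Sigma1Definable (fun e => ∃ q : PreRat M, R q e) :=
  Definable.of_iff (Q := fun e => ∃ a b c d, R ⟨⟨a, b⟩, ⟨c, d⟩⟩ e) fun _ =>
    ⟨fun ⟨⟨⟨a, b⟩, ⟨c, d⟩⟩, h⟩ => ⟨a, b, c, d, h⟩, fun ⟨_, _, _, _, h⟩ => ⟨_, h⟩⟩

end RatDefinable

/-! ## Induction and comprehension for definable predicates -/

theorem exists_holds_scons (P : M.Num → Prop) [hP : Sigma1Definable (fun e => P (e 0))] :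
    ∃ φ : ArithFormula M.sets, φ.IsSigma1 ∧ ∃ e : ℕ → M.Num, ∀ n, M.Holds φ (scons n e) ↔ P n := by
  obtain ⟨ρ, hρ⟩ := exists_scons_withParams_comp_eq (M := M)
  obtain ⟨⟨φ, hφ, p, h⟩⟩ := hP
  exact ⟨φ.rename ρ, RenameClosed.rename hφ _, withParams (fun _ => 0) p, fun n => by
    simp only [holds_rename, hρ, h, scons]⟩

variable [hM : Fact M.ModelsRCA0]

theorem induction_on (P : M.Num → Prop) [Sigma1Definable (fun e => P (e 0))] (n : M.Num)
    (zero : P 0) (succ : ∀ n, P n → P (n + 1)) : P n := by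
  obtain ⟨φ, hφ, e, h⟩ := exists_holds_scons P
  exact (h n).1 (hM.out.sigma1_induction φ hφ e ((h 0).2 zero)
    (fun n hn => (h _).2 (succ n ((h n).1 hn))) n)

theorem isSet_setOf (P : M.Num → Prop) [Sigma1Definable (fun e => P (e 0))]
    [Sigma1Definable (fun e => ¬ P (e 0))] : IsSet {n | P n} := by
  obtain ⟨ρ, hρ⟩ := exists_scons_withParams_comp_eq (M := M)
  obtain ⟨φ, ψ, hφ, hψ, p, h⟩ :=
    Definable.exists_common (C := IsSigma1) (fun e => P (e 0)) (fun e => ¬ P (e 0))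
  obtain ⟨χ, hχ, h'⟩ := exists_isPi1_not (RenameClosed.rename hψ ρ)
  have comprehension := hM.out.delta1_comprehension (φ.rename ρ) χ (RenameClosed.rename hφ ρ) hχ
    (withParams (fun _ => 0) p) (fun n => by simp only [h', holds_rename, hρ, h, scons, not_not])
  simp only [holds_rename, hρ, h, scons] at comprehension
  exact ⟨comprehension⟩

/-! ## The numbers of a model form a discretely ordered commutative semiring -/

namespace Arith

theorem add_zero (n : M.Num) : n + 0 = n := hM.out.basic.add_zero n
theorem add_succ (m n : M.Num) : m + (n + 1) = m + n + 1 := hM.out.basic.add_succ m n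
theorem mul_zero (n : M.Num) : n * 0 = 0 := hM.out.basic.mul_zero n
theorem mul_succ (m n : M.Num) : m * (n + 1) = m * n + m := hM.out.basic.mul_succ m n

theorem zero_add (n : M.Num) : 0 + n = n :=
  induction_on (fun n => 0 + n = n) n (add_zero _) fun n h => by rw [add_succ, h]

theorem succ_add (m n : M.Num) : m + 1 + n = m + n + 1 :=
  induction_on (fun n => m + 1 + n = m + n + 1) n (by simp only [add_zero]) fun n h => by
    simp only [add_succ, h]

theorem add_comm (m n : M.Num) : m + n = n + m :=
  induction_on (fun n => m + n = n + m) n (by simp only [add_zero, zero_add]) fun n h => by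
    simp only [add_succ, succ_add, h]

theorem add_assoc (m n k : M.Num) : m + n + k = m + (n + k) :=
  induction_on (fun k => m + n + k = m + (n + k)) k (by simp only [add_zero]) fun k h => by
    simp only [add_succ, h]

theorem zero_mul (n : M.Num) : 0 * n = 0 :=
  induction_on (fun n => 0 * n = 0) n (mul_zero _) fun n h => by simp only [mul_succ, h, add_zero]

theorem succ_mul (m n : M.Num) : (m + 1) * n = m * n + n :=
  induction_on (fun n => (m + 1) * n = m * n + n) n (by simp only [mul_zero, add_zero])
    fun n h => by
      rw [mul_succ, mul_succ, h, add_assoc, add_assoc, add_comm n, succ_add, add_succ m n]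

theorem mul_comm (m n : M.Num) : m * n = n * m :=
  induction_on (fun n => m * n = n * m) n (by simp only [mul_zero, zero_mul]) fun n h => by
    simp only [mul_succ, succ_mul, h]

theorem mul_add (m n k : M.Num) : m * (n + k) = m * n + m * k :=
  induction_on (fun k => m * (n + k) = m * n + m * k) k (by simp only [mul_zero, add_zero])
    fun k h => by rw [add_succ, mul_succ, h, mul_succ, add_assoc]

theorem mul_assoc (m n k : M.Num) : m * n * k = m * (n * k) :=
  induction_on (fun k => m * n * k = m * (n * k)) k (by simp only [mul_zero]) fun k h => by
    rw [mul_succ, h, mul_succ, mul_add]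

theorem mul_one (n : M.Num) : n * 1 = n := by
  rw [← zero_add (1 : M.Num), mul_succ, mul_zero, zero_add]

theorem add_right_cancel {a b n : M.Num} : a + n = b + n → a = b :=
  induction_on (fun n => a + n = b + n → a = b) n (by simp only [add_zero, imp_self])
    fun n h h' => h (hM.out.basic.succ_inj _ _ (by rwa [add_succ, add_succ] at h'))

theorem eq_zero_or_succ (n : M.Num) : n = 0 ∨ ∃ m, n = m + 1 :=
  induction_on (fun n => n = 0 ∨ ∃ m, n = m + 1) n (.inl rfl) fun n _ => .inr ⟨n, rfl⟩

theorem lt_iff {a b : M.Num} : a < b ↔ ∃ c, a + (c + 1) = b := by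
  constructor
  · intro h
    refine (induction_on (fun b => ¬ a < b ∨ ∃ c, a + (c + 1) = b) b
      (.inl (hM.out.basic.not_lt_zero _)) fun b ih => ?_).resolve_left (not_not.2 h)
    rw [hM.out.basic.lt_succ]
    by_cases hab : a = b
    · exact .inr ⟨0, by rw [hab, zero_add]⟩
    · rcases ih with ih | ⟨c, hc⟩
      · exact .inl (by tauto)
      · exact .inr ⟨c + 1, by rw [← hc, add_succ a (c + 1)]⟩
  · rintro ⟨c, rfl⟩
    refine induction_on (fun c => a < a + (c + 1)) c ?_ fun c ih => ?_
    · rw [zero_add, hM.out.basic.lt_succ]; exact .inr rfl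
    · rw [add_succ, hM.out.basic.lt_succ]; exact .inl ih

theorem le_iff {a b : M.Num} : a ≤ b ↔ ∃ c, b = a + c := by
  change a < b ∨ a = b ↔ _
  rw [lt_iff]
  constructor
  · rintro (⟨c, rfl⟩ | rfl)
    exacts [⟨_, rfl⟩, ⟨0, (add_zero _).symm⟩]
  · rintro ⟨c, rfl⟩
    rcases eq_zero_or_succ c with rfl | ⟨c, rfl⟩
    exacts [.inr (add_zero _).symm, .inl ⟨c, rfl⟩]

theorem lt_irrefl (a : M.Num) : ¬ a < a := fun h => by
  obtain ⟨c, hc⟩ := lt_iff.1 h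
  rw [add_comm] at hc
  exact hM.out.basic.succ_ne_zero c (add_right_cancel (hc.trans (zero_add a).symm))

theorem le_total (a b : M.Num) : a ≤ b ∨ b ≤ a := by
  refine induction_on (fun b => a ≤ b ∨ b ≤ a) b (.inr (le_iff.2 ⟨a, (zero_add a).symm⟩))
    fun b ih => ?_
  rcases ih with h | h
  · obtain ⟨c, rfl⟩ := le_iff.1 h
    exact .inl (le_iff.2 ⟨c + 1, (add_succ _ _).symm⟩)
  · obtain ⟨c, rfl⟩ := le_iff.1 h
    rcases eq_zero_or_succ c with rfl | ⟨c, rfl⟩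
    · exact .inl (le_iff.2 ⟨1, by rw [add_zero]⟩)
    · exact .inr (le_iff.2 ⟨c, by rw [add_succ, succ_add]⟩)

theorem le_antisymm {a b : M.Num} (h : a ≤ b) (h' : b ≤ a) : a = b := by
  obtain ⟨c, rfl⟩ := le_iff.1 h
  rcases eq_zero_or_succ c with rfl | ⟨c, rfl⟩
  · rw [add_zero]
  · obtain ⟨d, hd⟩ := le_iff.1 h'
    exact absurd (lt_iff.2 ⟨c + d, by rw [← succ_add, ← add_assoc]; exact hd.symm⟩)
      (lt_irrefl a)

end Arith

open Arith (eq_zero_or_succ)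

instance : CommSemiring M.Num where
  add_assoc := Arith.add_assoc
  zero_add := Arith.zero_add
  add_zero := Arith.add_zero
  add_comm := Arith.add_comm
  mul_assoc := Arith.mul_assoc
  mul_comm := Arith.mul_comm
  one_mul n := (Arith.mul_comm _ _).trans (Arith.mul_one n)
  mul_one := Arith.mul_one
  zero_mul := Arith.zero_mul
  mul_zero := Arith.mul_zero
  left_distrib := Arith.mul_add
  right_distrib a b c := by rw [Arith.mul_comm, Arith.mul_add, Arith.mul_comm c, Arith.mul_comm c]
  nsmul := nsmulRec
  npow := npowRec

noncomputable instance : LinearOrder M.Num where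
  le := (· ≤ ·)
  lt := (· < ·)
  le_refl _ := .inr rfl
  le_trans a b c h h' := by
    obtain ⟨d, rfl⟩ := Arith.le_iff.1 h
    obtain ⟨k, rfl⟩ := Arith.le_iff.1 h'
    exact Arith.le_iff.2 ⟨d + k, Arith.add_assoc _ _ _⟩
  le_antisymm _ _ := Arith.le_antisymm
  le_total := Arith.le_total
  lt_iff_le_not_ge a b := by
    refine ⟨fun h => ⟨.inl h, ?_⟩, fun ⟨h, h'⟩ => h.resolve_right fun h'' => h' (.inr h''.symm)⟩
    exact fun h' => Arith.lt_irrefl a (Arith.le_antisymm (.inl h) h' ▸ h)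
  toDecidableLE := Classical.decRel _

instance : IsOrderedCancelAddMonoid M.Num where
  add_le_add_left _ _ h _ := by
    obtain ⟨d, rfl⟩ := Arith.le_iff.1 h
    exact Arith.le_iff.2 ⟨d, by ring⟩
  le_of_add_le_add_left a b c h := by
    obtain ⟨d, h⟩ := Arith.le_iff.1 h
    exact Arith.le_iff.2 ⟨d, Arith.add_right_cancel (n := a)
      (by rw [add_comm c, h, add_assoc, add_comm a])⟩

instance : CanonicallyOrderedAdd M.Num where
  le_add_self _ b := Arith.le_iff.2 ⟨b, _root_.add_comm _ _⟩
  le_self_add _ b := Arith.le_iff.2 ⟨b, rfl⟩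
  exists_add_of_le h := Arith.le_iff.1 h

instance : Nontrivial M.Num :=
  ⟨0, 1, fun h => hM.out.basic.succ_ne_zero 0 (by rw [zero_add, ← h])⟩

theorem lt_succ_iff {a b : M.Num} : a < b + 1 ↔ a ≤ b := hM.out.basic.lt_succ a b

theorem succ_le_iff {a b : M.Num} : a + 1 ≤ b ↔ a < b := by
  rw [← not_lt, lt_succ_iff, not_le]

theorem Arith.mul_lt_mul_of_pos_left {a b c : M.Num} (ha : 0 < a) (hbc : b < c) :
    a * b < a * c := by
  obtain ⟨d, rfl⟩ := Arith.lt_iff.1 hbc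
  obtain ⟨k, hk⟩ := Arith.lt_iff.1 ha
  refine Arith.lt_iff.2 ⟨k * d + k + d, ?_⟩
  rw [← hk]
  ring

instance : IsStrictOrderedRing M.Num where
  zero_le_one := zero_le
  mul_lt_mul_of_pos_left _ ha _ _ hbc := Arith.mul_lt_mul_of_pos_left ha hbc
  mul_lt_mul_of_pos_right a ha b c hbc := by
    simpa only [mul_comm] using Arith.mul_lt_mul_of_pos_left ha hbc
theorem one_le_of_pos {a : M.Num} (h : 0 < a) : 1 ≤ a := by
  simpa only [zero_add] using succ_le_iff.2 h

theorem exists_least (P : M.Num → Prop) [BoundedDefinable (fun e => P (e 0))] (h : ∃ n, P n) :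
    ∃ n, P n ∧ ∀ m < n, ¬ P m := by
  by_contra! hc
  obtain ⟨n, hn⟩ := h
  have : BoundedDefinable (fun e : ℕ → M.Num => ∀ m, m < e 0 → ¬ P m) :=
    BoundedDefinable.ball _ (fun m _ => ¬ P m)
  have not_below (k : M.Num) : ∀ m, m < k → ¬ P m :=
    induction_on (fun k => ∀ m, m < k → ¬ P m) k (fun m h => absurd h not_lt_zero)
      fun k ih m hm hP => by
        rcases (lt_succ_iff.1 hm).lt_or_eq with h | rfl
        · exact ih m h hP
        · obtain ⟨l, hl, hl'⟩ := hc m hP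
          exact ih l hl hl'
  exact not_below (n + 1) n (lt_succ_iff.2 le_rfl) hn

theorem exists_greatest (P : M.Num → Prop) [BoundedDefinable (fun e => P (e 0))] (b : M.Num)
    (h : ∃ n, P n) (hb : ∀ n, P n → n ≤ b) : ∃ n, P n ∧ ∀ m, P m → m ≤ n := by
  have : BoundedDefinable (fun e : ℕ → M.Num => ∀ m, m < b + 1 → P m → m ≤ e 0) := by
    have : BoundedDefinable (fun e : ℕ → M.Num => P (e 0) → e 0 ≤ e 1) := inferInstance
    exact BoundedDefinable.ball (fun _ => b + 1) (fun m e => P m → m ≤ e 0)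
  obtain ⟨n, hn, hn'⟩ := exists_least (fun n => ∀ m, m < b + 1 → P m → m ≤ n)
    ⟨b, fun m hm _ => lt_succ_iff.1 hm⟩
  refine ⟨n, ?_, fun m hm => hn m (lt_succ_iff.2 (hb m hm)) hm⟩
  by_contra hP
  rcases eq_zero_or_succ n with rfl | ⟨k, rfl⟩
  · obtain ⟨m, hm⟩ := h
    exact hP (le_zero_iff.1 (hn m (lt_succ_iff.2 (hb m hm)) hm) ▸ hm)
  · refine hn' k (lt_succ_iff.2 le_rfl) fun m hm hPm => lt_succ_iff.1 ?_
    exact (hn m hm hPm).lt_of_ne fun h => hP (h ▸ hPm)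

theorem induction_on_not (P : M.Num → Prop) [Sigma1Definable (fun e => P (e 0))] (n : M.Num)
    (zero : ¬ P 0) (succ : ∀ n, ¬ P n → ¬ P (n + 1)) : ¬ P n := by
  intro hn
  have descend := induction_on (fun i => n < i ∨ ∃ j, j + i = n ∧ P j) n
    (.inr ⟨n, add_zero n, hn⟩) fun i ih => by
      rcases ih with h | ⟨j, rfl, hj⟩
      · exact .inl (h.trans (lt_succ_iff.2 le_rfl))
      · rcases eq_zero_or_succ j with rfl | ⟨j, rfl⟩
        · exact absurd hj zero
        · exact .inr ⟨j, by ring, not_imp_not.1 (succ j) hj⟩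
  rcases descend with h | ⟨j, h, hj⟩
  · exact lt_irrefl _ h
  · exact zero (by rwa [(add_eq_right (a := j)).1 h] at hj)

theorem exists_inv_lt {ε : Fr M.Num} (hε : 0 < ε) : ∃ u : M.Num, 0 < u ∧ 1 / toFr u < ε := by
  obtain ⟨a, b, hb, h⟩ := exists_eq_or_neg_div ε
  have hb_pos : 0 < toFr b := toFr_pos.2 (pos_iff_ne_zero.2 hb)
  have quotient_nonneg : 0 ≤ toFr a / toFr b := div_nonneg (toFr_nonneg _) hb_pos.le
  obtain rfl : ε = toFr a / toFr b := h.resolve_right (by rintro rfl; linarith)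
  have ha : 1 ≤ toFr a := by
    simpa only [map_one] using
      toFr_le.2 (one_le_of_pos (toFr_pos.1 ((div_pos_iff_of_pos_right hb_pos).1 hε)))
  refine ⟨b + 1, by positivity, ?_⟩
  rw [map_add, map_one, div_lt_div_iff₀ (by positivity) hb_pos]
  nlinarith

/-! ## Pairs -/

theorem pair_lt_of_add_lt {m n m' n' : M.Num} (h : m + n < m' + n') : pair m n < pair m' n' := by
  obtain ⟨d, hd⟩ := exists_add_of_le (succ_le_iff.2 h)
  have pair_eq : pair m' n' = pair m n + (m + n + n + 1 + (d + d) * (m + n + 1) + d * d + m') := by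
    simp only [pair, hd]
    ring
  rw [pair_eq]
  exact lt_add_of_pos_right _ (by positivity)

theorem pair_inj {m n m' n' : M.Num} : pair m n = pair m' n' ↔ m = m' ∧ n = n' := by
  refine ⟨fun h => ?_, fun ⟨h, h'⟩ => h ▸ h' ▸ rfl⟩
  rcases lt_trichotomy (m + n) (m' + n') with h' | h' | h'
  · exact absurd h (pair_lt_of_add_lt h').ne
  · have hm : m = m' := by simpa only [pair, h', add_right_inj] using h
    subst hm
    exact ⟨rfl, by simpa using h'⟩
  · exact absurd h (pair_lt_of_add_lt h').ne'

theorem pair_mono {m n m' n' : M.Num} (h : m ≤ m') (h' : n ≤ n') : pair m n ≤ pair m' n' := by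
  unfold pair
  gcongr

theorem left_le_pair (m n : M.Num) : m ≤ pair m n := le_add_self

theorem right_le_pair (m n : M.Num) : n ≤ pair m n := by
  rcases Arith.eq_zero_or_succ n with rfl | ⟨k, rfl⟩
  · exact zero_le
  · have pair_eq : pair m (k + 1) = k + 1 + (m * m + (m + m) * (k + 1) + k * k + k + m) := by
      unfold pair
      ring
    rw [pair_eq]
    exact le_self_add

/-! ## Values of formal differences and fractions -/

namespace PreInt

/-- The value of a formal difference in the field of fractions. -/
noncomputable def val (z : PreInt M) : Fr M.Num := toFr z.pos - toFr z.neg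

@[simp] theorem val_ofNum (n : M.Num) : (ofNum n).val = toFr n := by simp [val, ofNum]
@[simp] theorem val_add (z w : PreInt M) : (z.add w).val = z.val + w.val := by
  simp only [val, add, map_add]; ring
@[simp] theorem val_opp (z : PreInt M) : z.opp.val = -z.val := by simp [val, opp]
@[simp] theorem val_mul (z w : PreInt M) : (z.mul w).val = z.val * w.val := by
  simp only [val, mul, map_add, map_mul]; ring

theorem equiv_iff {z w : PreInt M} : z.Equiv w ↔ z.val = w.val := by
  unfold Equiv val
  rw [← toFr_inj, map_add, map_add, sub_eq_sub_iff_add_eq_add, add_comm (toFr w.pos)]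

theorem lt_iff {z w : PreInt M} : z.Lt w ↔ z.val < w.val := by
  unfold Lt val
  rw [← toFr_lt, map_add, map_add, sub_lt_sub_iff]

theorem isInt_iff {z : PreInt M} : z.IsInt ↔ z.pos = 0 ∨ z.neg = 0 := by
  obtain ⟨a, b⟩ := z
  constructor
  · intro h
    rcases Arith.eq_zero_or_succ a with rfl | ⟨a, rfl⟩
    · exact .inl rfl
    rcases Arith.eq_zero_or_succ b with rfl | ⟨b, rfl⟩
    · exact .inr rfl
    refine absurd (h ⟨a, b⟩ ?_) (not_le.2 (pair_lt_of_add_lt ?_))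
    · change a + (b + 1) = b + (a + 1)
      ring
    · exact add_lt_add (lt_succ_iff.2 le_rfl) (lt_succ_iff.2 le_rfl)
  · rintro (rfl | rfl) ⟨c, d⟩ hw
    · replace hw : c + b = d + 0 := hw
      exact pair_mono zero_le (by rw [add_zero] at hw; exact hw ▸ le_add_self)
    · replace hw : c + 0 = d + a := hw
      exact pair_mono (by rw [add_zero] at hw; exact hw ▸ le_add_self) zero_le

theorem code_injective : Function.Injective (code (M := M)) := fun z w h => by
  obtain ⟨hpos, hneg⟩ := pair_inj.1 h
  exact PreInt.ext hpos hneg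

end PreInt

namespace PreRat

/-- The value of a formal fraction in the field of fractions. Since `x / 0 = 0`, it is meaningful
only for a nonzero denominator; the lemmas below assume the denominator positive. -/
noncomputable def val (q : PreRat M) : Fr M.Num := q.num.val / q.den.val

/-- The fraction has a positive denominator, so that its value represents it. -/
def DenPos (q : PreRat M) : Prop := 0 < q.den.val

theorem code_injective : Function.Injective (code (M := M)) := fun q r h => by
  obtain ⟨hnum, hden⟩ := pair_inj.1 h
  exact PreRat.ext (PreInt.code_injective hnum) (PreInt.code_injective hden)

theorem IsFrac.denPos {q : PreRat M} (h : q.IsFrac) : q.DenPos := by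
  simpa [DenPos, PreInt.lt_iff] using h.2.2

theorem IsRat.denPos {q : PreRat M} (h : q.IsRat) : q.DenPos := h.1.denPos

theorem denPos_ofNums {a b : M.Num} (hb : 0 < b) : (ofNums a b).DenPos := by
  simpa [DenPos, ofNums] using hb

theorem DenPos.add {q r : PreRat M} (hq : q.DenPos) (hr : r.DenPos) : (q.add r).DenPos := by
  simpa [DenPos, PreRat.add] using mul_pos hq hr

theorem DenPos.opp {q : PreRat M} (hq : q.DenPos) : q.opp.DenPos := hq

theorem DenPos.sub {q r : PreRat M} (hq : q.DenPos) (hr : r.DenPos) : (q.sub r).DenPos :=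
  hq.add hr.opp

theorem DenPos.abs {q : PreRat M} (hq : q.DenPos) : q.abs.DenPos := by
  unfold PreRat.abs
  split_ifs
  exacts [hq.opp, hq]

@[simp] theorem val_ofNums (a b : M.Num) : (ofNums a b).val = toFr a / toFr b := by
  simp [val, ofNums]

theorem val_add {q r : PreRat M} (hq : q.DenPos) (hr : r.DenPos) :
    (q.add r).val = q.val + r.val := by
  simp only [val, add, PreInt.val_add, PreInt.val_mul, div_add_div _ _ hq.ne' hr.ne']
  ring

@[simp] theorem val_opp (q : PreRat M) : q.opp.val = -q.val := by
  simp [val, opp, neg_div]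

theorem val_sub {q r : PreRat M} (hq : q.DenPos) (hr : r.DenPos) :
    (q.sub r).val = q.val - r.val := by
  rw [sub, val_add hq hr.opp, val_opp, sub_eq_add_neg]

theorem lt_iff {q r : PreRat M} (hq : q.DenPos) (hr : r.DenPos) : q.Lt r ↔ q.val < r.val := by
  rw [Lt, PreInt.lt_iff, PreInt.val_mul, PreInt.val_mul, val, val, div_lt_div_iff₀ hq hr]

theorem le_iff {q r : PreRat M} (hq : q.DenPos) (hr : r.DenPos) : q.Le r ↔ q.val ≤ r.val := by
  rw [Le, lt_iff hr hq, not_lt]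

theorem equiv_iff {q r : PreRat M} (hq : q.DenPos) (hr : r.DenPos) :
    q.Equiv r ↔ q.val = r.val := by
  rw [Equiv, PreInt.equiv_iff, PreInt.val_mul, PreInt.val_mul, val, val,
    div_eq_div_iff hq.ne' hr.ne', mul_comm q.den.val]

theorem val_abs {q : PreRat M} (hq : q.DenPos) : q.abs.val = |q.val| := by
  unfold PreRat.abs
  have h : q.Lt (ofNums 0 1) ↔ q.val < 0 := by simp [lt_iff hq (denPos_ofNums zero_lt_one)]
  split_ifs with h'
  · rw [val_opp, abs_of_neg (h.1 h')]
  · rw [abs_of_nonneg (not_lt.1 (h.not.1 h'))]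

theorem exists_isFrac (x : Fr M.Num) : ∃ q : PreRat M, q.IsFrac ∧ q.val = x := by
  obtain ⟨a, b, hb, h | h⟩ := exists_eq_or_neg_div x
  · exact ⟨ofNums a b, ⟨PreInt.isInt_iff.2 (.inr rfl), PreInt.isInt_iff.2 (.inr rfl),
      PreInt.lt_iff.2 (by simpa [ofNums] using pos_iff_ne_zero.2 hb)⟩, by simp [h]⟩
  · exact ⟨(ofNums a b).opp, ⟨PreInt.isInt_iff.2 (.inl rfl), PreInt.isInt_iff.2 (.inr rfl),
      PreInt.lt_iff.2 (by simpa [ofNums, opp] using pos_iff_ne_zero.2 hb)⟩, by simp [h]⟩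

theorem isRat_iff {q : PreRat M} :
    q.IsRat ↔ q.IsFrac ∧ ¬ ∃ r : PreRat M, r.code < q.code ∧ r.IsFrac ∧ r.Equiv q := by
  refine and_congr_right fun _ => ?_
  push Not
  exact forall_congr' fun r => ⟨fun h hlt hr hrq => (h hr hrq).not_gt hlt,
    fun h hr hrq => not_lt.1 fun hlt => h hlt hr hrq⟩

end PreRat

namespace RatDefinable

variable (q : (ℕ → M.Num) → PreRat M)

instance bex (t : (ℕ → M.Num) → M.Num) [TermDefinable t] (R : PreRat M → (ℕ → M.Num) → Prop)
    [BoundedDefinable (fun e => R ⟨⟨e 3, e 2⟩, ⟨e 1, e 0⟩⟩ (fun i => e (i + 4)))] :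
    BoundedDefinable (fun e => ∃ q : PreRat M, q.code < t e ∧ R q e) := by
  refine Definable.of_iff (Q := fun e => ∃ a, a < t e ∧ ∃ b, b < t e ∧ ∃ c, c < t e ∧
    ∃ d, d < t e ∧ (PreRat.code ⟨⟨a, b⟩, ⟨c, d⟩⟩ < t e ∧ R ⟨⟨a, b⟩, ⟨c, d⟩⟩ e)) fun e => ⟨?_, ?_⟩
  · rintro ⟨⟨⟨a, b⟩, ⟨c, d⟩⟩, h, h'⟩
    exact ⟨a, ((left_le_pair _ _).trans (left_le_pair _ _)).trans_lt h,
      b, ((right_le_pair _ _).trans (left_le_pair _ _)).trans_lt h,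
      c, ((left_le_pair _ _).trans (right_le_pair _ _)).trans_lt h,
      d, ((right_le_pair _ _).trans (right_le_pair _ _)).trans_lt h, h, h'⟩
  · rintro ⟨a, _, b, _, c, _, d, _, h, h'⟩
    exact ⟨_, h, h'⟩

instance isFrac [RatDefinable q] : BoundedDefinable (fun e => (q e).IsFrac) :=
  Definable.of_iff (Q := fun e => ((q e).num.pos = 0 ∨ (q e).num.neg = 0) ∧
    ((q e).den.pos = 0 ∨ (q e).den.neg = 0) ∧ (PreInt.ofNum 0).Lt (q e).den) fun _ => by
      simp only [PreRat.IsFrac, PreInt.isInt_iff]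

instance isRat [RatDefinable q] : BoundedDefinable (fun e => (q e).IsRat) :=
  Definable.of_iff fun e => PreRat.isRat_iff (q := q e)

end RatDefinable

theorem exists_rat (x : Fr M.Num) : ∃ q : M.Rat, q.1.val = x := by
  obtain ⟨q₀, hq₀, rfl⟩ := PreRat.exists_isFrac x
  obtain ⟨_, ⟨q, -, rfl, hq, hqq₀⟩, code_min⟩ := exists_least
    (fun c => ∃ q : PreRat M, q.code < c + 1 ∧ c = q.code ∧ q.IsFrac ∧ q.Equiv q₀)
    ⟨q₀.code, q₀, lt_succ_iff.2 le_rfl, rfl, hq₀, (PreRat.equiv_iff hq₀.denPos hq₀.denPos).2 rfl⟩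
  have val_eq := (PreRat.equiv_iff hq.denPos hq₀.denPos).1 hqq₀
  refine ⟨⟨q, hq, fun r hr hrq => not_lt.1 fun hlt =>
    code_min r.code hlt ⟨r, lt_succ_iff.2 le_rfl, rfl, hr, ?_⟩⟩, val_eq⟩
  rw [PreRat.equiv_iff hr.denPos hq₀.denPos, ← val_eq]
  exact (PreRat.equiv_iff hr.denPos hq.denPos).1 hrq

theorem rat_denPos (q : M.Rat) : q.1.DenPos := q.2.denPos

theorem rat_val_injective {q r : M.Rat} (h : q.1.val = r.1.val) : q = r :=
  Subtype.ext (PreRat.code_injective (_root_.le_antisymm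
    (q.2.2 _ r.2.1 ((PreRat.equiv_iff (rat_denPos r) (rat_denPos q)).2 h.symm))
    (r.2.2 _ q.2.1 ((PreRat.equiv_iff (rat_denPos q) (rat_denPos r)).2 h))))

theorem rat_code_inj {q r : M.Rat} : q.1.code = r.1.code ↔ q = r :=
  ⟨fun h => Subtype.ext (PreRat.code_injective h), fun h => h ▸ rfl⟩

/-! ## Codes of finite sets -/

instance BoundedDefinable.dvd (t s : (ℕ → M.Num) → M.Num) [TermDefinable t] [TermDefinable s] :
    BoundedDefinable (fun e => t e ∣ s e) := by
  refine Definable.of_iff (Q := fun e => ∃ c, c < s e + 1 ∧ s e = t e * c) fun e => ⟨?_, ?_⟩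
  · rintro ⟨c, hc⟩
    rcases eq_or_ne (t e) 0 with h | h
    · exact ⟨0, zero_lt_one.trans_le le_add_self, by rw [hc, h, zero_mul, zero_mul]⟩
    · refine ⟨c, lt_succ_iff.2 ?_, hc⟩
      rw [hc]
      exact le_mul_of_one_le_left zero_le (one_le_of_pos (pos_iff_ne_zero.2 h))
  · rintro ⟨c, _, hc⟩
    exact ⟨c, hc⟩

/-- Gödel's moduli, pairwise coprime for suitable `b`: a pair `(b, z)` codes the finite set of all
`i` with `modulus b i ∣ z`. -/
def modulus (b i : M.Num) : M.Num := (i + 1) * b + 1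

instance TermDefinable.modulus (t s : (ℕ → M.Num) → M.Num) [TermDefinable t] [TermDefinable s] :
    TermDefinable (fun e => modulus (t e) (s e)) := by
  unfold L2Structure.modulus
  infer_instance

theorem isCoprime_modulus {b i j d : M.Num} (hd : d ∣ b) (hij : i + d = j) :
    IsCoprime (toDifferenceRing (modulus b i)) (toDifferenceRing (modulus b j)) := by
  obtain ⟨c, hc⟩ := hd
  have hB : toDifferenceRing b = toDifferenceRing d * toDifferenceRing c := by rw [hc, map_mul]
  subst hij
  set B := toDifferenceRing b
  set I := toDifferenceRing i
  set D := toDifferenceRing d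
  set C := toDifferenceRing c
  have hi : toDifferenceRing (modulus b i) = (I + 1) * B + 1 := by simp [modulus, I, B]
  have hj : toDifferenceRing (modulus b (i + d)) = (I + D + 1) * B + 1 := by simp [modulus, I, B, D]
  rw [hi, hj]
  refine ⟨1 - (I + 1) * B - (I + 1) ^ 2 * C, (I + 1) ^ 2 * C, ?_⟩
  linear_combination ((I + 1) ^ 2 * B) * (-hB)

theorem dvd_of_modulus_dvd_mul {b i j N z : M.Num} (hb : ∀ d, d < N → 0 < d → d ∣ b) (hi : i < N)
    (hj : j < N) (hij : i ≠ j) (h : modulus b i ∣ z * modulus b j) : modulus b i ∣ z := by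
  have hc : IsCoprime (toDifferenceRing (modulus b i)) (toDifferenceRing (modulus b j)) := by
    rcases lt_or_gt_of_ne hij with h' | h' <;> obtain ⟨d, rfl⟩ := exists_add_of_le h'.le
    · exact isCoprime_modulus (hb d (le_add_self.trans_lt hj)
        (pos_iff_ne_zero.2 fun hd => hij (by rw [hd, add_zero]))) rfl
    · exact (isCoprime_modulus (hb d (le_add_self.trans_lt hi)
        (pos_iff_ne_zero.2 fun hd => hij (by rw [hd, add_zero]))) rfl).symm
  exact dvd_of_toDifferenceRing_dvd (hc.dvd_of_dvd_mul_right (by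
    rw [← map_mul]
    exact map_dvd toDifferenceRing h))

theorem exists_forall_dvd (N : M.Num) : ∃ b, 0 < b ∧ ∀ d, d < N → 0 < d → d ∣ b := by
  refine induction_on (fun N => ∃ b, 0 < b ∧ ∀ d, d < N → 0 < d → d ∣ b) N
    ⟨1, zero_lt_one, fun d hd => absurd hd not_lt_zero⟩ ?_
  rintro N ⟨b, hb, h⟩
  rcases eq_or_ne N 0 with rfl | hN
  · exact ⟨1, zero_lt_one, fun d hd hd' => absurd (hd'.trans_le (lt_succ_iff.1 hd)) (lt_irrefl 0)⟩
  · refine ⟨b * N, mul_pos hb (pos_iff_ne_zero.2 hN), fun d hd hd' => ?_⟩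
    rcases (lt_succ_iff.1 hd).lt_or_eq with hlt | rfl
    · exact (h d hlt hd').mul_right N
    · exact dvd_mul_left d b

theorem not_modulus_dvd_one {b : M.Num} (hb : 0 < b) (i : M.Num) : ¬ modulus b i ∣ 1 := by
  rintro ⟨c, hc⟩
  have one_lt_modulus : 1 < modulus b i := lt_add_of_pos_left _ (by positivity)
  have c_pos : 0 < c := pos_iff_ne_zero.2 fun h => one_ne_zero (by rw [hc, h, mul_zero])
  exact (one_lt_modulus.trans_le
    (le_mul_of_one_le_right zero_le (one_le_of_pos c_pos))).ne hc

theorem exists_modulus_dvd_iff (P : M.Num → Prop) [BoundedDefinable (fun e => P (e 0))]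
    (N : M.Num) : ∃ b z, ∀ j, j < N → (modulus b j ∣ z ↔ P j) := by
  obtain ⟨b, hb, hdvd⟩ := exists_forall_dvd N
  suffices initial_segment : ∀ i, ∃ z, ∀ j, j < N → (modulus b j ∣ z ↔ j < i ∧ P j) by
    obtain ⟨z, hz⟩ := initial_segment N
    exact ⟨b, z, fun j hj => (hz j hj).trans (and_iff_right hj)⟩
  refine fun i => induction_on (fun i => ∃ z, ∀ j, j < N → (modulus b j ∣ z ↔ j < i ∧ P j)) i
    ⟨1, fun j _ => iff_of_false (not_modulus_dvd_one hb j) fun h => not_lt_zero h.1⟩ ?_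
  rintro i ⟨z, hz⟩
  by_cases hPi : P i ∧ i < N
  · refine ⟨z * modulus b i, fun j hj => ?_⟩
    rcases eq_or_ne j i with rfl | hji
    · exact iff_of_true (dvd_mul_left _ _) ⟨lt_succ_iff.2 le_rfl, hPi.1⟩
    · have dvd_mul_iff : modulus b j ∣ z * modulus b i ↔ modulus b j ∣ z :=
        ⟨dvd_of_modulus_dvd_mul hdvd hj hPi.2 hji, fun h => h.mul_right _⟩
      rw [dvd_mul_iff, hz j hj, lt_succ_iff, le_iff_lt_or_eq, or_iff_left hji]
  · refine ⟨z, fun j hj => (hz j hj).trans (and_congr_left fun hPj => ?_)⟩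
    rw [lt_succ_iff, le_iff_lt_or_eq, or_iff_left]
    rintro rfl
    exact hPi ⟨hPj, hj⟩

/-! ## Existence of the exponential function -/

/-- `(b, z)` codes a set of pairs, closed under predecessors below `(n, y)`, for the recursion
`2 ^ 0 = 1`, `2 ^ (i + 1) = 2 ^ i + 2 ^ i`. -/
def PowClosed (b z n y : M.Num) : Prop :=
  ∀ i, i < n + 1 → ∀ u, u < y + 1 → modulus b (pair i u) ∣ z →
    (i = 0 ∧ u = 1) ∨ ∃ j, j < i ∧ ∃ w, w < u + 1 ∧
      (i = j + 1 ∧ u = w + w ∧ modulus b (pair j w) ∣ z)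

/-- `y = 2 ^ n`, witnessed by a coded computation. -/
def PowGraph (n y : M.Num) : Prop :=
  ∃ b z, modulus b (pair n y) ∣ z ∧ PowClosed b z n y

instance Sigma1Definable.powGraph (t s : (ℕ → M.Num) → M.Num) [TermDefinable t] [TermDefinable s] :
    Sigma1Definable (fun e => PowGraph (t e) (s e)) := by
  unfold PowGraph PowClosed
  infer_instance

theorem PowGraph.unique {n y y' : M.Num} (h : PowGraph n y) (h' : PowGraph n y') : y = y' := by
  obtain ⟨b, z, hm, hc⟩ := h
  obtain ⟨b', z', hm', hc'⟩ := h'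
  have eq_below := induction_on (fun i => i < n + 1 → ∀ u, u < y + 1 → ∀ u', u' < y' + 1 →
    modulus b (pair i u) ∣ z → modulus b' (pair i u') ∣ z' → u = u') n ?_ ?_
  · exact eq_below (lt_succ_iff.2 le_rfl) y (lt_succ_iff.2 le_rfl) y' (lt_succ_iff.2 le_rfl) hm hm'
  · intro h0 u hu u' hu' hz hz'
    rcases hc 0 h0 u hu hz with ⟨-, rfl⟩ | ⟨j, hj, _⟩
    · rcases hc' 0 h0 u' hu' hz' with ⟨-, rfl⟩ | ⟨j, hj, _⟩
      · rfl
      · exact absurd hj not_lt_zero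
    · exact absurd hj not_lt_zero
  · intro i ih hi u hu u' hu' hz hz'
    rcases hc _ hi u hu hz with ⟨h0, -⟩ | ⟨j, _, w, hw, hj, rfl, hwz⟩
    · exact absurd h0 (hM.out.basic.succ_ne_zero i)
    · rcases hc' _ hi u' hu' hz' with ⟨h0, -⟩ | ⟨j', _, w', hw', hj', rfl, hwz'⟩
      · exact absurd h0 (hM.out.basic.succ_ne_zero i)
      · obtain rfl := add_right_cancel hj
        obtain rfl := add_right_cancel hj'
        rw [ih (lt_of_le_of_lt le_self_add hi) w
          (lt_of_le_of_lt (lt_succ_iff.1 hw) hu) w' (lt_of_le_of_lt (lt_succ_iff.1 hw') hu') hwz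
          hwz']

theorem powGraph_zero : PowGraph (0 : M.Num) 1 := by
  obtain ⟨b, z, h⟩ := exists_modulus_dvd_iff (fun w : M.Num => w = pair 0 1) (pair 0 1 + 1)
  refine ⟨b, z, (h _ (lt_succ_iff.2 le_rfl)).2 rfl, fun i hi u hu hz => .inl ?_⟩
  exact pair_inj.1 <|
    (h (pair i u) (lt_succ_iff.2 (pair_mono (lt_succ_iff.1 hi) (lt_succ_iff.1 hu)))).1 hz

theorem PowGraph.succ {n y : M.Num} (h : PowGraph n y) : PowGraph (n + 1) (y + y) := by
  obtain ⟨b, z, hm, hc⟩ := h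
  obtain ⟨b', z', h⟩ := exists_modulus_dvd_iff (fun w : M.Num => w = pair (n + 1) (y + y) ∨
    ∃ i, i < n + 1 ∧ ∃ u, u < y + 1 ∧ (w = pair i u ∧ modulus b w ∣ z))
    (pair (n + 1) (y + y) + 1)
  have dvd_new : ∀ i u, i < n + 1 → u < y + 1 → modulus b (pair i u) ∣ z →
      modulus b' (pair i u) ∣ z' := fun i u hi hu hz =>
    (h _ (lt_succ_iff.2 (pair_mono hi.le ((lt_succ_iff.1 hu).trans le_self_add)))).2
      (.inr ⟨i, hi, u, hu, rfl, hz⟩)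
  refine ⟨b', z', (h _ (lt_succ_iff.2 le_rfl)).2 (.inl rfl), fun i hi u hu hz => ?_⟩
  rcases (h _ (lt_succ_iff.2 (pair_mono (lt_succ_iff.1 hi) (lt_succ_iff.1 hu)))).1 hz with
    h' | ⟨i', hi', u', hu', h', hz'⟩
  · obtain ⟨rfl, rfl⟩ := pair_inj.1 h'
    exact .inr ⟨n, lt_succ_iff.2 le_rfl, y, lt_succ_iff.2 le_self_add, rfl, rfl,
      dvd_new _ _ (lt_succ_iff.2 le_rfl) (lt_succ_iff.2 le_rfl) hm⟩
  · obtain ⟨rfl, rfl⟩ := pair_inj.1 h'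
    refine (hc i hi' u hu' hz').imp_right ?_
    rintro ⟨j, hj, w, hw, rfl, rfl, hwz⟩
    exact ⟨j, hj, w, hw, rfl, rfl, dvd_new _ _ (hj.trans hi')
      (lt_of_le_of_lt (lt_succ_iff.1 hw) hu') hwz⟩

theorem exists_powGraph (n : M.Num) : ∃ y, PowGraph n y :=
  induction_on (fun n => ∃ y, PowGraph n y) n ⟨1, powGraph_zero⟩ fun _ ⟨y, h⟩ => ⟨y + y, h.succ⟩

/-! ## Powers of two -/

/-- The complement of the graph is `Σ⁰₁` as well: a number outside the graph either is not a pair or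
carries a value different from the one the function takes. -/
theorem isSet_graph (G : M.Num → M.Num → Prop) [Sigma1Definable (fun e => G (e 1) (e 0))]
    (hG : ∀ n, ∃! y, G n y) : IsSet {w | ∃ n y, w = pair n y ∧ G n y} := by
  have graph : Sigma1Definable (fun e : ℕ → M.Num => G (e 2) (e 0)) :=
    Definable.rename (fun e => G (e 1) (e 0)) (fun i => 2 * i)
  have compl_graph : Sigma1Definable (fun e => ¬ ∃ n y, e 0 = pair n y ∧ G n y) := by
    refine Definable.of_iff (Q := fun e =>
      (¬ ∃ n, n < e 0 + 1 ∧ ∃ y, y < e 0 + 1 ∧ e 0 = pair n y) ∨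
      ∃ n y y' : M.Num, (e 0 = pair n y ∧ y ≠ y') ∧ G n y') fun e => ⟨fun h => ?_, ?_⟩
    · by_cases isPair : ∃ n y, e 0 = pair n y
      · obtain ⟨n, y, hw⟩ := isPair
        obtain ⟨y', hy'⟩ := (hG n).exists
        exact .inr ⟨n, y, y', ⟨hw, fun hy => h ⟨n, y, hw, hy ▸ hy'⟩⟩, hy'⟩
      · exact .inl fun ⟨n, _, y, _, hw⟩ => isPair ⟨n, y, hw⟩
    · rintro (h | ⟨n, y, y', ⟨hw, hne⟩, h⟩) ⟨n', y'', hw', h'⟩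
      · exact h ⟨n', hw' ▸ lt_succ_iff.2 (left_le_pair _ _), y'',
          hw' ▸ lt_succ_iff.2 (right_le_pair _ _), hw'⟩
      · obtain ⟨rfl, rfl⟩ := pair_inj.1 (hw.symm.trans hw')
        exact hne ((hG n).unique h' h)
  exact isSet_setOf (fun w => ∃ n y, w = pair n y ∧ G n y)

/-- The power `2 ^ n` in `M`. -/
noncomputable def pow2 (n : M.Num) : M.Num := (exists_powGraph n).choose

theorem powGraph_iff {n y : M.Num} : PowGraph n y ↔ y = pow2 n :=
  have spec : PowGraph n (pow2 n) := (exists_powGraph n).choose_spec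
  ⟨fun h => h.unique spec, fun h => h ▸ spec⟩

theorem pow2_zero : pow2 (0 : M.Num) = 1 := (powGraph_iff.1 powGraph_zero).symm

theorem pow2_succ (n : M.Num) : pow2 (n + 1) = pow2 n + pow2 n :=
  (powGraph_iff.1 (powGraph_iff.2 rfl).succ).symm

/-- The graph of `n ↦ 2 ^ n`, as a set of coded pairs. -/
def powSet (M : L2Structure.{u}) [Fact M.ModelsRCA0] : Set M.Num :=
  {w | ∃ n y, w = pair n y ∧ PowGraph n y}

instance isSet_powSet : IsSet (powSet M) :=
  isSet_graph PowGraph fun n => ⟨pow2 n, powGraph_iff.2 rfl, fun _ h => powGraph_iff.1 h⟩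

theorem pair_mem_powSet {n y : M.Num} : pair n y ∈ powSet M ↔ y = pow2 n := by
  rw [← powGraph_iff]
  refine ⟨?_, fun h => ⟨n, y, rfl, h⟩⟩
  rintro ⟨n', y', hw, h⟩
  obtain ⟨rfl, rfl⟩ := pair_inj.1 hw
  exact h

instance BoundedDefinable.eq_pow2 (t s : (ℕ → M.Num) → M.Num) [TermDefinable t] [TermDefinable s] :
    BoundedDefinable (fun e => s e = pow2 (t e)) :=
  Definable.of_iff (Q := fun e => pair (t e) (s e) ∈ powSet M) fun _ => pair_mem_powSet.symm

theorem isPow2_iff {m v : M.Num} : IsPow2 m v ↔ v = pow2 m := by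
  constructor
  · rintro ⟨E, hE, hfun, hzero, hsucc, hmv⟩
    have E_isSet := IsSet.mk hE
    obtain ⟨v', rfl, hmv'⟩ := induction_on (fun n => ∃ v, v = pow2 n ∧ pair n v ∈ E) m
      ⟨1, pow2_zero.symm, hzero⟩ fun n ⟨v, hv, h⟩ => ⟨v + v, by rw [pow2_succ, hv], hsucc _ _ h⟩
    exact (hfun.2 m trivial).unique ⟨trivial, hmv⟩ ⟨trivial, hmv'⟩
  · rintro rfl
    refine ⟨powSet M, IsSet.mem, ⟨?_, fun n _ => ?_⟩, pair_mem_powSet.2 pow2_zero.symm,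
      fun n y h => pair_mem_powSet.2 (by rw [pow2_succ, pair_mem_powSet.1 h]),
      pair_mem_powSet.2 rfl⟩
    · rintro _ ⟨n, y, rfl, -⟩
      exact ⟨n, trivial, y, trivial, rfl⟩
    · exact ⟨pow2 n, ⟨trivial, pair_mem_powSet.2 rfl⟩, fun y h => pair_mem_powSet.1 h.2⟩

theorem lt_pow2 (n : M.Num) : n < pow2 n := by
  obtain ⟨v, rfl, h⟩ := induction_on (fun n => ∃ v, v = pow2 n ∧ n < v) n
    ⟨1, pow2_zero.symm, zero_lt_one⟩ fun n ⟨v, hv, h⟩ => ⟨v + v, by rw [pow2_succ, hv],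
      add_lt_add_of_lt_of_le h (one_le_of_pos (zero_le.trans_lt h))⟩
  exact h

theorem pow2_pos (n : M.Num) : 0 < pow2 n := zero_le.trans_lt (lt_pow2 n)

theorem pow2_add (m n : M.Num) : pow2 (m + n) = pow2 m * pow2 n := by
  obtain ⟨v, hv, h⟩ := induction_on
    (fun n => ∃ v, v = pow2 n ∧ pow2 m * v = pow2 (m + n)) n
    ⟨1, pow2_zero.symm, by rw [add_zero, mul_one]⟩ fun n ⟨v, hv, h⟩ =>
      ⟨v + v, by rw [pow2_succ, hv], by rw [← add_assoc, pow2_succ, ← h]; ring⟩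
  rw [← h, hv]

theorem pow2_mono {m n : M.Num} (h : m ≤ n) : pow2 m ≤ pow2 n := by
  obtain ⟨d, rfl⟩ := exists_add_of_le h
  rw [pow2_add]
  exact le_mul_of_one_le_right zero_le (one_le_of_pos (pow2_pos d))

/-- `2 ^ (-k)`. -/
noncomputable def eps (k : M.Num) : Fr M.Num := 1 / toFr (pow2 k)

theorem eps_pos (k : M.Num) : 0 < eps k := one_div_pos.2 (toFr_pos.2 (pow2_pos k))

theorem eps_anti {m n : M.Num} (h : m ≤ n) : eps n ≤ eps m :=
  one_div_le_one_div_of_le (toFr_pos.2 (pow2_pos m)) (toFr_le.2 (pow2_mono h))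

theorem eps_succ (n : M.Num) : eps (n + 1) = eps n / 2 := by
  rw [eps, eps, pow2_succ, map_add, ← two_mul, div_div, mul_comm]

theorem exists_eps_lt {ε : Fr M.Num} (hε : 0 < ε) : ∃ k, eps k < ε := by
  obtain ⟨u, hu, h⟩ := exists_inv_lt hε
  exact ⟨u, (one_div_le_one_div_of_le (toFr_pos.2 hu) (toFr_le.2 (lt_pow2 u).le)).trans_lt h⟩

theorem le_of_forall_eps {x y : Fr M.Num} (c : Fr M.Num) (hc : 0 < c) (h : ∀ k, x ≤ y + c * eps k) :
    x ≤ y := by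
  by_contra! hlt
  obtain ⟨k, hk⟩ := exists_eps_lt (div_pos (sub_pos.2 hlt) hc)
  rw [lt_div_iff₀ hc] at hk
  linarith [h k]

/-! ## Real numbers as sequences of fractions -/

theorem val_two_div (v : M.Num) : (PreRat.ofNums (1 + 1) v).val = 2 * (1 / toFr v) := by
  rw [PreRat.val_ofNums, map_add, map_one, one_add_one_eq_two]
  ring

/-- The set `A` of coded pairs is a sequence of rational numbers with values `a`. -/
def Represents (A : Set M.Num) (a : M.Num → Fr M.Num) : Prop :=
  ∀ k (q : M.Rat), At A k q ↔ q.1.val = a k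

open Classical in
/-- The sequence of values of the terms of `A`, with the junk value `0` at missing terms. -/
noncomputable def termSeq (A : Set M.Num) (k : M.Num) : Fr M.Num :=
  if h : ∃ q : M.Rat, At A k q then h.choose.1.val else 0

omit hM in
theorem IsReal.exists_at {A : Set M.Num} (hA : IsReal A) (k : M.Num) : ∃ q : M.Rat, At A k q := by
  obtain ⟨_, ⟨⟨q, rfl⟩, hq⟩, _⟩ := hA.2.1.2 k trivial
  exact ⟨q, hq⟩

theorem IsReal.represents {A : Set M.Num} (hA : IsReal A) : Represents A (termSeq A) := by
  intro k q
  have h := hA.exists_at k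
  have at_choose : At A k h.choose := h.choose_spec
  rw [show termSeq A k = h.choose.1.val from dif_pos h]
  refine ⟨fun hq => ?_, fun hq => rat_val_injective hq ▸ at_choose⟩
  have code_eq := (hA.2.1.2 k trivial).unique ⟨⟨q, rfl⟩, hq⟩ ⟨⟨_, rfl⟩, at_choose⟩
  rw [rat_code_inj.1 code_eq]

theorem Represents.constReal {q : PreRat M} (hq : q.DenPos) :
    Represents (constReal q) fun _ => q.val := by
  intro k r
  constructor
  · rintro ⟨k', a, h, hc⟩
    obtain ⟨rfl, hc'⟩ := pair_inj.1 hc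
    rw [rat_code_inj.1 hc']
    exact (PreRat.equiv_iff (rat_denPos a) hq).1 h
  · exact fun h => ⟨k, r, (PreRat.equiv_iff (rat_denPos r) hq).2 h, rfl⟩

theorem Represents.realSub {A B : Set M.Num} {a b : M.Num → Fr M.Num} (hA : Represents A a)
    (hB : Represents B b) : Represents (realSub A B) fun k => a (k + 1) - b (k + 1) := by
  intro k r
  constructor
  · rintro ⟨k', q, q', d, hq, hq', h, hc⟩
    obtain ⟨rfl, hc'⟩ := pair_inj.1 hc
    change _ = a (k + 1) - b (k + 1)
    rw [rat_code_inj.1 hc', ← (hA _ _).1 hq, ← (hB _ _).1 hq',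
      ← PreRat.val_sub (rat_denPos q) (rat_denPos q')]
    exact (PreRat.equiv_iff (rat_denPos d) ((rat_denPos q).sub (rat_denPos q'))).1 h
  · intro h
    obtain ⟨q, hq⟩ := exists_rat (a (k + 1))
    obtain ⟨q', hq'⟩ := exists_rat (b (k + 1))
    refine ⟨k, q, q', r, (hA _ _).2 hq, (hB _ _).2 hq', ?_, rfl⟩
    rw [PreRat.equiv_iff (rat_denPos r) ((rat_denPos q).sub (rat_denPos q')), h,
      PreRat.val_sub (rat_denPos q) (rat_denPos q'), hq, hq']

theorem Represents.realAbs {A : Set M.Num} {a : M.Num → Fr M.Num} (hA : Represents A a) :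
    Represents (realAbs A) fun k => |a k| := by
  intro k r
  constructor
  · rintro ⟨k', q, d, hq, h, hc⟩
    obtain ⟨rfl, hc'⟩ := pair_inj.1 hc
    change _ = |a k|
    rw [rat_code_inj.1 hc', ← (hA _ _).1 hq, ← PreRat.val_abs (rat_denPos q)]
    exact (PreRat.equiv_iff (rat_denPos d) (rat_denPos q).abs).1 h
  · intro h
    obtain ⟨q, hq⟩ := exists_rat (a k)
    refine ⟨k, q, r, (hA _ _).2 hq, ?_, rfl⟩
    rw [PreRat.equiv_iff (rat_denPos r) (rat_denPos q).abs, h, PreRat.val_abs (rat_denPos q), hq]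

theorem ratPos_iff {ε : M.Rat} : RatPos ε ↔ 0 < ε.1.val := by
  rw [RatPos, PreRat.lt_iff (PreRat.denPos_ofNums zero_lt_one) (rat_denPos ε)]
  simp

theorem represents_zero : Represents (constReal (.ofNums (0 : M.Num) 1)) fun _ => 0 := by
  simpa using Represents.constReal (PreRat.denPos_ofNums (a := (0 : M.Num)) zero_lt_one)

theorem represents_one : Represents (constReal (.ofNums (1 : M.Num) 1)) fun _ => 1 := by
  simpa using Represents.constReal (PreRat.denPos_ofNums (a := (1 : M.Num)) zero_lt_one)

theorem Represents.eq {A : Set M.Num} {a b : M.Num → Fr M.Num} (ha : Represents A a)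
    (hb : Represents A b) : a = b := by
  funext k
  obtain ⟨q, hq⟩ := exists_rat (a k)
  rw [← hq]
  exact (hb k q).1 ((ha k q).2 hq)

/-! ## Regular sequences -/

/-- The sequence `a` converges at the rate required of a real number. -/
def Regular (a : M.Num → Fr M.Num) : Prop := ∀ m n, m ≤ n → |a m - a n| ≤ eps m

theorem Regular.abs_sub_le {a : M.Num → Fr M.Num} (ha : Regular a) (m n : M.Num) :
    |a m - a n| ≤ eps m + eps n := by
  rcases le_total m n with h | h
  · exact (ha m n h).trans (le_add_of_nonneg_right (eps_pos _).le)
  · rw [abs_sub_comm]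
    exact (ha n m h).trans (le_add_of_nonneg_left (eps_pos _).le)

theorem Regular.le {a : M.Num → Fr M.Num} (ha : Regular a) (m n : M.Num) :
    a m ≤ a n + eps m + eps n := by
  linarith [le_abs_self (a m - a n), ha.abs_sub_le m n]

theorem IsReal.regular {A : Set M.Num} (hA : IsReal A) : Regular (termSeq A) := by
  intro m n hmn
  obtain ⟨q, hq⟩ := hA.exists_at m
  obtain ⟨r, hr⟩ := hA.exists_at n
  obtain ⟨v, hv, h⟩ := hA.2.2 m n q r hmn hq hr
  have hd := (rat_denPos q).sub (rat_denPos r)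
  rw [isPow2_iff] at hv
  subst hv
  rw [PreRat.le_iff hd.abs (PreRat.denPos_ofNums (pow2_pos _)), PreRat.val_abs hd,
    PreRat.val_sub (rat_denPos q) (rat_denPos r), (hA.represents _ _).1 hq,
    (hA.represents _ _).1 hr] at h
  simpa [eps] using h

theorem Represents.isReal {A : Set M.Num} {a : M.Num → Fr M.Num} (h : Represents A a)
    (hA : A ∈ M.sets) (hc : ∀ c ∈ A, ∃ k, ∃ q : M.Rat, c = pair k q.1.code) (ha : Regular a) :
    IsReal A := by
  refine ⟨hA, ⟨fun c hcA => ?_, fun k _ => ?_⟩, fun m n q r hmn hq hr =>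
    ⟨pow2 m, isPow2_iff.2 rfl, ?_⟩⟩
  · obtain ⟨k, q, rfl⟩ := hc c hcA
    exact ⟨k, trivial, _, ⟨q, rfl⟩, rfl⟩
  · obtain ⟨q, hq⟩ := exists_rat (a k)
    refine ⟨q.1.code, ⟨⟨q, rfl⟩, (h k q).2 hq⟩, ?_⟩
    rintro _ ⟨⟨r, rfl⟩, hr⟩
    rw [rat_val_injective (hq.trans ((h k r).1 hr).symm)]
  · have hd := (rat_denPos q).sub (rat_denPos r)
    rw [PreRat.le_iff hd.abs (PreRat.denPos_ofNums (pow2_pos _)), PreRat.val_abs hd,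
      PreRat.val_sub (rat_denPos q) (rat_denPos r), (h _ _).1 hq, (h _ _).1 hr]
    simpa [eps] using ha m n hmn

theorem Represents.forall_at_iff {A B : Set M.Num} {a b : M.Num → Fr M.Num} (hA : Represents A a)
    (hB : Represents B b) {S : M.Num → M.Rat → M.Rat → Prop}
    {T : M.Num → Fr M.Num → Fr M.Num → Prop} (h : ∀ k q r, S k q r ↔ T k q.1.val r.1.val) :
    (∀ k q r, At A k q → At B k r → S k q r) ↔ ∀ k, T k (a k) (b k) := by
  refine ⟨fun hS k => ?_, fun hT k q r hq hr => ?_⟩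
  · obtain ⟨q, hq⟩ := exists_rat (a k)
    obtain ⟨r, hr⟩ := exists_rat (b k)
    exact hq ▸ hr ▸ (h k q r).1 (hS k q r ((hA k q).2 hq) ((hB k r).2 hr))
  · rw [h, (hA k q).1 hq, (hB k r).1 hr]
    exact hT k

theorem realLe_iff {A B : Set M.Num} {a b : M.Num → Fr M.Num} (hA : Represents A a)
    (hB : Represents B b) : RealLe A B ↔ ∀ k, a k ≤ b k + 2 * eps k :=
  hA.forall_at_iff hB (T := fun k x y => x ≤ y + 2 * eps k) fun k q r => by
    have hd : (PreRat.ofNums (1 + 1) (pow2 k)).DenPos := PreRat.denPos_ofNums (pow2_pos k)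
    simp only [isPow2_iff, exists_eq_left]
    rw [PreRat.le_iff (rat_denPos q) ((rat_denPos r).add hd), PreRat.val_add (rat_denPos r) hd,
      val_two_div, eps]

theorem realLt_iff {A B : Set M.Num} {a b : M.Num → Fr M.Num} (hA : Represents A a)
    (hB : Represents B b) : RealLt A B ↔ ∃ k, a k + 2 * eps k < b k := by
  simp only [RealLt, realLe_iff hB hA, not_forall, not_le]

theorem distLe_iff {A B : Set M.Num} {a b : M.Num → Fr M.Num} (hA : Represents A a)
    (hB : Represents B b) (ε : M.Rat) :
    DistLe A B ε ↔ ∀ k, |a (k + 1) - b (k + 1)| ≤ ε.1.val + 2 * eps k :=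
  realLe_iff (hA.realSub hB).realAbs (Represents.constReal (rat_denPos ε))

theorem realEq_iff {A B : Set M.Num} {a b : M.Num → Fr M.Num} (hA : Represents A a)
    (hB : Represents B b) : RealEq A B ↔ ∀ k, |a k - b k| ≤ 2 * eps k :=
  hA.forall_at_iff hB (T := fun k x y => |x - y| ≤ 2 * eps k) fun k q r => by
    have hd := (rat_denPos q).sub (rat_denPos r)
    simp only [isPow2_iff, exists_eq_left]
    rw [PreRat.le_iff hd.abs (PreRat.denPos_ofNums (pow2_pos k)), PreRat.val_abs hd,
      PreRat.val_sub (rat_denPos q) (rat_denPos r), val_two_div, eps]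

theorem inUnit_iff {A : Set M.Num} : InUnit A ↔
    IsReal A ∧ (∀ k, 0 ≤ termSeq A k + 2 * eps k) ∧ ∀ k, termSeq A k ≤ 1 + 2 * eps k :=
  and_congr_right fun hA => by
    rw [realLe_iff represents_zero hA.represents, realLe_iff hA.represents represents_one]

theorem IsReal.const_lt_iff {A : Set M.Num} (hA : IsReal A) (q : M.Rat) :
    RealLt (constReal q.1) A ↔ ∃ k, q.1.val + 2 * eps k < termSeq A k :=
  realLt_iff (Represents.constReal (rat_denPos q)) hA.represents

theorem IsReal.lt_const_iff {A : Set M.Num} (hA : IsReal A) (q : M.Rat) :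
    RealLt A (constReal q.1) ↔ ∃ k, termSeq A k + 2 * eps k < q.1.val :=
  realLt_iff hA.represents (Represents.constReal (rat_denPos q))

theorem exists_isReal_of_sigma1 (a : M.Num → Fr M.Num) (ha : Regular a)
    (R : M.Num → PreRat M → Prop)
    [Sigma1Definable (fun e => R (e 4) ⟨⟨e 3, e 2⟩, ⟨e 1, e 0⟩⟩)]
    (hR : ∀ k (q : M.Rat), R k q.1 ↔ q.1.val = a k) :
    ∃ A : Set M.Num, IsReal A ∧ Represents A a := by
  let G : M.Num → M.Num → Prop := fun k c => ∃ q : PreRat M, q.IsRat ∧ c = q.code ∧ R k q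
  have G_code_iff (k : M.Num) (q : M.Rat) : G k q.1.code ↔ q.1.val = a k := by
    rw [← hR]
    refine ⟨?_, fun h => ⟨q.1, q.2, rfl, h⟩⟩
    rintro ⟨r, -, hc, h⟩
    rwa [PreRat.code_injective hc]
  have R_definable : Sigma1Definable (fun e => R (e 5) ⟨⟨e 3, e 2⟩, ⟨e 1, e 0⟩⟩) :=
    Definable.rename (fun e => R (e 4) ⟨⟨e 3, e 2⟩, ⟨e 1, e 0⟩⟩) (fun i => if i = 4 then 5 else i)
  have G_definable : Sigma1Definable (fun e => G (e 1) (e 0)) := inferInstanceAs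
    (Sigma1Definable (fun e => ∃ q : PreRat M, q.IsRat ∧ e 0 = q.code ∧ R (e 1) q))
  have isSet := isSet_graph G fun k => by
    obtain ⟨q, hq⟩ := exists_rat (a k)
    refine ⟨q.1.code, (G_code_iff k q).2 hq, ?_⟩
    rintro _ ⟨r, hr, rfl, h⟩
    rw [rat_val_injective (hq.trans ((hR k ⟨r, hr⟩).1 h).symm)]
  have represents : Represents {w | ∃ k c, w = pair k c ∧ G k c} a := fun k q => by
    rw [← G_code_iff]
    refine ⟨?_, fun h => ⟨k, q.1.code, rfl, h⟩⟩
    rintro ⟨k', c, hw, h⟩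
    obtain ⟨rfl, rfl⟩ := pair_inj.1 hw
    exact h
  refine ⟨_, represents.isReal isSet.mem ?_ ha, represents⟩
  rintro _ ⟨k, _, rfl, q, hq, rfl, -⟩
  exact ⟨k, ⟨q, hq⟩, rfl⟩

/-! ## Division and parity -/

theorem exists_div (v c : M.Num) (hv : 0 < v) : ∃ h r, r < v ∧ c = h * v + r := by
  refine induction_on (fun c => ∃ h r, r < v ∧ c = h * v + r) c ⟨0, 0, hv, by ring⟩ ?_
  rintro c ⟨h, r, hr, rfl⟩
  rcases (succ_le_iff.2 hr).lt_or_eq with h' | h'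
  · exact ⟨h, r + 1, h', by ring⟩
  · exact ⟨h + 1, 0, hv, by rw [← h']; ring⟩

theorem mul_add_lt_mul {h h' v r : M.Num} (hr : r < v) (hh : h < h') : h * v + r < h' * v := by
  obtain ⟨d, rfl⟩ := exists_add_of_le (succ_le_iff.2 hh)
  calc h * v + r < h * v + v := by gcongr
    _ ≤ (h + 1 + d) * v := by
      rw [show (h + 1 + d) * v = h * v + v + d * v by ring]
      exact le_self_add

theorem div_unique {h h' v r r' : M.Num} (hr : r < v) (hr' : r' < v)
    (e : h * v + r = h' * v + r') : h = h' := by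
  rcases lt_trichotomy h h' with hh | hh | hh
  · exact absurd e ((mul_add_lt_mul hr hh).trans_le le_self_add).ne
  · exact hh
  · exact absurd e ((mul_add_lt_mul hr' hh).trans_le le_self_add).ne'

theorem odd_ne_even (a b : M.Num) : a + a + 1 ≠ b + b := by
  intro h
  have rem_eq : a * (1 + 1) + 1 = b * (1 + 1) + 0 := by rw [add_zero, mul_add, mul_one, h]; ring
  rw [div_unique (lt_succ_iff.2 le_rfl) (by positivity) rem_eq] at rem_eq
  exact one_ne_zero (add_left_cancel rem_eq)

theorem even_or_odd (c : M.Num) : ∃ g, c = g + g ∨ c = g + g + 1 := by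
  obtain ⟨h, r, hr, rfl⟩ := exists_div (1 + 1) c (by positivity)
  refine ⟨h, ?_⟩
  rcases (lt_succ_iff.1 hr).lt_or_eq with h' | rfl
  · left
    rw [← zero_add (1 : M.Num), lt_succ_iff, le_zero_iff] at h'
    rw [h']
    ring
  · right
    ring

theorem double_lt_double {a b : M.Num} : a + a < b + b ↔ a < b :=
  ⟨fun h => not_le.1 fun h' => not_le.2 h (add_le_add h' h'), fun h => add_lt_add h h⟩

theorem double_add_one_lt_double {a b : M.Num} (h : a < b) : a + a + 1 < b + b :=
  calc a + a + 1 < a + a + 1 + 1 := lt_succ_iff.2 le_rfl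
    _ = a + 1 + (a + 1) := by ring
    _ ≤ b + b := add_le_add (succ_le_iff.2 h) (succ_le_iff.2 h)

theorem double_inj {a b : M.Num} (h : a + a = b + b) : a = b := by
  rcases lt_trichotomy a b with h' | h' | h'
  · exact absurd h (double_lt_double.2 h').ne
  · exact h'
  · exact absurd h (double_lt_double.2 h').ne'

/-! ## Binary digits -/

/-- The digit of weight `2 ^ i` of `c` is `1`. -/
def Bit (i c : M.Num) : Prop :=
  ∃ v, v < c + 1 ∧ (v = pow2 i ∧ ∃ h, h < c + 1 ∧ ∃ r, r < v ∧ c = (h + h + 1) * v + r)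

instance BoundedDefinable.bit (t s : (ℕ → M.Num) → M.Num) [TermDefinable t] [TermDefinable s] :
    BoundedDefinable (fun e => Bit (t e) (s e)) := by
  unfold Bit
  infer_instance

theorem bit_iff {i c : M.Num} : Bit i c ↔ ∃ h r, r < pow2 i ∧ c = (h + h + 1) * pow2 i + r := by
  constructor
  · rintro ⟨_, _, rfl, h, _, r, hr, hc⟩
    exact ⟨h, r, hr, hc⟩
  · rintro ⟨h, r, hr, rfl⟩
    have pow2_le : pow2 i ≤ (h + h + 1) * pow2 i + r :=
      (le_mul_of_one_le_left zero_le le_add_self).trans le_self_add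
    refine ⟨_, lt_succ_iff.2 pow2_le, rfl, h, lt_succ_iff.2 ?_, r, hr, rfl⟩
    refine le_trans ?_ le_self_add
    exact (le_self_add.trans le_self_add).trans
      (le_mul_of_one_le_right zero_le (one_le_of_pos (pow2_pos i)))

theorem not_bit_zero_right (i : M.Num) : ¬ Bit i 0 := by
  rintro ⟨v, hv, rfl, -⟩
  exact not_lt.2 (lt_succ_iff.1 hv) (pow2_pos i)

theorem exists_of_not_bit {i c : M.Num} (h : ¬ Bit i c) :
    ∃ g r, r < pow2 i ∧ c = (g + g) * pow2 i + r := by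
  obtain ⟨d, r, hr, rfl⟩ := exists_div (pow2 i) c (pow2_pos i)
  obtain ⟨g, rfl | rfl⟩ := even_or_odd d
  · exact ⟨g, r, hr, rfl⟩
  · exact absurd (bit_iff.2 ⟨g, r, hr, rfl⟩) h

theorem exists_pow2_of_lt {i j : M.Num} (h : i < j) : ∃ d, pow2 j = (d + d) * pow2 i := by
  obtain ⟨k, rfl⟩ := exists_add_of_le (succ_le_iff.2 h)
  exact ⟨pow2 k, by rw [pow2_add, pow2_succ]; ring⟩

theorem bit_of_bit_add_pow2_of_lt {i j c : M.Num} (hji : j < i) (hj : Bit j (c + pow2 i)) :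
    Bit j c := by
  obtain ⟨l, s, hs, hl⟩ := bit_iff.1 hj
  obtain ⟨d, hd⟩ := exists_pow2_of_lt hji
  have hdl : d ≤ l := by
    by_contra! hlt
    refine absurd (mul_add_lt_mul hs (double_add_one_lt_double hlt)) (not_lt.2 ?_)
    rw [← hl, ← hd]
    exact le_add_self
  obtain ⟨k, rfl⟩ := exists_add_of_le hdl
  refine bit_iff.2 ⟨k, s, hs, add_right_cancel (b := pow2 i) ?_⟩
  rw [hl, hd]
  ring

theorem bit_of_bit_add_pow2_of_gt {i j c : M.Num} (hi : ¬ Bit i c) (hij : i < j)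
    (hj : Bit j (c + pow2 i)) : Bit j c := by
  obtain ⟨g, r, hr, hc⟩ := exists_of_not_bit hi
  obtain ⟨l, s, hs, hl⟩ := bit_iff.1 hj
  obtain ⟨d, hd⟩ := exists_pow2_of_lt hij
  have no_borrow : pow2 i ≤ s := by
    by_contra! hlt
    have odd_eq_even : g + g + 1 = (l + l + 1) * (d + d) :=
      div_unique hr hlt (by rw [mul_assoc, ← hd, ← hl, hc]; ring)
    exact odd_ne_even g ((l + l + 1) * d) (by rw [odd_eq_even]; ring)
  obtain ⟨k, rfl⟩ := exists_add_of_le no_borrow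
  refine bit_iff.2 ⟨l, k, lt_of_le_of_lt le_add_self hs, add_right_cancel (b := pow2 i) ?_⟩
  rw [hl]
  ring

theorem bit_add_pow2 {i j c : M.Num} (h : ¬ Bit i c) (hj : Bit j (c + pow2 i)) :
    j = i ∨ Bit j c := by
  rcases lt_trichotomy j i with hji | rfl | hij
  · exact .inr (bit_of_bit_add_pow2_of_lt hji hj)
  · exact .inl rfl
  · exact .inr (bit_of_bit_add_pow2_of_gt h hij hj)

theorem add_pow2_lt {i n c : M.Num} (h : ¬ Bit i c) (hi : i < n) (hc : c < pow2 n) :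
    c + pow2 i < pow2 n := by
  obtain ⟨g, r, hr, rfl⟩ := exists_of_not_bit h
  obtain ⟨d, hd⟩ := exists_pow2_of_lt hi
  have hgd : g < d := by
    by_contra! hle
    refine absurd hc (not_lt.2 ?_)
    rw [hd]
    refine le_trans ?_ le_self_add
    gcongr
  rw [hd, show (g + g) * pow2 i + r + pow2 i = (g + g + 1) * pow2 i + r by ring]
  exact mul_add_lt_mul hr (double_add_one_lt_double hgd)

theorem not_bit_zero_double (c : M.Num) : ¬ Bit 0 (c + c) := by
  intro h
  obtain ⟨h, r, hr, hc⟩ := bit_iff.1 h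
  rw [pow2_zero, ← zero_add (1 : M.Num), lt_succ_iff, le_zero_iff] at hr
  rw [hr, pow2_zero, mul_one, add_zero] at hc
  exact odd_ne_even h c hc.symm

theorem bit_of_bit_succ_double {i c : M.Num} (h : Bit (i + 1) (c + c)) : Bit i c := by
  obtain ⟨h, r, hr, hc⟩ := bit_iff.1 h
  rw [pow2_succ] at hr hc
  obtain ⟨s, rfl | rfl⟩ := even_or_odd r
  · refine bit_iff.2 ⟨h, s, double_lt_double.1 hr, double_inj ?_⟩
    rw [hc]
    ring
  · refine absurd ?_ (odd_ne_even ((h + h + 1) * pow2 i + s) c)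
    rw [hc]
    ring

/-! ## Approximations to the characteristic number of a range -/

section Approx

variable (Θ : Set M.Num)

/-- `Θ` is read as enumerating `k` at stage `m` when it contains `pair k m`. -/
def EnumBefore (n k : M.Num) : Prop := ∃ m, m < n ∧ pair k m ∈ Θ

theorem EnumBefore.mono {Θ : Set M.Num} {n n' k : M.Num} (h : EnumBefore Θ n k) (hn : n ≤ n') :
    EnumBefore Θ n' k :=
  let ⟨m, hm, h⟩ := h
  ⟨m, hm.trans_le hn, h⟩

/-- If `c` is written with `n` binary digits, only the places of numbers enumerated before stage
`n` carry a digit `1`. The `k`-th place from the left has weight `2 ^ (n - k - 1)`; the exponent is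
called `i` to avoid subtraction. -/
def Admissible (n c : M.Num) : Prop :=
  ∀ k, k < n → ∀ i, i < n → (k + i + 1 = n ∧ Bit i c) → EnumBefore Θ n k

variable [IsSet Θ]

instance BoundedDefinable.enumBefore (t s : (ℕ → M.Num) → M.Num)
    [TermDefinable t] [TermDefinable s] :
    BoundedDefinable (fun e => EnumBefore Θ (t e) (s e)) := by
  unfold EnumBefore
  infer_instance

instance BoundedDefinable.admissible (t s : (ℕ → M.Num) → M.Num)
    [TermDefinable t] [TermDefinable s] :
    BoundedDefinable (fun e => Admissible Θ (t e) (s e)) := by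
  unfold Admissible
  infer_instance

theorem exists_approx (n : M.Num) : ∃ c, (c < pow2 n ∧ Admissible Θ n c) ∧
    ∀ c', (c' < pow2 n ∧ Admissible Θ n c') → c' ≤ c := by
  exact exists_greatest (fun c => c < pow2 n ∧ Admissible Θ n c) (pow2 n)
    ⟨0, pow2_pos n, fun _ _ i _ h => absurd h.2 (not_bit_zero_right i)⟩ fun c hc => hc.1.le

/-- The numerator of `partialSum` over `2 ^ n`. Defining it as a maximum replaces the sum
over the numbers enumerated before stage `n` by bounded search. -/
noncomputable def approx (n : M.Num) : M.Num := (exists_approx Θ n).choose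

theorem approx_lt (n : M.Num) : approx Θ n < pow2 n := (exists_approx Θ n).choose_spec.1.1

theorem approx_admissible (n : M.Num) : Admissible Θ n (approx Θ n) :=
  (exists_approx Θ n).choose_spec.1.2

theorem le_approx {n c : M.Num} (h : c < pow2 n) (hc : Admissible Θ n c) : c ≤ approx Θ n :=
  (exists_approx Θ n).choose_spec.2 c ⟨h, hc⟩

instance Sigma1Definable.eq_approx (t s : (ℕ → M.Num) → M.Num) [TermDefinable t] [TermDefinable s] :
    Sigma1Definable (fun e => s e = approx Θ (t e)) := by
  refine Definable.of_iff (Q := fun e => ∃ v, v = pow2 (t e) ∧ (s e < v ∧ Admissible Θ (t e) (s e) ∧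
    ∀ c, c < v → Admissible Θ (t e) c → c ≤ s e)) fun e => ⟨?_, ?_⟩
  · intro h
    rw [h]
    exact ⟨_, rfl, approx_lt Θ _, approx_admissible Θ _, fun c hc h => le_approx Θ hc h⟩
  · rintro ⟨_, rfl, h, h', h''⟩
    exact _root_.le_antisymm (le_approx Θ h h') (h'' _ (approx_lt Θ _) (approx_admissible Θ _))

variable {Θ}

omit [IsSet Θ] in
theorem Admissible.double {n c : M.Num} (h : Admissible Θ n c) : Admissible Θ (n + 1) (c + c) := by
  rintro k _ i _ ⟨hki, hi⟩
  rcases Arith.eq_zero_or_succ i with rfl | ⟨i, rfl⟩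
  · exact absurd hi (not_bit_zero_double c)
  · have hn : k + i + 1 = n := by
      rw [add_assoc]
      exact add_right_cancel hki
    refine (h k ?_ i ?_ ⟨hn, bit_of_bit_succ_double hi⟩).mono (lt_succ_iff.2 le_rfl).le
    · rw [← hn, lt_succ_iff]; exact le_self_add
    · rw [← hn, lt_succ_iff]; exact le_add_self

theorem double_approx_le (n : M.Num) : approx Θ n + approx Θ n ≤ approx Θ (n + 1) :=
  le_approx Θ (by rw [pow2_succ]; exact double_lt_double.2 (approx_lt Θ n))
    (approx_admissible Θ n).double

theorem approx_jump {n k i : M.Num} (hn : k + i = n) (h : ¬ EnumBefore Θ n k)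
    (h' : EnumBefore Θ (n + 1) k) :
    approx Θ n + approx Θ n + pow2 i ≤ approx Θ (n + 1) := by
  have hbit : ¬ Bit i (approx Θ n + approx Θ n) := by
    intro hi
    rcases Arith.eq_zero_or_succ i with rfl | ⟨i, rfl⟩
    · exact not_bit_zero_double _ hi
    · rw [← add_assoc] at hn
      refine h (approx_admissible Θ n k ?_ i ?_ ⟨hn, bit_of_bit_succ_double hi⟩)
      · rw [← hn, lt_succ_iff]; exact le_self_add
      · rw [← hn, lt_succ_iff]; exact le_add_self
  refine le_approx Θ (add_pow2_lt hbit ?_ ?_) ?_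
  · rw [← hn, lt_succ_iff]; exact le_add_self
  · rw [pow2_succ]; exact double_lt_double.2 (approx_lt Θ n)
  · rintro l hl j hj ⟨hlj, hb⟩
    rcases bit_add_pow2 hbit hb with rfl | hb
    · rw [← hn] at hlj
      rwa [add_right_cancel (add_right_cancel hlj)]
    · exact (approx_admissible Θ n).double l hl j hj ⟨hlj, hb⟩

variable (Θ) in
/-- The sum of `2 ^ (-k - 1)` over the numbers `k < n` enumerated before stage `n`. -/
noncomputable def partialSum (n : M.Num) : Fr M.Num := toFr (approx Θ n) * eps n

theorem partialSum_nonneg (n : M.Num) : 0 ≤ partialSum Θ n :=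
  mul_nonneg (toFr_nonneg _) (eps_pos n).le

theorem partialSum_lt_one (n : M.Num) : partialSum Θ n < 1 := by
  rw [partialSum, eps, mul_one_div, div_lt_one (toFr_pos.2 (pow2_pos n)), toFr_lt]
  exact approx_lt Θ n

theorem val_approx (n : M.Num) : (PreRat.ofNums (approx Θ n) (pow2 n)).val = partialSum Θ n := by
  rw [PreRat.val_ofNums, partialSum, eps, mul_one_div]

theorem partialSum_mono {m n : M.Num} (h : m ≤ n) : partialSum Θ m ≤ partialSum Θ n := by
  obtain ⟨d, rfl⟩ := exists_add_of_le h
  obtain ⟨_, _, rfl, rfl, hd⟩ := induction_on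
    (fun d => ∃ c v, c = approx Θ (m + d) ∧ (v = pow2 d ∧ approx Θ m * v ≤ c)) d
    ⟨_, _, rfl, rfl, by rw [add_zero, pow2_zero, mul_one]⟩ fun d ⟨c, v, hc, hv, h⟩ =>
      ⟨_, _, rfl, rfl, by
        rw [← add_assoc, pow2_succ, mul_add, ← hv]
        exact (add_le_add (h.trans_eq hc) (h.trans_eq hc)).trans (double_approx_le _)⟩
  rw [partialSum, partialSum, eps, eps, mul_one_div, mul_one_div,
    div_le_div_iff₀ (toFr_pos.2 (pow2_pos _)) (toFr_pos.2 (pow2_pos _)), ← map_mul, ← map_mul,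
    toFr_le, pow2_add]
  calc _ = approx Θ m * pow2 d * pow2 m := by ring
    _ ≤ _ := by gcongr

theorem partialSum_jump {n k : M.Num} (hn : k ≤ n) (h : ¬ EnumBefore Θ n k)
    (h' : EnumBefore Θ (n + 1) k) :
    partialSum Θ n + eps (k + 1) ≤ partialSum Θ (n + 1) := by
  obtain ⟨i, rfl⟩ := exists_add_of_le hn
  have pow2_ne_zero (k : M.Num) : toFr (pow2 k) ≠ 0 := (toFr_pos.2 (pow2_pos k)).ne'
  have pow2_mul_eps : toFr (pow2 i) * eps (k + i) = eps k := by
    rw [eps, eps, pow2_add, map_mul]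
    field_simp [pow2_ne_zero k, pow2_ne_zero i]
  have jump := mul_le_mul_of_nonneg_right (toFr_le.2 (approx_jump rfl h h')) (eps_pos (k + i)).le
  rw [map_add, map_add] at jump
  rw [partialSum, partialSum, eps_succ, eps_succ]
  linarith

theorem partialSum_add_eps_le {n m k : M.Num} (hn : k ≤ n) (h : ¬ EnumBefore Θ n k)
    (h' : EnumBefore Θ m k) :
    partialSum Θ n + eps (k + 1) ≤ partialSum Θ m := by
  obtain ⟨l, hl, hmin⟩ := exists_least (fun l => EnumBefore Θ l k) ⟨m, h'⟩
  have hlm : l ≤ m := not_lt.1 fun hlt => hmin m hlt h'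
  have hnl : n < l := not_le.1 fun hle => h (hl.mono hle)
  obtain ⟨l, rfl⟩ : ∃ l', l = l' + 1 :=
    (Arith.eq_zero_or_succ l).resolve_left (zero_le.trans_lt hnl).ne'
  rw [lt_succ_iff] at hnl
  calc partialSum Θ n + eps (k + 1) ≤ partialSum Θ l + eps (k + 1) := by
        gcongr
        exact partialSum_mono hnl
    _ ≤ partialSum Θ (l + 1) := partialSum_jump (hn.trans hnl) (hmin l (lt_succ_iff.2 le_rfl)) hl
    _ ≤ partialSum Θ m := partialSum_mono hlm

theorem exists_forall_partialSum_le {ε : Fr M.Num} (hε : 0 < ε) :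
    ∃ N, ∀ n, N ≤ n → partialSum Θ n ≤ partialSum Θ N + ε := by
  by_contra! hc
  obtain ⟨u, hu, huε⟩ := exists_inv_lt hε
  have hu' : 0 < toFr u := toFr_pos.2 hu
  have mul_pow2_le_iff (j n : M.Num) :
      j * pow2 n ≤ approx Θ n * u ↔ toFr j * (1 / toFr u) ≤ partialSum Θ n := by
    rw [partialSum, eps, mul_one_div, mul_one_div,
      div_le_div_iff₀ hu' (toFr_pos.2 (pow2_pos n)), ← map_mul, ← map_mul, toFr_le]
  obtain ⟨n, _, _, rfl, rfl, h⟩ := induction_on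
    (fun j => ∃ n c v, c = approx Θ n ∧ (v = pow2 n ∧ j * v ≤ c * u)) (u + 1)
    ⟨0, _, _, rfl, rfl, by rw [zero_mul]; exact zero_le⟩ fun j ⟨N, c, v, hc', hv, h⟩ => by
      obtain ⟨n, _, hn⟩ := hc N
      refine ⟨n, _, _, rfl, rfl, (mul_pow2_le_iff _ _).2 ?_⟩
      rw [hc', hv, mul_pow2_le_iff] at h
      rw [map_add, map_one, add_mul, one_mul]
      linarith
  rw [mul_pow2_le_iff, map_add, map_one, add_mul, mul_one_div_cancel hu'.ne'] at h
  linarith [partialSum_lt_one (Θ := Θ) n, one_div_pos.2 hu']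

theorem forall_not_pair_mem_iff {a : M.Num → Fr M.Num} {C : M.Num}
    (hlim : ∀ ε : Fr M.Num, 0 < ε → ∃ N, ∀ m, N ≤ m → ∀ i,
      |a i - partialSum Θ m| ≤ ε + toFr C * eps i) (k : M.Num) :
    (∀ m, pair k m ∉ Θ) ↔ ∃ n i, k ≤ n ∧ ¬ EnumBefore Θ n k ∧
      a i + toFr C * eps i < partialSum Θ n + eps (k + 1) := by
  constructor
  · intro hk
    obtain ⟨N, hN⟩ := hlim (eps (k + 1) / 4) (by linarith [eps_pos (k + 1)])
    have hC : 0 < 4 * (toFr C + 1) := by linarith [toFr_nonneg C]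
    obtain ⟨i, hi⟩ := exists_eps_lt (div_pos (eps_pos (k + 1)) hC)
    rw [lt_div_iff₀ hC] at hi
    refine ⟨max N k, i, le_max_right _ _, fun ⟨m, _, hm⟩ => hk m hm, ?_⟩
    linarith [(abs_le.1 (hN _ (le_max_left N k) i)).2, eps_pos i, eps_pos (k + 1)]
  · rintro ⟨n, i, hkn, hn, hlt⟩ m hm
    have jump : partialSum Θ n + eps (k + 1) ≤ partialSum Θ (m + 1) :=
      partialSum_add_eps_le hkn hn ⟨m, lt_succ_iff.2 le_rfl, hm⟩
    obtain ⟨N, hN⟩ := hlim _ (half_pos (sub_pos.2 (hlt.trans_le jump)))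
    have near := (abs_le.1 (hN _ (le_max_left N (m + 1)) i)).1
    linarith [partialSum_mono (Θ := Θ) (le_max_right N (m + 1))]

theorem lt_partialSum_add_eps_iff (q : M.Rat) (C i n k : M.Num) :
    (q.1.add (.ofNums C (pow2 i))).Lt
      ((PreRat.ofNums (approx Θ n) (pow2 n)).add (.ofNums 1 (pow2 (k + 1)))) ↔
    q.1.val + toFr C * eps i < partialSum Θ n + eps (k + 1) := by
  have denPos (c k : M.Num) : (PreRat.ofNums c (pow2 k)).DenPos :=
    PreRat.denPos_ofNums (pow2_pos k)
  rw [PreRat.lt_iff ((rat_denPos q).add (denPos _ _)) ((denPos _ _).add (denPos _ _)),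
    PreRat.val_add (rat_denPos q) (denPos _ _), PreRat.val_add (denPos _ _) (denPos _ _),
    val_approx, PreRat.val_ofNums, PreRat.val_ofNums, map_one, eps, eps, mul_one_div]

set_option synthInstance.maxSize 4096 in
/-- A limit of the partial sums makes the complement of the range `Σ⁰₁`: once the partial sum at
stage `n ≥ k` is within `2 ^ (-k - 1)` of the limit, `k` can no longer be enumerated. -/
theorem isSet_range_of_limit {x : Set M.Num} (hx : IsReal x) (C : M.Num)
    (hlim : ∀ ε : Fr M.Num, 0 < ε → ∃ N, ∀ m, N ≤ m → ∀ i,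
      |termSeq x i - partialSum Θ m| ≤ ε + toFr C * eps i) :
    IsSet {k | ∃ m, pair k m ∈ Θ} := by
  have x_isSet := IsSet.mk hx.1
  have compl_definable : Sigma1Definable (fun e : ℕ → M.Num => ¬ ∃ m, pair (e 0) m ∈ Θ) := by
    refine Definable.of_iff (Q := fun e => ∃ n i, ∃ q : PreRat M, ∃ c v w u : M.Num,
      c = approx Θ n ∧ (q.IsRat ∧ v = pow2 n ∧ w = pow2 i ∧ u = pow2 (e 0 + 1) ∧ e 0 ≤ n ∧
        ¬ EnumBefore Θ n (e 0) ∧ pair i q.code ∈ x ∧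
        (q.add (.ofNums C w)).Lt ((PreRat.ofNums c v).add (.ofNums 1 u)))) fun e => ?_
    rw [not_exists, forall_not_pair_mem_iff hlim]
    constructor
    · rintro ⟨n, i, hkn, hn, hlt⟩
      obtain ⟨q, hq⟩ := exists_rat (termSeq x i)
      exact ⟨n, i, q.1, _, _, _, _, rfl, q.2, rfl, rfl, rfl, hkn, hn,
        (hx.represents i q).2 hq, (lt_partialSum_add_eps_iff q C i n _).2 (hq ▸ hlt)⟩
    · rintro ⟨n, i, q, _, _, _, _, rfl, hq, rfl, rfl, rfl, hkn, hn, hqx, hlt⟩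
      rw [lt_partialSum_add_eps_iff ⟨q, hq⟩, (hx.represents i ⟨q, hq⟩).1 hqx] at hlt
      exact ⟨n, i, hkn, hn, hlt⟩
  exact isSet_setOf (fun k => ∃ m, pair k m ∈ Θ)

end Approx

/-! ## The continuous functions `x ↦ |x - a| / 2` -/

/-- The pair of the open interval `(p, q)`, which meets `[0, 1]`, and the open interval `(r, s)`
belongs to the code of the function `x ↦ |x - a| / 2`, that is, `|x - a| / 2` lies in `[r, s]` for
all `x` in `(p, q) ∩ [0, 1]`. -/
def DistBox (p q r s a : PreRat M) : Prop :=
  (p.Lt q ∧ p.Lt (.ofNums 1 1) ∧ (PreRat.ofNums 0 1).Lt q) ∧ r.Lt s ∧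
  (r.Lt (.ofNums 0 1) ∨ (r.add r).Le (p.sub a) ∨ (r.add r).Le (a.sub q)) ∧
  ((q.sub a).Le (s.add s) ∨ ((PreRat.ofNums 1 1).sub a).Le (s.add s)) ∧
  ((a.sub p).Le (s.add s) ∨ a.Le (s.add s))

/-- `DistBox` for elements of an ordered field instead of codes of rational numbers. -/
def DistBoxVal {K : Type*} [Field K] [LinearOrder K] (p q r s a : K) : Prop :=
  (p < q ∧ p < 1 ∧ 0 < q) ∧ r < s ∧ (r < 0 ∨ r + r ≤ p - a ∨ r + r ≤ a - q) ∧
  (q - a ≤ s + s ∨ 1 - a ≤ s + s) ∧ (a - p ≤ s + s ∨ a ≤ s + s)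

section DistBoxVal

variable {K : Type*} [Field K] [LinearOrder K] [IsStrictOrderedRing K] {p q r s p' q' r' s' a : K}

theorem DistBoxVal.lower_lt_upper (h : DistBoxVal p q r s a)
    (h' : DistBoxVal p q r' s' a) : r < s' := by
  obtain ⟨⟨hpq, hp, hq⟩, -, lower, -, -⟩ := h
  obtain ⟨-, -, -, upper_right, upper_left⟩ := h'
  rcases lower with lower | lower | lower <;> rcases upper_right with upper_right | upper_right <;>
    rcases upper_left with upper_left | upper_left <;> linarith

theorem DistBoxVal.shrink (ha : 0 ≤ a) (ha' : a ≤ 1) (h : DistBoxVal p q r s a)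
    (hu : p' < q' ∧ p' < 1 ∧ 0 < q') (hp : p < 0 ∨ p ≤ p') (hq : 1 < q ∨ q' ≤ q) :
    DistBoxVal p' q' r s a := by
  obtain ⟨-, hrs, lower, upper_right, upper_left⟩ := h
  obtain ⟨hpq', hp', hq'⟩ := hu
  refine ⟨⟨hpq', hp', hq'⟩, hrs, ?_, ?_, ?_⟩
  · rcases lower with lower | lower | lower
    · exact .inl lower
    · rcases hp with hp | hp
      · exact .inl (by linarith)
      · exact .inr (.inl (by linarith))
    · rcases hq with hq | hq
      · exact .inl (by linarith)
      · exact .inr (.inr (by linarith))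
  · rcases upper_right with upper_right | upper_right
    · rcases hq with hq | hq
      · exact .inr (by linarith)
      · exact .inl (by linarith)
    · exact .inr upper_right
  · rcases upper_left with upper_left | upper_left
    · rcases hp with hp | hp
      · exact .inr (by linarith)
      · exact .inl (by linarith)
    · exact .inr upper_left

theorem DistBoxVal.enlarge (h : DistBoxVal p q r s a) (hr : r' ≤ r) (hs : s ≤ s') :
    DistBoxVal p q r' s' a := by
  obtain ⟨hu, hrs, lower, upper_right, upper_left⟩ := h
  refine ⟨hu, hr.trans_lt (hrs.trans_le hs), lower.imp hr.trans_lt (Or.imp ?_ ?_),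
    upper_right.imp ?_ ?_, upper_left.imp ?_ ?_⟩ <;> intro <;> linarith

end DistBoxVal

theorem distBox_iff {p q r s a : PreRat M} (hp : p.DenPos) (hq : q.DenPos) (hr : r.DenPos)
    (hs : s.DenPos) (ha : a.DenPos) :
    DistBox p q r s a ↔ DistBoxVal p.val q.val r.val s.val a.val := by
  have denPos_zero : (PreRat.ofNums (0 : M.Num) 1).DenPos := PreRat.denPos_ofNums zero_lt_one
  have denPos_one : (PreRat.ofNums (1 : M.Num) 1).DenPos := PreRat.denPos_ofNums zero_lt_one
  simp only [DistBox, DistBoxVal, PreRat.lt_iff hp hq, PreRat.lt_iff hp denPos_one,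
    PreRat.lt_iff denPos_zero hq, PreRat.lt_iff hr hs, PreRat.lt_iff hr denPos_zero,
    PreRat.le_iff (hr.add hr) (hp.sub ha), PreRat.le_iff (hr.add hr) (ha.sub hq),
    PreRat.le_iff (hq.sub ha) (hs.add hs), PreRat.le_iff (denPos_one.sub ha) (hs.add hs),
    PreRat.le_iff (ha.sub hp) (hs.add hs), PreRat.le_iff ha (hs.add hs), PreRat.val_add hr hr,
    PreRat.val_add hs hs, PreRat.val_sub hp ha, PreRat.val_sub ha hq, PreRat.val_sub hq ha,
    PreRat.val_sub denPos_one ha, PreRat.val_sub ha hp, PreRat.val_ofNums, map_zero, map_one,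
    div_one]

instance BoundedDefinable.distBox (p q r s a : (ℕ → M.Num) → PreRat M) [RatDefinable p]
    [RatDefinable q] [RatDefinable r] [RatDefinable s] [RatDefinable a] :
    BoundedDefinable (fun e => DistBox (p e) (q e) (r e) (s e) (a e)) := by
  unfold DistBox
  infer_instance

/-- `b` codes a pair of intervals as in `DistBox`, with rational endpoints. The quantifiers are
bounded by `b` so that the notion is visibly `Δ⁰₀`. -/
def IsDistBox (b : M.Num) (a : PreRat M) : Prop :=
  ∃ p : PreRat M, p.code < b + 1 ∧ ∃ q : PreRat M, q.code < b + 1 ∧ ∃ r : PreRat M,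
    r.code < b + 1 ∧ ∃ s : PreRat M, s.code < b + 1 ∧ (p.IsRat ∧ q.IsRat ∧ r.IsRat ∧ s.IsRat ∧
      b = pair (pair p.code q.code) (pair r.code s.code) ∧ DistBox p q r s a)

set_option synthInstance.maxSize 4096 in
instance BoundedDefinable.isDistBox (b : (ℕ → M.Num) → M.Num) (a : (ℕ → M.Num) → PreRat M)
    [TermDefinable b] [RatDefinable a] : BoundedDefinable (fun e => IsDistBox (b e) (a e)) := by
  unfold IsDistBox
  infer_instance

theorem isDistBox_iff {b : M.Num} {a : PreRat M} (ha : a.DenPos) : IsDistBox b a ↔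
    ∃ p q r s : M.Rat, b = boxCode p q r s ∧
      DistBoxVal p.1.val q.1.val r.1.val s.1.val a.val := by
  constructor
  · rintro ⟨p, _, q, _, r, _, s, _, hp, hq, hr, hs, hb, h⟩
    exact ⟨⟨p, hp⟩, ⟨q, hq⟩, ⟨r, hr⟩, ⟨s, hs⟩, hb,
      (distBox_iff hp.denPos hq.denPos hr.denPos hs.denPos ha).1 h⟩
  · rintro ⟨p, q, r, s, rfl, h⟩
    refine ⟨p.1, ?_, q.1, ?_, r.1, ?_, s.1, ?_, p.2, q.2, r.2, s.2, rfl,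
      (distBox_iff (rat_denPos p) (rat_denPos q) (rat_denPos r) (rat_denPos s) ha).2 h⟩ <;>
      refine lt_succ_iff.2 ?_
    · exact (left_le_pair _ _).trans (left_le_pair _ _)
    · exact (right_le_pair _ _).trans (left_le_pair _ _)
    · exact (left_le_pair _ _).trans (right_le_pair _ _)
    · exact (right_le_pair _ _).trans (right_le_pair _ _)

theorem boxCode_inj {p q r s p' q' r' s' : M.Rat} :
    boxCode p q r s = boxCode p' q' r' s' ↔ (p = p' ∧ q = q') ∧ r = r' ∧ s = s' := by
  simp only [boxCode, pair_inj, rat_code_inj]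

theorem unitInterval_iff {p q : M.Rat} :
    UnitInterval p q ↔ p.1.val < q.1.val ∧ p.1.val < 1 ∧ 0 < q.1.val := by
  have denPos_zero : (PreRat.ofNums (0 : M.Num) 1).DenPos := PreRat.denPos_ofNums zero_lt_one
  have denPos_one : (PreRat.ofNums (1 : M.Num) 1).DenPos := PreRat.denPos_ofNums zero_lt_one
  simp only [UnitInterval, PreRat.lt_iff (rat_denPos p) (rat_denPos q),
    PreRat.lt_iff (rat_denPos p) denPos_one, PreRat.lt_iff denPos_zero (rat_denPos q),
    PreRat.val_ofNums, map_zero, map_one, div_one]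

theorem unitIntervalSub_iff {p' q' p q : M.Rat} : UnitIntervalSub p' q' p q ↔
    (p.1.val < 0 ∨ p.1.val ≤ p'.1.val) ∧ (1 < q.1.val ∨ q'.1.val ≤ q.1.val) := by
  have denPos_zero : (PreRat.ofNums (0 : M.Num) 1).DenPos := PreRat.denPos_ofNums zero_lt_one
  have denPos_one : (PreRat.ofNums (1 : M.Num) 1).DenPos := PreRat.denPos_ofNums zero_lt_one
  simp only [UnitIntervalSub, PreRat.le_iff (rat_denPos p) (rat_denPos p'),
    PreRat.lt_iff (rat_denPos p) denPos_zero, PreRat.lt_iff denPos_one (rat_denPos q),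
    PreRat.le_iff (rat_denPos q') (rat_denPos q), PreRat.val_ofNums, map_zero,
    map_one, div_one]

theorem rat_lt_iff {p q : M.Rat} : p.1.Lt q.1 ↔ p.1.val < q.1.val :=
  PreRat.lt_iff (rat_denPos p) (rat_denPos q)

theorem rat_le_iff {p q : M.Rat} : p.1.Le q.1 ↔ p.1.val ≤ q.1.val :=
  PreRat.le_iff (rat_denPos p) (rat_denPos q)

theorem rat_sub_le_iff {p q r : M.Rat} : (p.1.sub q.1).Le r.1 ↔ p.1.val - q.1.val ≤ r.1.val := by
  rw [PreRat.le_iff ((rat_denPos p).sub (rat_denPos q)) (rat_denPos r),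
    PreRat.val_sub (rat_denPos p) (rat_denPos q)]

theorem boxCode_mem_iff_of_distBox {F : Set M.Num} {a : Fr M.Num}
    (h : ∀ b, b ∈ F ↔ ∃ p q r s : M.Rat, b = boxCode p q r s ∧
      DistBoxVal p.1.val q.1.val r.1.val s.1.val a) {p q r s : M.Rat} :
    boxCode p q r s ∈ F ↔ DistBoxVal p.1.val q.1.val r.1.val s.1.val a := by
  rw [h]
  constructor
  · rintro ⟨p', q', r', s', code_eq, h⟩
    obtain ⟨⟨rfl, rfl⟩, rfl, rfl⟩ := boxCode_inj.1 code_eq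
    exact h
  · exact fun h => ⟨p, q, r, s, rfl, h⟩

theorem isContinuous_of_distBox {F : Set M.Num} (hF : F ∈ M.sets) {a : Fr M.Num}
    (ha : 0 ≤ a) (ha' : a ≤ 1)
    (h : ∀ b, b ∈ F ↔ ∃ p q r s : M.Rat, b = boxCode p q r s ∧
      DistBoxVal p.1.val q.1.val r.1.val s.1.val a) : IsContinuous F := by
  have mem_iff {p q r s : M.Rat} := boxCode_mem_iff_of_distBox h (p := p) (q := q) (r := r) (s := s)
  refine ⟨hF, fun b hb => ?_, fun p q r s r' s' hb hb' => ?_, fun p q r s p' q' hb hu hsub => ?_,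
    fun p q r s r' s' hb _ hr hs => ?_⟩
  · obtain ⟨p, q, r, s, rfl, hu, hrs, -⟩ := (h b).1 hb
    exact ⟨p, q, r, s, unitInterval_iff.2 hu, rat_lt_iff.2 hrs, rfl⟩
  · rw [mem_iff] at hb hb'
    exact ⟨rat_lt_iff.2 (hb.lower_lt_upper hb'), rat_lt_iff.2 (hb'.lower_lt_upper hb)⟩
  · obtain ⟨hp, hq⟩ := unitIntervalSub_iff.1 hsub
    exact mem_iff.2 ((mem_iff.1 hb).shrink ha ha' (unitInterval_iff.1 hu) hp hq)
  · exact mem_iff.2 ((mem_iff.1 hb).enlarge (rat_le_iff.1 hr) (rat_le_iff.1 hs))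

/-! ## Strict inequalities between regular sequences and constants -/

theorem Regular.forall_of_lt {a : M.Num → Fr M.Num} (ha : Regular a) {β : Fr M.Num}
    (h : ∃ k, a k + 2 * eps k < β) : ∃ η, 0 < η ∧ ∀ i, a i + η ≤ β + eps i := by
  obtain ⟨k, hk⟩ := h
  exact ⟨eps k, eps_pos k, fun i => by linarith [ha.le i k]⟩

theorem Regular.forall_of_gt {a : M.Num → Fr M.Num} (ha : Regular a) {β : Fr M.Num}
    (h : ∃ k, β + 2 * eps k < a k) : ∃ η, 0 < η ∧ ∀ i, β + η ≤ a i + eps i := by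
  obtain ⟨k, hk⟩ := h
  exact ⟨eps k, eps_pos k, fun i => by linarith [ha.le k i]⟩

theorem exists_mul_eps_lt (C : Fr M.Num) {η : Fr M.Num} (hη : 0 < η) : ∃ k, C * eps k < η := by
  have hC : 0 < |C| + 1 := by positivity
  obtain ⟨k, hk⟩ := exists_eps_lt (div_pos hη hC)
  rw [lt_div_iff₀ hC] at hk
  exact ⟨k, by nlinarith [eps_pos k, le_abs_self C]⟩

theorem exists_lt_of_forall {a : M.Num → Fr M.Num} {β η : Fr M.Num} (C : Fr M.Num) (hη : 0 < η)
    (h : ∀ i, a i + η ≤ β + C * eps i) : ∃ k, a k + 2 * eps k < β := by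
  obtain ⟨k, hk⟩ := exists_mul_eps_lt (C + 2) hη
  exact ⟨k, by linarith [h k]⟩

theorem exists_gt_of_forall {a : M.Num → Fr M.Num} {β η : Fr M.Num} (C : Fr M.Num) (hη : 0 < η)
    (h : ∀ i, β + η ≤ a i + C * eps i) : ∃ k, β + 2 * eps k < a k := by
  obtain ⟨k, hk⟩ := exists_mul_eps_lt (C + 2) hη
  exact ⟨k, by linarith [h k]⟩

theorem Regular.half_abs_sub {a : M.Num → Fr M.Num} (ha : Regular a) (c : Fr M.Num) :
    Regular fun k => |a k - c| / 2 := by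
  intro m n hmn
  calc |(|a m - c| / 2 - |a n - c| / 2)| = |(|a m - c| - |a n - c|)| / 2 := by
        rw [← sub_div, abs_div, abs_two]
    _ ≤ |a m - a n| / 2 := by
        rw [← sub_sub_sub_cancel_right (a m) (a n) c]
        exact div_le_div_of_nonneg_right (abs_abs_sub_abs_le_abs_sub _ _) zero_le_two
    _ ≤ |a m - a n| := half_le_self (abs_nonneg _)
    _ ≤ eps m := ha m n hmn

/-! ## The gauge -/

theorem isSet_sect (Z : Set M.Num) [IsSet Z] (n : M.Num) : IsSet (sect Z n) :=
  isSet_setOf (fun m => pair m n ∈ Z)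

section Gauge

variable (Θ : Set M.Num) [IsSet Θ]

/-- The sequence of the functions `x ↦ |x - aₙ| / 2`, where `aₙ` is the `n`-th partial sum. These
functions converge to `|x - sup aₙ| / 2`, which is positive unless the supremum exists in the
model. -/
def gauge : Set M.Num :=
  {w | ∃ b n, w = pair b n ∧ IsDistBox b (.ofNums (approx Θ n) (pow2 n))}

theorem gauge_mem_sets : gauge Θ ∈ M.sets := by
  have definable : Sigma1Definable (fun e : ℕ → M.Num => ∃ b n, e 0 = pair b n ∧
      IsDistBox b (.ofNums (approx Θ n) (pow2 n))) := by
    refine Definable.of_iff (Q := fun e => ∃ b n c v : M.Num, c = approx Θ n ∧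
      (v = pow2 n ∧ e 0 = pair b n ∧ IsDistBox b (.ofNums c v))) fun e => ⟨?_, ?_⟩
    · rintro ⟨b, n, h, h'⟩
      exact ⟨b, n, _, _, rfl, rfl, h, h'⟩
    · rintro ⟨b, n, _, _, rfl, rfl, h, h'⟩
      exact ⟨b, n, h, h'⟩
  have compl_definable : Sigma1Definable (fun e : ℕ → M.Num => ¬ ∃ b n, e 0 = pair b n ∧
      IsDistBox b (.ofNums (approx Θ n) (pow2 n))) := by
    refine Definable.of_iff (Q := fun e =>
      (¬ ∃ b, b < e 0 + 1 ∧ ∃ n, n < e 0 + 1 ∧ e 0 = pair b n) ∨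
        ∃ b n c v : M.Num, c = approx Θ n ∧ (v = pow2 n ∧ e 0 = pair b n ∧
          ¬ IsDistBox b (.ofNums c v))) fun e => ⟨fun h => ?_, ?_⟩
    · by_cases hp : ∃ b n, e 0 = pair b n
      · obtain ⟨b, n, hw⟩ := hp
        exact .inr ⟨b, n, _, _, rfl, rfl, hw, fun h' => h ⟨b, n, hw, h'⟩⟩
      · exact .inl fun ⟨b, _, n, _, hw⟩ => hp ⟨b, n, hw⟩
    · rintro (h | ⟨b, n, _, _, rfl, rfl, hw, h⟩) ⟨b', n', hw', h'⟩
      · exact h ⟨b', by rw [hw']; exact lt_succ_iff.2 (left_le_pair _ _), n',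
          by rw [hw']; exact lt_succ_iff.2 (right_le_pair _ _), hw'⟩
      · obtain ⟨rfl, rfl⟩ := pair_inj.1 (hw.symm.trans hw')
        exact h h'
  exact (isSet_setOf (fun w => ∃ b n, w = pair b n ∧
    IsDistBox b (.ofNums (approx Θ n) (pow2 n)))).mem

variable {Θ}

theorem mem_sect_gauge {b n : M.Num} : b ∈ sect (gauge Θ) n ↔ ∃ p q r s : M.Rat,
    b = boxCode p q r s ∧ DistBoxVal p.1.val q.1.val r.1.val s.1.val (partialSum Θ n) := by
  rw [← val_approx, ← isDistBox_iff (PreRat.denPos_ofNums (pow2_pos n))]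
  constructor
  · rintro ⟨b', n', h, h'⟩
    obtain ⟨rfl, rfl⟩ := pair_inj.1 h
    exact h'
  · exact fun h => ⟨b, n, rfl, h⟩

theorem boxCode_mem_sect_gauge {p q r s : M.Rat} {n : M.Num} :
    boxCode p q r s ∈ sect (gauge Θ) n ↔
      DistBoxVal p.1.val q.1.val r.1.val s.1.val (partialSum Θ n) :=
  boxCode_mem_iff_of_distBox fun _ => mem_sect_gauge

theorem isContinuous_sect_gauge (n : M.Num) : IsContinuous (sect (gauge Θ) n) := by
  have gauge_isSet := IsSet.mk (gauge_mem_sets Θ)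
  exact isContinuous_of_distBox (isSet_sect _ n).mem (partialSum_nonneg n) (partialSum_lt_one n).le
    fun _ => mem_sect_gauge

theorem inInterval_iff {x : Set M.Num} (hx : InUnit x) {p q : M.Rat} : InInterval x p q ↔
    (∃ k, p.1.val + 2 * eps k < termSeq x k) ∧ ∃ k, termSeq x k + 2 * eps k < q.1.val := by
  rw [InInterval, hx.1.const_lt_iff, hx.1.lt_const_iff]
  exact and_iff_right hx

theorem isTotal_sect_gauge (n : M.Num) : IsTotal (sect (gauge Θ) n) := by
  intro x hx ε hε
  rw [ratPos_iff] at hε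
  obtain ⟨k, hk⟩ := exists_mul_eps_lt 3 hε
  obtain ⟨-, x_nonneg, x_le_one⟩ := inUnit_iff.1 hx
  have eps_k_pos := eps_pos k
  obtain ⟨p, hp⟩ := exists_rat (termSeq x k - 3 * eps k)
  obtain ⟨q, hq⟩ := exists_rat (termSeq x k + 3 * eps k)
  have hint : InInterval x p q := (inInterval_iff hx).2 ⟨⟨k, by linarith⟩, ⟨k, by linarith⟩⟩
  have hu : p.1.val < q.1.val ∧ p.1.val < 1 ∧ 0 < q.1.val :=
    ⟨by linarith, by linarith [x_le_one k], by linarith [x_nonneg k]⟩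
  rcases le_total (partialSum Θ n) (termSeq x k) with h | h
  · obtain ⟨r, hr⟩ := exists_rat ((p.1.val - partialSum Θ n) / 2)
    obtain ⟨s, hs⟩ := exists_rat ((q.1.val - partialSum Θ n) / 2)
    exact ⟨p, q, r, s, boxCode_mem_sect_gauge.2 ⟨hu, by linarith [hu.1], .inr (.inl (by linarith)),
      .inl (by linarith), .inl (by linarith)⟩, hint, rat_sub_le_iff.2 (by linarith)⟩
  · obtain ⟨r, hr⟩ := exists_rat ((partialSum Θ n - q.1.val) / 2)
    obtain ⟨s, hs⟩ := exists_rat ((partialSum Θ n - p.1.val) / 2)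
    exact ⟨p, q, r, s, boxCode_mem_sect_gauge.2 ⟨hu, by linarith [hu.1], .inr (.inr (by linarith)),
      .inl (by linarith), .inl (by linarith)⟩, hint, rat_sub_le_iff.2 (by linarith)⟩

theorem isValue_sect_gauge {x y : Set M.Num} (hx : InUnit x) (hy : IsReal y) (n : M.Num)
    (h : Represents y fun k => |termSeq x k - partialSum Θ n| / 2) :
    IsValue (sect (gauge Θ) n) x y := by
  refine ⟨hy, fun p q r s hbox hint => ?_⟩
  obtain ⟨-, -, lower, upper_right, upper_left⟩ := boxCode_mem_sect_gauge.1 hbox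
  rw [inInterval_iff hx] at hint
  obtain ⟨η, hη, hp⟩ := hx.1.regular.forall_of_gt hint.1
  obtain ⟨η', hη', hq⟩ := hx.1.regular.forall_of_lt hint.2
  obtain ⟨-, x_nonneg, x_le_one⟩ := inUnit_iff.1 hx
  rw [realLe_iff (Represents.constReal (rat_denPos r)) h,
    realLe_iff h (Represents.constReal (rat_denPos s))]
  constructor <;> intro k
  · have eps_k_pos := eps_pos k
    have le_abs := le_abs_self (termSeq x k - partialSum Θ n)
    have neg_le_abs := neg_abs_le (termSeq x k - partialSum Θ n)
    rcases lower with lower | lower | lower <;>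
      linarith [hp k, hq k, abs_nonneg (termSeq x k - partialSum Θ n)]
  · have eps_k_pos := eps_pos k
    rcases abs_cases (termSeq x k - partialSum Θ n) with ⟨abs_eq, -⟩ | ⟨abs_eq, -⟩ <;> rw [abs_eq]
    · rcases upper_right with upper | upper <;> linarith [hq k, x_le_one k]
    · rcases upper_left with upper | upper <;> linarith [hp k, x_nonneg k]

omit [IsSet Θ] in
theorem val_eq_half_abs_sub_iff {a q z : PreRat M} (ha : a.DenPos) (hq : q.DenPos)
    (hz : z.DenPos) :
    ((PreRat.ofNums 0 1).Le q ∧ ((q.add q).Equiv (z.sub a) ∨ (q.add q).Equiv (a.sub z))) ↔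
      q.val = |z.val - a.val| / 2 := by
  rw [PreRat.le_iff (PreRat.denPos_ofNums zero_lt_one) hq,
    PreRat.equiv_iff (hq.add hq) (hz.sub ha), PreRat.equiv_iff (hq.add hq) (ha.sub hz),
    PreRat.val_add hq hq, PreRat.val_sub hz ha, PreRat.val_sub ha hz,
    PreRat.val_ofNums, map_zero, zero_div]
  constructor
  · rintro ⟨q_nonneg, h | h⟩
    · rw [abs_of_nonneg (by linarith)]; linarith
    · rw [abs_of_nonpos (by linarith)]; linarith
  · intro h
    refine ⟨by rw [h]; positivity, ?_⟩
    rcases abs_cases (z.val - a.val) with ⟨abs_eq, -⟩ | ⟨abs_eq, -⟩ <;> rw [abs_eq] at h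
    · exact .inl (by linarith)
    · exact .inr (by linarith)

variable (Θ) in
theorem exists_isValue_gauge {x : Set M.Num} (hx : InUnit x) (n : M.Num) :
    ∃ y, IsValue (sect (gauge Θ) n) x y ∧
      Represents y fun k => |termSeq x k - partialSum Θ n| / 2 := by
  have x_isSet := IsSet.mk hx.1.1
  let a : PreRat M := .ofNums (approx Θ n) (pow2 n)
  have a_denPos : a.DenPos := PreRat.denPos_ofNums (pow2_pos n)
  have val_a : a.val = partialSum Θ n := val_approx n
  obtain ⟨y, hy, hr⟩ := exists_isReal_of_sigma1 (fun k => |termSeq x k - partialSum Θ n| / 2)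
    (hx.1.regular.half_abs_sub _)
    (fun k q => ∃ z : PreRat M, z.IsRat ∧ pair k z.code ∈ x ∧ (PreRat.ofNums 0 1).Le q ∧
      ((q.add q).Equiv (z.sub a) ∨ (q.add q).Equiv (a.sub z))) fun k q => by
      rw [← val_a]
      constructor
      · rintro ⟨z, hz, hzx, h⟩
        rw [(val_eq_half_abs_sub_iff a_denPos (rat_denPos q) hz.denPos).1 h,
          (hx.1.represents k ⟨z, hz⟩).1 hzx]
      · intro h
        obtain ⟨z, hz⟩ := exists_rat (termSeq x k)
        exact ⟨z.1, z.2, (hx.1.represents k z).2 hz,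
          (val_eq_half_abs_sub_iff a_denPos (rat_denPos q) (rat_denPos z)).2 (by rw [h, hz])⟩
  exact ⟨y, isValue_sect_gauge hx hy n hr, hr⟩

theorem abs_sub_le_of_isValue {x w : Set M.Num} (hx : InUnit x) {n : M.Num}
    (hw : IsValue (sect (gauge Θ) n) x w) (k : M.Num) :
    |termSeq w k - |termSeq x k - partialSum Θ n| / 2| ≤ 4 * eps k := by
  obtain ⟨y, hy, y_represents⟩ := exists_isValue_gauge Θ hx n
  refine le_of_forall_eps 1 one_pos fun l => ?_
  obtain ⟨ε, hε⟩ := exists_rat (eps l)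
  obtain ⟨p, q, r, s, hbox, hint, hrs⟩ := isTotal_sect_gauge (Θ := Θ) n x hx ε
    (ratPos_iff.2 (by rw [hε]; exact eps_pos l))
  rw [rat_sub_le_iff, hε] at hrs
  obtain ⟨le_y, y_le⟩ := hy.2 p q r s hbox hint
  obtain ⟨le_w, w_le⟩ := hw.2 p q r s hbox hint
  rw [realLe_iff (Represents.constReal (rat_denPos r)) y_represents] at le_y
  rw [realLe_iff y_represents (Represents.constReal (rat_denPos s))] at y_le
  rw [realLe_iff (Represents.constReal (rat_denPos r)) hw.1.represents] at le_w
  rw [realLe_iff hw.1.represents (Represents.constReal (rat_denPos s))] at w_le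
  rw [abs_le]
  constructor <;> linarith [le_y k, y_le k, le_w k, w_le k]

theorem isBaire1_gauge : IsBaire1 (gauge Θ) := by
  refine ⟨gauge_mem_sets Θ, isContinuous_sect_gauge, isTotal_sect_gauge, fun x hx ε hε => ?_⟩
  obtain ⟨N, hN⟩ := exists_forall_partialSum_le (Θ := Θ) (ratPos_iff.1 hε)
  refine ⟨N, fun m n hm hn => ?_⟩
  obtain ⟨y, hy, y_represents⟩ := exists_isValue_gauge Θ hx m
  obtain ⟨z, hz, z_represents⟩ := exists_isValue_gauge Θ hx n
  refine ⟨y, z, hy, hz, (distLe_iff y_represents z_represents ε).2 fun k => ?_⟩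
  have reverse_triangle := abs_abs_sub_abs_le_abs_sub (termSeq x (k + 1) - partialSum Θ m)
    (termSeq x (k + 1) - partialSum Θ n)
  rw [sub_sub_sub_cancel_left] at reverse_triangle
  have sums_near : |partialSum Θ n - partialSum Θ m| ≤ ε.1.val := by
    rw [abs_le]
    constructor <;> linarith [hN m hm, hN n hn, partialSum_mono (Θ := Θ) hm,
      partialSum_mono (Θ := Θ) hn]
  rw [← sub_div, abs_div, abs_two]
  linarith [eps_pos k, abs_nonneg (partialSum Θ n - partialSum Θ m)]

theorem isSet_range_of_baire1Le {x : Set M.Num} (hx : InUnit x)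
    (h : Baire1Le (gauge Θ) x (constReal (.ofNums 0 1))) : IsSet {k | ∃ m, pair k m ∈ Θ} := by
  refine isSet_range_of_limit hx.1 10 fun ε hε => ?_
  obtain ⟨q, hq⟩ := exists_rat (ε / 2)
  obtain ⟨N, hN⟩ := h q ((realLt_iff represents_zero (Represents.constReal (rat_denPos q))).2 (by
    obtain ⟨k, hk⟩ := exists_mul_eps_lt 2 (half_pos hε)
    exact ⟨k, by rw [hq]; linarith⟩))
  refine ⟨N, fun m hm i => ?_⟩
  obtain ⟨w, hw, hlt⟩ := hN m hm
  obtain ⟨η, hη, w_le⟩ := hw.1.regular.forall_of_lt ((hw.1.lt_const_iff q).1 hlt)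
  rw [hq] at w_le
  rw [map_ofNat]
  linarith [w_le i, (abs_le.1 (abs_sub_le_of_isValue hx hw i)).1]

theorem eventually_le_of_baire1Ge {x : Set M.Num} (hx : InUnit x) {y : Set M.Num}
    {b : M.Num → Fr M.Num} (hb : Represents y b) {β : Fr M.Num} (C : Fr M.Num)
    (hβ : ∀ i, β ≤ b i + C * eps i) (h : Baire1Ge (gauge Θ) x y) {ε : Fr M.Num} (hε : 0 < ε) :
    ∃ N, ∀ m, N ≤ m → ∀ i, β ≤ |termSeq x i - partialSum Θ m| / 2 + ε + 5 * eps i := by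
  obtain ⟨q, hq⟩ := exists_rat (β - ε)
  obtain ⟨N, hN⟩ := h q ((realLt_iff (Represents.constReal (rat_denPos q)) hb).2
    (exists_gt_of_forall C hε fun i => by linarith [hβ i]))
  refine ⟨N, fun m hm i => ?_⟩
  obtain ⟨w, hw, hlt⟩ := hN m hm
  obtain ⟨η, hη, le_w⟩ := hw.1.regular.forall_of_gt ((hw.1.const_lt_iff q).1 hlt)
  linarith [le_w i, (abs_le.1 (abs_sub_le_of_isValue hx hw i)).2]

end Gauge

/-! ## Tagged partitions -/

/-- The partition point `x_j` of the sequence `P` is less than the rational number `b`, as a `Σ⁰₁`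
condition on the codes. -/
def NodeLt (P : Set M.Num) (j : M.Num) (b : PreRat M) : Prop :=
  ∃ k w : M.Num, ∃ z : PreRat M, w = pow2 k ∧ z.IsRat ∧ pair (pair k z.code) (j + j) ∈ P ∧
    (z.add (.ofNums (1 + 1) w)).Lt b

/-- The partition point `x_j` of the sequence `P` is greater than the rational number `b`, as a
`Σ⁰₁` condition on the codes. -/
def NodeGt (P : Set M.Num) (j : M.Num) (b : PreRat M) : Prop :=
  ∃ k w : M.Num, ∃ z : PreRat M, w = pow2 k ∧ z.IsRat ∧ pair (pair k z.code) (j + j) ∈ P ∧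
    (b.add (.ofNums (1 + 1) w)).Lt z

section Definability

variable (P : Set M.Num) [IsSet P] (t : (ℕ → M.Num) → M.Num) (b : (ℕ → M.Num) → PreRat M)
  [TermDefinable t] [RatDefinable b]

instance Sigma1Definable.nodeLt : Sigma1Definable (fun e => NodeLt P (t e) (b e)) := by
  unfold NodeLt
  infer_instance

instance Sigma1Definable.nodeGt : Sigma1Definable (fun e => NodeGt P (t e) (b e)) := by
  unfold NodeGt
  infer_instance

end Definability

theorem add_two_div_pow2_lt_iff (k : M.Num) {a b : PreRat M} (ha : a.DenPos) (hb : b.DenPos) :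
    (a.add (.ofNums (1 + 1) (pow2 k))).Lt b ↔ a.val + 2 * eps k < b.val := by
  have denPos : (PreRat.ofNums (1 + 1) (pow2 k)).DenPos := PreRat.denPos_ofNums (pow2_pos k)
  rw [PreRat.lt_iff (ha.add denPos) hb, PreRat.val_add ha denPos, val_two_div, eps]

theorem nodeLt_iff {P : Set M.Num} {j : M.Num} (h : IsReal (node P j)) {b : PreRat M}
    (hb : b.DenPos) : NodeLt P j b ↔ ∃ k, termSeq (node P j) k + 2 * eps k < b.val := by
  constructor
  · rintro ⟨k, _, z, rfl, hz, hP, hlt⟩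
    refine ⟨k, ?_⟩
    rw [← (h.represents k ⟨z, hz⟩).1 hP]
    exact (add_two_div_pow2_lt_iff k (rat_denPos ⟨z, hz⟩) hb).1 hlt
  · rintro ⟨k, hk⟩
    obtain ⟨z, hz⟩ := exists_rat (termSeq (node P j) k)
    exact ⟨k, _, z.1, rfl, z.2, (h.represents k z).2 hz,
      (add_two_div_pow2_lt_iff k (rat_denPos z) hb).2 (by rwa [hz])⟩

theorem nodeGt_iff {P : Set M.Num} {j : M.Num} (h : IsReal (node P j)) {b : PreRat M}
    (hb : b.DenPos) : NodeGt P j b ↔ ∃ k, b.val + 2 * eps k < termSeq (node P j) k := by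
  constructor
  · rintro ⟨k, _, z, rfl, hz, hP, hlt⟩
    refine ⟨k, ?_⟩
    rw [← (h.represents k ⟨z, hz⟩).1 hP]
    exact (add_two_div_pow2_lt_iff k hb (rat_denPos ⟨z, hz⟩)).1 hlt
  · rintro ⟨k, hk⟩
    obtain ⟨z, hz⟩ := exists_rat (termSeq (node P j) k)
    exact ⟨k, _, z.1, rfl, z.2, (h.represents k z).2 hz,
      (add_two_div_pow2_lt_iff k hb (rat_denPos z)).2 (by rwa [hz])⟩

section Partition

variable {P : Set M.Num} {ℓ : M.Num}

theorem IsTaggedPartition.real_node (hP : IsTaggedPartition P ℓ) {j : M.Num} (hj : j ≤ ℓ) :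
    IsReal (node P j) :=
  hP.real _ (add_le_add hj hj)

theorem IsTaggedPartition.real_tag (hP : IsTaggedPartition P ℓ) {j : M.Num} (hj : j < ℓ) :
    IsReal (tag P j) := by
  refine hP.real _ (le_trans ?_ (add_le_add (succ_le_iff.2 hj) (succ_le_iff.2 hj)))
  rw [show j + 1 + (j + 1) = j + j + 1 + 1 by ring]
  exact le_self_add

theorem IsTaggedPartition.node_lt (hP : IsTaggedPartition P ℓ) {j : M.Num} (hj : j < ℓ) :
    ∃ k, termSeq (node P j) k + 2 * eps k < termSeq (node P (j + 1)) k :=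
  (realLt_iff (hP.real_node hj.le).represents
    (hP.real_node (succ_le_iff.2 hj)).represents).1 (hP.lt j hj)

theorem IsTaggedPartition.node_le_tag (hP : IsTaggedPartition P ℓ) {j : M.Num} (hj : j < ℓ)
    (k : M.Num) : termSeq (node P j) k ≤ termSeq (tag P j) k + 2 * eps k :=
  (realLe_iff (hP.real_node hj.le).represents (hP.real_tag hj).represents).1 (hP.le_tag j hj) k

theorem IsTaggedPartition.tag_le_node (hP : IsTaggedPartition P ℓ) {j : M.Num} (hj : j < ℓ)
    (k : M.Num) : termSeq (tag P j) k ≤ termSeq (node P (j + 1)) k + 2 * eps k :=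
  (realLe_iff (hP.real_tag hj).represents
    (hP.real_node (succ_le_iff.2 hj)).represents).1 (hP.tag_le j hj) k

theorem IsTaggedPartition.abs_first_le (hP : IsTaggedPartition P ℓ) (k : M.Num) :
    |termSeq (node P 0) k| ≤ 2 * eps k := by
  simpa only [sub_zero] using
    (realEq_iff (hP.real_node zero_le).represents represents_zero).1 hP.first k

theorem IsTaggedPartition.abs_last_le (hP : IsTaggedPartition P ℓ) (k : M.Num) :
    |termSeq (node P ℓ) k - 1| ≤ 2 * eps k :=
  (realEq_iff (hP.real_node le_rfl).represents represents_one).1 hP.last k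

theorem IsTaggedPartition.not_nodeLt_zero (hP : IsTaggedPartition P ℓ) {j : M.Num} (hj : j ≤ ℓ) :
    ¬ NodeLt P j (.ofNums 0 1) := by
  have P_isSet := IsSet.mk hP.mem_sets
  have nodeLt_zero_iff {i : M.Num} (hi : i ≤ ℓ) :
      NodeLt P i (.ofNums 0 1) ↔ ∃ k, termSeq (node P i) k + 2 * eps k < 0 := by
    rw [nodeLt_iff (hP.real_node hi) (PreRat.denPos_ofNums zero_lt_one), PreRat.val_ofNums,
      map_zero, zero_div]
  refine fun lt => induction_on_not (fun i => i ≤ ℓ ∧ NodeLt P i (.ofNums 0 1)) j ?_ ?_ ⟨hj, lt⟩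
  · rintro ⟨h, first_lt⟩
    obtain ⟨k, hk⟩ := (nodeLt_zero_iff h).1 first_lt
    linarith [(abs_le.1 (hP.abs_first_le k)).1]
  · rintro i not_lt ⟨h, succ_lt⟩
    have hi := succ_le_iff.1 h
    refine not_lt ⟨hi.le, (nodeLt_zero_iff hi.le).2 ?_⟩
    obtain ⟨η, hη, succ_add_le⟩ :=
      (hP.real_node h).regular.forall_of_lt ((nodeLt_zero_iff h).1 succ_lt)
    obtain ⟨l, hl⟩ := hP.node_lt hi
    refine exists_lt_of_forall 2 hη fun k => ?_
    linarith [succ_add_le l, (hP.real_node hi.le).regular.le k l, eps_pos l, eps_pos k]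

theorem IsTaggedPartition.node_nonneg (hP : IsTaggedPartition P ℓ) {j : M.Num} (hj : j ≤ ℓ)
    (k : M.Num) : 0 ≤ termSeq (node P j) k + 2 * eps k := by
  by_contra! lt
  refine hP.not_nodeLt_zero hj
    ((nodeLt_iff (hP.real_node hj) (PreRat.denPos_ofNums zero_lt_one)).2 ⟨k, ?_⟩)
  rwa [PreRat.val_ofNums, map_zero, zero_div]

theorem IsTaggedPartition.not_nodeGt_one (hP : IsTaggedPartition P ℓ) {j : M.Num} (hj : j ≤ ℓ) :
    ¬ NodeGt P j (.ofNums 1 1) := by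
  have P_isSet := IsSet.mk hP.mem_sets
  have nodeGt_one_iff {i : M.Num} (hi : i ≤ ℓ) :
      NodeGt P i (.ofNums 1 1) ↔ ∃ k, 1 + 2 * eps k < termSeq (node P i) k := by
    rw [nodeGt_iff (hP.real_node hi) (PreRat.denPos_ofNums zero_lt_one), PreRat.val_ofNums,
      map_one, div_one]
  intro gt
  obtain ⟨d, rfl⟩ := exists_add_of_le hj
  have last_gt := induction_on (fun i => j + d < j + i ∨ NodeGt P (j + i) (.ofNums 1 1)) d
    (.inr (by rwa [add_zero])) fun i ih => by
      rw [← add_assoc]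
      rcases lt_or_ge (j + i) (j + d) with hlt | hge
      · have h := succ_le_iff.2 hlt
        obtain ⟨η, hη, add_le⟩ := (hP.real_node hlt.le).regular.forall_of_gt
          ((nodeGt_one_iff hlt.le).1 (ih.resolve_left hlt.not_gt))
        obtain ⟨l, hl⟩ := hP.node_lt hlt
        refine .inr ((nodeGt_one_iff h).2 (exists_gt_of_forall 2 hη fun k => ?_))
        linarith [add_le l, (hP.real_node h).regular.le l k, eps_pos l, eps_pos k]
      · exact .inl (lt_succ_iff.2 hge)
  obtain ⟨k, hk⟩ := (nodeGt_one_iff le_rfl).1 (last_gt.resolve_left (lt_irrefl _))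
  linarith [(abs_le.1 (hP.abs_last_le k)).2]

theorem IsTaggedPartition.node_le_one (hP : IsTaggedPartition P ℓ) {j : M.Num} (hj : j ≤ ℓ)
    (k : M.Num) : termSeq (node P j) k ≤ 1 + 2 * eps k := by
  by_contra! gt
  refine hP.not_nodeGt_one hj
    ((nodeGt_iff (hP.real_node hj) (PreRat.denPos_ofNums zero_lt_one)).2 ⟨k, ?_⟩)
  rwa [PreRat.val_ofNums, map_one, div_one]

theorem IsTaggedPartition.inUnit_tag (hP : IsTaggedPartition P ℓ) {j : M.Num} (hj : j < ℓ) :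
    InUnit (tag P j) := by
  refine inUnit_iff.2 ⟨hP.real_tag hj, fun k => ?_, fun k => ?_⟩
  · by_contra! lt
    obtain ⟨η, hη, tag_add_le⟩ := (hP.real_tag hj).regular.forall_of_lt ⟨k, lt⟩
    obtain ⟨i, hi⟩ := exists_lt_of_forall (a := termSeq (node P j)) (β := 0) 3 hη fun i => by
      linarith [tag_add_le i, hP.node_le_tag hj i]
    linarith [hP.node_nonneg hj.le i]
  · by_contra! gt
    obtain ⟨η, hη, add_le_tag⟩ := (hP.real_tag hj).regular.forall_of_gt ⟨k, gt⟩
    obtain ⟨i, hi⟩ := exists_gt_of_forall (a := termSeq (node P (j + 1))) (β := 1) 3 hη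
      fun i => by linarith [add_le_tag i, hP.tag_le_node hj i]
    linarith [hP.node_le_one (succ_le_iff.2 hj) i]

end Partition

/-! ## Ranges of functions from Cousin's lemma -/

theorem Regular.abs_sub_sub_sub_le {a b : M.Num → Fr M.Num} (ha : Regular a) (hb : Regular b)
    (k i : M.Num) :
    |a (k + 1) - b (k + 1) - (a (i + 1) - b (i + 1))| ≤ 2 * eps k + 2 * eps i := by
  have abs_a := abs_le.1 (ha.abs_sub_le (k + 1) (i + 1))
  have abs_b := abs_le.1 (hb.abs_sub_le (k + 1) (i + 1))
  rw [eps_succ, eps_succ] at abs_a abs_b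
  rw [abs_le]
  constructor <;> linarith [eps_pos k, eps_pos i]

section Range

variable {Θ : Set M.Num} [IsSet Θ]

theorem eventually_le_of_baire1Ge_realSub {x y z : Set M.Num} (hx : InUnit x) (hy : IsReal y)
    (hz : IsReal z) (h : Baire1Ge (gauge Θ) x (realSub y z)) {ε : Fr M.Num} (hε : 0 < ε)
    (l : M.Num) : ∃ N, ∀ m, N ≤ m → ∀ i,
      termSeq y (l + 1) - termSeq z (l + 1) - 2 * eps l ≤
        |termSeq x i - partialSum Θ m| / 2 + ε + 5 * eps i :=
  eventually_le_of_baire1Ge hx (hy.represents.realSub hz.represents) 2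
    (fun i => by linarith [(abs_le.1 (hy.regular.abs_sub_sub_sub_le hz.regular l i)).2]) h hε

/-- The gauge at a tag `t` is at most half the distance from `t` to the partial sums, so an interval
of a fine partition that starts before a late partial sum also ends before it. -/
theorem IsTaggedPartition.exists_node_succ_lt_partialSum {P : Set M.Num} {ℓ : M.Num}
    (hP : IsTaggedPartition P ℓ) (hfine : IsFine (gauge Θ) P ℓ) {j : M.Num} (hj : j < ℓ)
    (h : ∃ n k, termSeq (node P j) k + 2 * eps k < partialSum Θ n) :
    ∃ n k, termSeq (node P (j + 1)) k + 2 * eps k < partialSum Θ n := by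
  by_contra! partialSum_le
  obtain ⟨n, hn⟩ := h
  have real_node := hP.real_node hj.le
  have real_succ := hP.real_node (succ_le_iff.2 hj)
  have real_tag := hP.real_tag hj
  obtain ⟨η, hη, add_le⟩ := real_node.regular.forall_of_lt hn
  obtain ⟨l, hl⟩ := exists_mul_eps_lt 1000 hη
  obtain ⟨N₁, left⟩ := eventually_le_of_baire1Ge_realSub (hP.inUnit_tag hj) real_tag real_node
    (hfine j hj).1 (div_pos hη (by norm_num : (0 : Fr M.Num) < 100)) l
  obtain ⟨N₂, right⟩ := eventually_le_of_baire1Ge_realSub (hP.inUnit_tag hj) real_succ real_tag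
    (hfine j hj).2 (div_pos hη (by norm_num : (0 : Fr M.Num) < 100)) l
  obtain ⟨m, hnm, hm₁, hm₂⟩ : ∃ m, n ≤ m ∧ N₁ ≤ m ∧ N₂ ≤ m :=
    ⟨max n (max N₁ N₂), le_max_left _ _, (le_max_left _ _).trans (le_max_right _ _),
      (le_max_right _ _).trans (le_max_right _ _)⟩
  have left := left m hm₁ (l + 1)
  have right := right m hm₂ (l + 1)
  have add_le := add_le (l + 1)
  have partialSum_le := partialSum_le m (l + 1)
  rw [eps_succ] at left right add_le partialSum_le
  rcases abs_cases (termSeq (tag P j) (l + 1) - partialSum Θ m) with ⟨abs_eq, -⟩ | ⟨abs_eq, -⟩ <;>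
    rw [abs_eq] at left right <;> linarith [partialSum_mono (Θ := Θ) hnm, eps_pos l]

variable (Θ) in
/-- The partition point `x_j` of the sequence `P` is less than some partial sum, as a `Σ⁰₁`
condition on the codes. -/
def NodeLtPartialSum (P : Set M.Num) (j : M.Num) : Prop :=
  ∃ n c v : M.Num, c = approx Θ n ∧ (v = pow2 n ∧ NodeLt P j (.ofNums c v))

instance Sigma1Definable.nodeLtPartialSum (P : Set M.Num) [IsSet P] (t : (ℕ → M.Num) → M.Num)
    [TermDefinable t] : Sigma1Definable (fun e => NodeLtPartialSum Θ P (t e)) := by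
  unfold NodeLtPartialSum
  infer_instance

theorem nodeLtPartialSum_iff {P : Set M.Num} {j : M.Num} (h : IsReal (node P j)) :
    NodeLtPartialSum Θ P j ↔ ∃ n k, termSeq (node P j) k + 2 * eps k < partialSum Θ n := by
  simp only [NodeLtPartialSum, exists_and_left, exists_eq_left,
    nodeLt_iff h (PreRat.denPos_ofNums (pow2_pos _)), val_approx]

/-- Induction along a fine partition: its first point is `0`, and its last point is `1`, which no
partial sum exceeds. -/
theorem isSet_range_of_isFine {P : Set M.Num} {ℓ : M.Num} (hP : IsTaggedPartition P ℓ)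
    (hfine : IsFine (gauge Θ) P ℓ) : IsSet {k | ∃ m, pair k m ∈ Θ} := by
  by_contra not_isSet
  have P_isSet := IsSet.mk hP.mem_sets
  have last_lt : ℓ < ℓ ∨ NodeLtPartialSum Θ P ℓ :=
    induction_on (fun j => ℓ < j ∨ NodeLtPartialSum Θ P j) ℓ ?_ fun j ih => ?_
  · obtain ⟨n, k, hk⟩ :=
      (nodeLtPartialSum_iff (hP.real_node le_rfl)).1 (last_lt.resolve_left (lt_irrefl ℓ))
    linarith [(abs_le.1 (hP.abs_last_le k)).1, partialSum_lt_one (Θ := Θ) n]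
  · refine .inr ((nodeLtPartialSum_iff (hP.real_node zero_le)).2 ?_)
    by_contra! partialSum_le
    refine not_isSet (isSet_range_of_limit (hP.real_node zero_le) 4
      fun ε hε => ⟨0, fun m _ i => ?_⟩)
    have abs_first := abs_le.1 (hP.abs_first_le i)
    rw [map_ofNat, abs_le]
    constructor <;> linarith [partialSum_le m i, partialSum_nonneg (Θ := Θ) m, eps_pos i]
  · rcases lt_or_ge j ℓ with hlt | hge
    · exact .inr ((nodeLtPartialSum_iff (hP.real_node (succ_le_iff.2 hlt))).2
        (hP.exists_node_succ_lt_partialSum hfine hlt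
          ((nodeLtPartialSum_iff (hP.real_node hlt.le)).1 (ih.resolve_left hlt.not_gt))))
    · exact .inl (lt_succ_iff.2 hge)

variable (Θ) in
theorem isSet_range (hCL : M.CousinBaire1) : IsSet {k | ∃ m, pair k m ∈ Θ} := by
  by_contra not_isSet
  obtain ⟨_, _, hP, hfine⟩ := hCL (gauge Θ) isBaire1_gauge
    fun _ hx h => not_isSet (isSet_range_of_baire1Le hx h)
  exact not_isSet (isSet_range_of_isFine hP hfine)

end Range

/-! ## Arithmetical comprehension -/

/-- A block of existential quantifiers is contracted to a single one by bounding its witnesses. -/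
theorem exists_boundedDefinable_of_isSigma1 {φ : ArithFormula M.sets} (hφ : φ.IsSigma1) :
    ∃ R : M.Num → (ℕ → M.Num) → Prop, BoundedDefinable (fun e => R (e 0) (fun i => e (i + 1))) ∧
      ∀ e, M.Holds φ e ↔ ∃ a, R a e := by
  induction hφ with
  | bounded hφ =>
    have holds_definable := BoundedDefinable.holds hφ
    exact ⟨fun _ e => M.Holds _ e, BoundedDefinable.rename _ _,
      fun e => ⟨fun h => ⟨0, h⟩, fun ⟨_, h⟩ => h⟩⟩
  | ex _ ih =>
    obtain ⟨R, hR, holds_iff⟩ := ih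
    have matrix_definable :
        BoundedDefinable fun e : ℕ → M.Num => R (e 0) (scons (e 1) fun i => e (i + 3)) :=
      (Definable.rename _ (scons 0 (scons 1 (· + 3))) (hP := hR)).of_iff (Q := _) fun e => by
        change _ ↔ R (e 0) fun i => e (scons 1 (· + 3) i)
        rw [comp_scons]
    have inner_definable : BoundedDefinable fun e : ℕ → M.Num =>
        ∃ b, b < e 1 + 1 ∧ R b (scons (e 0) fun i => e (i + 2)) :=
      BoundedDefinable.bex (fun e => e 1 + 1) fun b e => R b (scons (e 0) fun i => e (i + 2))
    refine ⟨fun c e => ∃ a, a < c + 1 ∧ ∃ b, b < c + 1 ∧ R b (scons a e),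
      BoundedDefinable.bex (fun e => e 0 + 1)
        fun a e => ∃ b, b < e 0 + 1 ∧ R b (scons a fun i => e (i + 1)), fun e => ?_⟩
    simp only [Holds, holds_iff]
    constructor
    · rintro ⟨a, b, hab⟩
      exact ⟨max a b, a, lt_succ_iff.2 (le_max_left _ _), b, lt_succ_iff.2 (le_max_right _ _), hab⟩
    · rintro ⟨_, a, _, b, _, hab⟩
      exact ⟨a, b, hab⟩

variable (M) in
omit hM in
/-- `Σ⁰₁` comprehension, with predicates in place of formulas. -/
def Sigma1Comprehension : Prop :=
  ∀ P : M.Num → Prop, Sigma1Definable (fun e => P (e 0)) → IsSet {n | P n}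

/-- A `Σ⁰₁` set `{n | ∃ m, R m n}` is the range of the partial function sending the code of a pair
`(n, m)` with `R m n` to `n`. -/
theorem sigma1Comprehension_of_cousinBaire1 (hCL : M.CousinBaire1) : M.Sigma1Comprehension := by
  intro P hP
  obtain ⟨φ, hφ, s, holds_iff⟩ := exists_holds_scons P
  obtain ⟨R, hR, holds_iff_exists⟩ := exists_boundedDefinable_of_isSigma1 hφ
  let Θ : Set M.Num :=
    {w | ∃ n, n < w + 1 ∧ ∃ m, m < w + 1 ∧ (w = pair n m ∧ R m (scons n s))}
  have matrix_definable : BoundedDefinable fun e : ℕ → M.Num => R (e 0) (scons (e 1) s) :=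
    (Definable.subst _ (scons (.inl 0) (scons (.inl 1) (Sum.inr ∘ s))) (hP := hR)).of_iff (Q := _)
      fun e => by
        change _ ↔ R (e 0) fun i => Sum.elim e id (scons (.inl 1) (Sum.inr ∘ s) i)
        rw [comp_scons]
        rfl
  have inner_definable : BoundedDefinable fun e : ℕ → M.Num =>
      ∃ m, m < e 1 + 1 ∧ (e 1 = pair (e 0) m ∧ R m (scons (e 0) s)) :=
    BoundedDefinable.bex (fun e => e 1 + 1) fun m e => e 1 = pair (e 0) m ∧ R m (scons (e 0) s)
  have outer_definable : BoundedDefinable fun e : ℕ → M.Num => e 0 ∈ Θ :=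
    BoundedDefinable.bex (fun e => e 0 + 1)
      fun n e => ∃ m, m < e 0 + 1 ∧ (e 0 = pair n m ∧ R m (scons n s))
  have Θ_isSet : IsSet Θ := isSet_setOf (· ∈ Θ)
  convert isSet_range Θ hCL using 2
  ext n
  rw [← holds_iff n, holds_iff_exists]
  constructor
  · rintro ⟨m, hm⟩
    exact ⟨m, n, lt_succ_iff.2 (left_le_pair n m), m, lt_succ_iff.2 (right_le_pair n m), rfl, hm⟩
  · rintro ⟨m, n', _, m', _, hw, hm⟩
    obtain ⟨rfl, rfl⟩ := pair_inj.1 hw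
    exact ⟨_, hm⟩

omit hM in
theorem Sigma1Definable.scons_term (P : (ℕ → M.Num) → Prop) [hP : Sigma1Definable P]
    (t : (ℕ → M.Num) → M.Num) [TermDefinable t] (k : ℕ) :
    Sigma1Definable fun e => P (scons (t e) fun i => e (i + k)) := by
  have matrix_definable :
      Sigma1Definable fun e : ℕ → M.Num => P (scons (e 0) fun i => e (i + k + 1)) :=
    (Definable.rename P (scons 0 (· + k + 1))).of_iff (Q := _) fun e => by rw [comp_scons]
  exact Definable.of_iff (Q := fun e => ∃ c : M.Num, c = t e ∧ P (scons c fun i => e (i + k)))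
    fun e => by rw [exists_eq_left]

/-- The predicate `P` with its first two arguments contracted to the code of a pair. -/
def contract (P : (ℕ → M.Num) → Prop) (e : ℕ → M.Num) : Prop :=
  ∃ a b : M.Num, e 0 = pair a b ∧ P (scons a (scons b fun i => e (i + 1)))

instance Sigma1Definable.contract (P : (ℕ → M.Num) → Prop) [Sigma1Definable P] :
    Sigma1Definable (contract P) := by
  have matrix_definable : Sigma1Definable fun e : ℕ → M.Num =>
      P (scons (e 1) (scons (e 0) fun i => e (i + 3))) :=
    (Definable.rename P (scons 1 (scons 0 (· + 3)))).of_iff (Q := _) fun e => by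
      simp only [comp_scons]
  unfold L2Structure.contract
  infer_instance

theorem contract_scons_pair (P : (ℕ → M.Num) → Prop) (e : ℕ → M.Num) :
    contract P (scons (pair (e 0) (e 1)) fun i => e (i + 2)) ↔ P e := by
  have scons_scons : scons (e 0) (scons (e 1) fun i => e (i + 2)) = e := by
    rw [scons_zero_succ fun i => e (i + 1), scons_zero_succ]
  constructor
  · rintro ⟨a, b, hab, h⟩
    obtain ⟨rfl, rfl⟩ := pair_inj.1 hab
    exact scons_scons ▸ h
  · exact fun h => ⟨e 0, e 1, rfl, scons_scons.symm ▸ h⟩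

theorem Sigma1Comprehension.not_of_support (hCA : M.Sigma1Comprehension) (d : ℕ)
    (P : (ℕ → M.Num) → Prop) [Sigma1Definable P]
    (support : ∀ e e', (∀ i < d + 1, e i = e' i) → (P e ↔ P e')) :
    Sigma1Definable fun e => ¬ P e := by
  induction d generalizing P with
  | zero =>
    have P_isSet := hCA (fun n => P fun _ => n) (Definable.rename P fun _ => 0)
    refine Definable.of_iff (Q := fun e => e 0 ∉ {n | P fun _ => n}) fun e => not_congr ?_
    exact support _ _ fun i hi => by rw [Nat.lt_one_iff.1 hi]
  | succ d ih =>
    have contract_support (e e' : ℕ → M.Num) (he : ∀ i < d + 1, e i = e' i) :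
        contract P e ↔ contract P e' := by
      have matrix_iff (a b : M.Num) : P (scons a (scons b fun i => e (i + 1))) ↔
          P (scons a (scons b fun i => e' (i + 1))) :=
        support _ _ fun
          | 0, _ => rfl
          | 1, _ => rfl
          | i + 2, hi => he (i + 1) (by omega)
      simp only [contract, matrix_iff, he 0 d.succ_pos]
    have not_contract_definable := ih (contract P) contract_support
    have not_definable := Sigma1Definable.scons_term (fun e => ¬ contract P e)
      (fun e => pair (e 0) (e 1)) 2
    simpa only [contract_scons_pair] using not_definable

theorem Sigma1Comprehension.not (hCA : M.Sigma1Comprehension) (P : (ℕ → M.Num) → Prop)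
    [Sigma1Definable P] : Sigma1Definable fun e => ¬ P e := by
  obtain ⟨d, support⟩ := Definable.exists_support (C := IsSigma1) P
  exact hCA.not_of_support d P fun e e' h => support e e' fun i hi => h i (by omega)

omit hM in
theorem Sigma1Definable.holds_ex {φ : ArithFormula M.sets}
    (h : Sigma1Definable fun e => M.Holds φ e) : Sigma1Definable fun e => M.Holds (.ex φ) e := by
  have matrix_definable :
      Sigma1Definable fun e : ℕ → M.Num => M.Holds φ (scons (e 0) fun i => e (i + 1)) := by
    simpa only [scons_zero_succ] using h
  exact Sigma1Definable.ex fun a e => M.Holds φ (scons a e)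

theorem Sigma1Comprehension.holds (hCA : M.Sigma1Comprehension) (φ : ArithFormula M.sets) :
    Sigma1Definable fun e => M.Holds φ e := by
  induction φ with
  | eq s t =>
    have holds_definable := BoundedDefinable.holds (M := M) (.eq s t)
    infer_instance
  | lt s t =>
    have holds_definable := BoundedDefinable.holds (M := M) (.lt s t)
    infer_instance
  | mem s X =>
    have holds_definable := BoundedDefinable.holds (M := M) (.mem s X)
    infer_instance
  | neg φ ih => exact hCA.not _
  | and φ ψ hφ hψ => exact Sigma1Definable.and _ _
  | or φ ψ hφ hψ => exact Sigma1Definable.or _ _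
  | imp φ ψ hφ hψ =>
    have not_φ := hCA.not (M.Holds φ)
    exact Definable.of_iff (Q := fun e => ¬ M.Holds φ e ∨ M.Holds ψ e) fun _ => imp_iff_not_or
  | iff φ ψ hφ hψ =>
    have not_φ := hCA.not (M.Holds φ)
    have not_ψ := hCA.not (M.Holds ψ)
    exact Definable.of_iff (Q := fun e => M.Holds φ e ∧ M.Holds ψ e ∨
      ¬ M.Holds φ e ∧ ¬ M.Holds ψ e) fun _ => iff_iff_and_or_not_and_not
  | ex φ ih => exact ih.holds_ex
  | all φ ih =>
    have not_φ : Sigma1Definable fun e => M.Holds (.neg φ) e := hCA.not _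
    have ex_not_φ := not_φ.holds_ex
    exact (hCA.not (M.Holds (.ex (.neg φ)))).of_iff (Q := _) fun e => by
      simp only [Holds, not_exists, not_not]

theorem Sigma1Comprehension.modelsACA0 (hCA : M.Sigma1Comprehension) : M.ModelsACA0 := by
  refine ⟨hM.out.basic, fun X hX zero succ n => ?_, fun φ s => ?_⟩
  · have X_isSet := IsSet.mk hX
    exact induction_on (· ∈ X) n zero succ
  · have holds_definable := hCA.holds φ
    have matrix_definable : Sigma1Definable fun e : ℕ → M.Num => M.Holds φ (scons (e 0) s) :=
      (Definable.subst _ (scons (.inl 0) (Sum.inr ∘ s)) (hP := holds_definable)).of_iff (Q := _)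
        fun e => by rw [comp_scons]; rfl
    exact (hCA (fun n => M.Holds φ (scons n s)) matrix_definable).mem

/-! ## Sequential completeness -/

theorem Sigma1Comprehension.exists_choice (hCA : M.Sigma1Comprehension)
    (P : M.Num → M.Num → Prop) [Sigma1Definable fun e => P (e 1) (e 0)] (h : ∀ k, ∃ n, P k n) :
    ∃ f : M.Num → M.Num, (∀ k, P k (f k)) ∧ Sigma1Definable fun e => e 0 = f (e 1) := by
  have exists_least_choice (k : M.Num) : ∃ n, P k n ∧ ∀ n' < n, ¬ P k n' := by
    have section_definable : Sigma1Definable fun e => P k (e 0) :=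
      Definable.subst (fun e => P (e 1) (e 0)) (fun i => if i = 1 then .inr k else .inl 0)
    have section_isSet := hCA (P k) section_definable
    exact exists_least (· ∈ {n | P k n}) (h k)
  choose f hf f_least using exists_least_choice
  refine ⟨f, hf, ?_⟩
  have smaller_definable : Sigma1Definable fun e : ℕ → M.Num => P (e 2) (e 0) :=
    Definable.rename (fun e : ℕ → M.Num => P (e 1) (e 0)) (2 * ·)
  have no_smaller_definable := hCA.not fun e => ∃ n, n < e 0 ∧ P (e 1) n
  refine Definable.of_iff
    (Q := fun e => P (e 1) (e 0) ∧ ¬ ∃ n, n < e 0 ∧ P (e 1) n) fun e => ⟨?_, ?_⟩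
  · intro he
    rw [he]
    exact ⟨hf _, fun ⟨n, hn, hPn⟩ => f_least _ n hn hPn⟩
  · rintro ⟨he, no_smaller⟩
    exact le_antisymm (not_lt.1 fun hlt => no_smaller ⟨_, hlt, hf _⟩)
      (not_lt.1 fun hlt => f_least _ _ hlt he)

/-- The `k`-th approximation of the `N`-th real of the sequence `Z` differs from that of some later
real by more than `5 * 2 ^ (-k)`. -/
def HasFarTerm (Z : Set M.Num) (k N : M.Num) : Prop :=
  ∃ m v : M.Num, ∃ q r : PreRat M, N ≤ m ∧ v = pow2 k ∧ q.IsRat ∧ r.IsRat ∧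
    pair (pair k q.code) N ∈ Z ∧ pair (pair k r.code) m ∈ Z ∧
    ((PreRat.ofNums 5 v).Lt (q.sub r) ∨ (PreRat.ofNums 5 v).Lt (r.sub q))

set_option synthInstance.maxSize 4096 in
instance Sigma1Definable.hasFarTerm (Z : Set M.Num) [IsSet Z] (t s : (ℕ → M.Num) → M.Num)
    [TermDefinable t] [TermDefinable s] : Sigma1Definable (fun e => HasFarTerm Z (t e) (s e)) := by
  unfold HasFarTerm
  infer_instance

theorem five_div_pow2_lt_sub_iff (k : M.Num) (q r : M.Rat) :
    (PreRat.ofNums 5 (pow2 k)).Lt (q.1.sub r.1) ↔ 5 * eps k < q.1.val - r.1.val := by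
  rw [PreRat.lt_iff (PreRat.denPos_ofNums (pow2_pos k)) ((rat_denPos q).sub (rat_denPos r)),
    PreRat.val_sub (rat_denPos q) (rat_denPos r), PreRat.val_ofNums, eps, mul_one_div, map_ofNat]

theorem hasFarTerm_iff {Z : Set M.Num} (hZ : ∀ n, IsReal (sect Z n)) {k N : M.Num} :
    HasFarTerm Z k N ↔
      ∃ m, N ≤ m ∧ 5 * eps k < |termSeq (sect Z N) k - termSeq (sect Z m) k| := by
  simp only [lt_abs, neg_sub]
  constructor
  · rintro ⟨m, _, q, r, hm, rfl, hq, hr, hqZ, hrZ, far⟩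
    refine ⟨m, hm, ?_⟩
    rw [← ((hZ N).represents k ⟨q, hq⟩).1 hqZ, ← ((hZ m).represents k ⟨r, hr⟩).1 hrZ]
    exact far.imp (five_div_pow2_lt_sub_iff k ⟨q, hq⟩ ⟨r, hr⟩).1
      (five_div_pow2_lt_sub_iff k ⟨r, hr⟩ ⟨q, hq⟩).1
  · rintro ⟨m, hm, far⟩
    obtain ⟨q, hq⟩ := exists_rat (termSeq (sect Z N) k)
    obtain ⟨r, hr⟩ := exists_rat (termSeq (sect Z m) k)
    rw [← hq, ← hr] at far
    exact ⟨m, _, q.1, r.1, hm, rfl, q.2, r.2, ((hZ N).represents k q).2 hq,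
      ((hZ m).represents k r).2 hr,
      far.imp (five_div_pow2_lt_sub_iff k q r).2 (five_div_pow2_lt_sub_iff k r q).2⟩

theorem not_hasFarTerm_iff {Z : Set M.Num} (hZ : ∀ n, IsReal (sect Z n)) {k N : M.Num} :
    ¬ HasFarTerm Z k N ↔
      ∀ m, N ≤ m → |termSeq (sect Z N) k - termSeq (sect Z m) k| ≤ 5 * eps k := by
  simp only [hasFarTerm_iff hZ, not_exists, not_and, not_lt]

theorem exists_not_hasFarTerm {Z : Set M.Num} (hZ : ∀ n, IsReal (sect Z n))
    (cauchy : ∀ ε : M.Rat, RatPos ε → ∃ N : M.Num, ∀ m n : M.Num, N ≤ m → N ≤ n →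
      DistLe (sect Z m) (sect Z n) ε) (k : M.Num) : ∃ N, ¬ HasFarTerm Z (k + 1) N := by
  obtain ⟨ε, hε⟩ := exists_rat (eps (k + 1))
  obtain ⟨N, hN⟩ := cauchy ε (ratPos_iff.2 (hε ▸ eps_pos _))
  refine ⟨N, (not_hasFarTerm_iff hZ).2 fun m hm => ?_⟩
  have dist_le := (distLe_iff (hZ N).represents (hZ m).represents ε).1 (hN N m le_rfl hm) k
  linarith [eps_succ k, eps_pos k]

theorem eps_add_four (k : M.Num) : eps (k + 4) = eps k / 16 := by
  rw [show k + 4 = k + 1 + 1 + 1 + 1 by ring]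
  simp only [eps_succ]
  ring

/-- The function `N` is a modulus of convergence for the sequence `x` of rapidly converging
sequences. The shift by `4` makes the diagonal sequence `k ↦ x (N k) (k + 4)` converge rapidly. -/
def IsModulus (x : M.Num → M.Num → Fr M.Num) (N : M.Num → M.Num) : Prop :=
  ∀ k m, N k ≤ m → |x (N k) (k + 4) - x m (k + 4)| ≤ 5 * eps (k + 4)

namespace IsModulus

variable {x : M.Num → M.Num → Fr M.Num} {N : M.Num → M.Num}

theorem regular_diagonal (hN : IsModulus x N) (hx : ∀ n, Regular (x n)) :
    Regular fun k => x (N k) (k + 4) := by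
  intro k l hkl
  have near_k := abs_le.1 (hN k _ (le_max_left (N k) (N l)))
  have near_l := abs_le.1 (hN l _ (le_max_right (N k) (N l)))
  have near_max := abs_le.1 (hx (max (N k) (N l)) (k + 4) (l + 4) (by gcongr))
  simp only [eps_add_four] at near_k near_l near_max
  rw [abs_le]
  constructor <;>
    linarith [near_k.1, near_k.2, near_l.1, near_l.2, near_max.1, near_max.2, eps_anti hkl,
      eps_pos k]

theorem abs_sub_diagonal_le (hN : IsModulus x N) (hx : ∀ n, Regular (x n)) {k n : M.Num}
    (hn : N k ≤ n) (i : M.Num) :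
    |x n (i + 1) - x (N (i + 1)) (i + 1 + 4)| ≤ 2 * eps k + eps i := by
  have near_n := abs_le.1 ((hx n).abs_sub_le (i + 1) (k + 4))
  have near_modulus := abs_le.1 (hN k n hn)
  have near_diagonal := abs_le.1 ((hN.regular_diagonal hx).abs_sub_le k (i + 1))
  rw [eps_succ, eps_add_four] at near_n
  rw [eps_add_four] at near_modulus
  rw [eps_succ] at near_diagonal
  rw [abs_le]
  constructor <;>
    linarith [near_n.1, near_n.2, near_modulus.1, near_modulus.2, near_diagonal.1,
      near_diagonal.2, eps_pos k]

end IsModulus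

theorem Sigma1Comprehension.exists_isModulus (hCA : M.Sigma1Comprehension) {Z : Set M.Num}
    [IsSet Z] (hZ : ∀ n, IsReal (sect Z n))
    (cauchy : ∀ ε : M.Rat, RatPos ε → ∃ N : M.Num, ∀ m n : M.Num, N ≤ m → N ≤ n →
      DistLe (sect Z m) (sect Z n) ε) :
    ∃ N : M.Num → M.Num, IsModulus (fun n => termSeq (sect Z n)) N ∧
      Sigma1Definable fun e => e 0 = N (e 1) := by
  have near_definable : Sigma1Definable fun e : ℕ → M.Num => ¬ HasFarTerm Z (e 1 + 4) (e 0) :=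
    hCA.not _
  obtain ⟨N, hN, N_definable⟩ :=
    hCA.exists_choice (fun k N => ¬ HasFarTerm Z (k + 4) N) fun k => by
      simpa only [add_assoc, three_add_one_eq_four] using exists_not_hasFarTerm hZ cauchy (k + 3)
  exact ⟨N, fun k => (not_hasFarTerm_iff hZ).1 (hN k), N_definable⟩

theorem exists_isReal_diagonal {Z : Set M.Num} [IsSet Z] (hZ : ∀ n, IsReal (sect Z n))
    {N : M.Num → M.Num} [Sigma1Definable fun e => e 0 = N (e 1)]
    (hN : IsModulus (fun n => termSeq (sect Z n)) N) :
    ∃ z, IsReal z ∧ Represents z fun k => termSeq (sect Z (N k)) (k + 4) := by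
  have graph_definable : Sigma1Definable fun e : ℕ → M.Num => e 0 = N (e 5) :=
    Definable.rename (fun e : ℕ → M.Num => e 0 = N (e 1)) (5 * ·)
  refine exists_isReal_of_sigma1 _ (hN.regular_diagonal fun n => (hZ n).regular)
    (fun k q => ∃ n : M.Num, n = N k ∧ pair (pair (k + 4) q.code) n ∈ Z) fun k q => ?_
  rw [exists_eq_left]
  exact (hZ (N k)).represents (k + 4) q

theorem Sigma1Comprehension.seqComplete (hCA : M.Sigma1Comprehension) : M.SeqComplete := by
  intro Z hZ Z_inUnit cauchy
  have Z_isSet := IsSet.mk hZ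
  have Z_real (n : M.Num) : IsReal (sect Z n) := (Z_inUnit n).1
  obtain ⟨N, hN, N_definable⟩ := hCA.exists_isModulus Z_real cauchy
  obtain ⟨z, z_real, hz⟩ := exists_isReal_diagonal Z_real hN
  refine ⟨z, inUnit_iff.2 ⟨z_real, fun k => ?_, fun k => ?_⟩, fun ε hε => ?_⟩
  · have nonneg := (inUnit_iff.1 (Z_inUnit (N k))).2.1 (k + 4)
    rw [eps_add_four] at nonneg
    rw [z_real.represents.eq hz]
    linarith [eps_pos k]
  · have le_one := (inUnit_iff.1 (Z_inUnit (N k))).2.2 (k + 4)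
    rw [eps_add_four] at le_one
    rw [z_real.represents.eq hz]
    linarith [eps_pos k]
  · obtain ⟨k, hk⟩ := exists_eps_lt (half_pos (ratPos_iff.1 hε))
    refine ⟨N k, fun n hn => (distLe_iff (Z_real n).represents hz ε).2 fun i => ?_⟩
    exact (hN.abs_sub_diagonal_le (fun n => (Z_real n).regular) hn i).trans
      (by linarith [eps_pos i])

end L2Structure

end SOA

theorem mainTheorem2 (M : SOA.L2Structure.{u}) (hRCA : M.ModelsRCA0) (hCL : M.CousinBaire1) :
    M.SeqComplete ∧ M.ModelsACA0 := by
  have model : Fact M.ModelsRCA0 := ⟨hRCA⟩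
  have comprehension := SOA.L2Structure.sigma1Comprehension_of_cousinBaire1 hCL
  exact ⟨comprehension.seqComplete, comprehension.modelsACA0⟩
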